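/- Let $L_\omega$ be the language of arithmetic in all finite types (type $0$ for $\mathbb N$, type $1$ for $\mathbb N^{\mathbb N}$, type $2$ for functionals from type $1$ to type $0$, and so on). Let $\mathsf{RCA}_0^\omega$ be Kohlenbach's base theory: classical logic, the axioms for zero and successor, the combinators, and primitive recursion of type $0$, the axiom of extensionality at all types, induction for quantifier-free formulas, and the quantifier-free axiom of choice $\mathsf{QF\text{-}AC}^{1,0}$. Let $\mathsf{ACA}_0^\omega=\mathsf{RCA}_0^\omega+(\exists^2)$, where $(\exists^2)$ is $$(\exists \varphi^2\le_2 1)(\forall f^1)\big[(\exists n)(f(n)=0)\leftrightarrow \varphi(f)=0\big].$$ Let $\mathsf{IND}_0$ be the axiom: if for every $n\in\mathbb N$ there is at most one $f\in 2^{\mathbb N}$ with $Y(f,n)=0$, then for every $k\in\mathbb N$ there is a finite sequence $w$ of elements of $\mathbb N^{\mathbb N}$ such that for all $m\le k$ $$(\exists i<|w|)\big(w(i)\in 2^{\mathbb N}\wedge Y(w(i),m)=0\big)\leftrightarrow(\exists f\in 2^{\mathbb N})(Y(f,m)=0).$$ Within $L_\omega$, real numbers are represented by fast-converging Cauchy sequences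 of (codes of) rationals ($|q_n-q_{n+i}|<2^{-n}$), functions on $[0,1]$ by functionals respecting equality of reals, and sets of reals by characteristic functions respecting equality of reals. A set of reals is Borel if it belongs to every $\sigma$-algebra of sets of reals (given by a characteristic functional, and closed under complements and under unions of sequences) that contains all open intervals. A function $f:[0,1]\to\mathbb R$ is Borel if $\{x\in[0,1]:f(x)>a\}$ is a Borel set for every $a\in\mathbb R$, and it is upper semi-continuous if $f(x_0)\ge\limsup_{x\to x_0}f(x)$ for every $x_0\in[0,1]$. Consider the following statements of $L_\omega$. * $\mathsf{NIN}$: there is no injection from $[0,1]$ to $\mathbb N$. * $\mathsf{HBU}_{\mathsf{semi}}$ (resp. $\mathsf{HBU}_{\mathsf{Borel}}$): for every upper semi-continuous (resp. Borel) function $\Psi:[0,1]\to\mathbb R^+$ there are finitely many $y_0,\dots,y_k\in[0,1]$ such that $[0,1]\subset\bigcup_{i\le k}B(y_i,\Psi(y_i))$, where $B(y,r)$ is the open ball with centre $y$ and radius $r$. **Theorem.** 1. The theory $\mathsf{ACA}_0^\omega+\mathsf{IND}_0$ proves $\mathsf{HBU}_{\mathsf{semi}}\rightarrow\mathsf{NIN}$.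 2. The theory $\mathsf{ACA}_0^\omega$ proves $\mathsf{HBU}_{\mathsf{Borel}}\rightarrow\mathsf{NIN}$. -/

import Mathlib

/-!  Higher-order arithmetic: the language of all finite types, classical many-sorted natural
deduction, the theories `RCA₀^ω` and `ACA₀^ω`, and the formalisation of real numbers, NIN and
(restrictions of) Cousin's lemma in that language.  All principles (including statements about
real numbers, sets of reals and functions) are formulas of the object language. -/

namespace HigherOrder

/-! ### Finite types, terms and formulas -/

/-- Finite types over the natural numbers; `N` is the type `0`. -/
inductive Ty : Type
  | N : Ty
  | arr : Ty → Ty → Ty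

infixr:62 " ⟶ₜ " => Ty.arr

/-- The type `1` of functions from numbers to numbers. -/
abbrev Ty.one : Ty := Ty.N ⟶ₜ Ty.N

/-- The type `2` of functionals from type `1` to type `0`. -/
abbrev Ty.two : Ty := Ty.one ⟶ₜ Ty.N

/-- A typed family of variables `V`, extended by one new variable of type `τ`. -/
inductive Ext (V : Ty → Type) (τ : Ty) : Ty → Type
  | new : Ext V τ τ
  | old {σ : Ty} (v : V σ) : Ext V τ σ

/-- Terms with variables from `V`: zero, successor, the combinators `K` and `S`, and the recursor
`R₀` (for recursion of type `0` only), closed under application. -/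
inductive Tm (V : Ty → Type) : Ty → Type
  | var {τ : Ty} (v : V τ) : Tm V τ
  | zero : Tm V Ty.N
  | succ : Tm V (Ty.N ⟶ₜ Ty.N)
  | K (σ τ : Ty) : Tm V (σ ⟶ₜ τ ⟶ₜ σ)
  | S (ρ σ τ : Ty) : Tm V ((ρ ⟶ₜ σ ⟶ₜ τ) ⟶ₜ (ρ ⟶ₜ σ) ⟶ₜ ρ ⟶ₜ τ)
  | R : Tm V ((Ty.N ⟶ₜ Ty.N ⟶ₜ Ty.N) ⟶ₜ Ty.N ⟶ₜ Ty.N ⟶ₜ Ty.N)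
  | app {σ τ : Ty} (f : Tm V (σ ⟶ₜ τ)) (t : Tm V σ) : Tm V τ

infixl:75 " ⬝ₜ " => Tm.app

/-- Formulas with free variables from `V`.  The only primitive relation is equality of numbers. -/
inductive Fm : (Ty → Type) → Type 1
  | bot {V : Ty → Type} : Fm V
  | eq {V : Ty → Type} (s t : Tm V Ty.N) : Fm V
  | imp {V : Ty → Type} (φ ψ : Fm V) : Fm V
  | all {V : Ty → Type} (τ : Ty) (φ : Fm (Ext V τ)) : Fm V

infix:50 " =ₒ " => Fm.eq
infixr:25 " ⇒ₒ " => Fm.imp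

/-- Simultaneous substitution in terms. -/
def Tm.subst {V W : Ty → Type} (f : (τ : Ty) → V τ → Tm W τ) : {τ : Ty} → Tm V τ → Tm W τ
  | τ, .var v => f τ v
  | _, .zero => .zero
  | _, .succ => .succ
  | _, .K σ τ => .K σ τ
  | _, .S ρ σ τ => .S ρ σ τ
  | _, .R => .R
  | _, .app s t => .app (s.subst f) (t.subst f)

/-- Weakening of a term by one new variable. -/
def Tm.wk {V : Ty → Type} {σ τ : Ty} (t : Tm V τ) : Tm (Ext V σ) τ :=
  t.subst fun _ v => .var (.old v)

postfix:max "⇑" => Tm.wk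

/-- A substitution carried under a quantifier. -/
def liftSubst {V W : Ty → Type} (f : (τ : Ty) → V τ → Tm W τ) (σ : Ty) :
    (τ : Ty) → Ext V σ τ → Tm (Ext W σ) τ
  | _, .new => .var .new
  | τ, .old v => (f τ v)⇑

/-- Simultaneous (capture-free) substitution in formulas. -/
def Fm.subst : {V W : Ty → Type} → ((τ : Ty) → V τ → Tm W τ) → Fm V → Fm W
  | _, _, _, .bot => .bot
  | _, _, f, .eq s t => .eq (s.subst f) (t.subst f)
  | _, _, f, .imp φ ψ => .imp (φ.subst f) (ψ.subst f)
  | _, _, f, .all τ φ => .all τ (φ.subst (liftSubst f τ))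

/-- Weakening of a formula by one new variable. -/
def Fm.wk {V : Ty → Type} {σ : Ty} (φ : Fm V) : Fm (Ext V σ) :=
  φ.subst fun _ v => .var (.old v)

/-- The substitution replacing the newest variable by `t`. -/
def instSubst {V : Ty → Type} {σ : Ty} (t : Tm V σ) : (τ : Ty) → Ext V σ τ → Tm V τ
  | _, .new => t
  | _, .old v => .var v

/-- The instance `φ(t)`. -/
def Fm.inst {V : Ty → Type} {σ : Ty} (φ : Fm (Ext V σ)) (t : Tm V σ) : Fm V :=
  φ.subst (instSubst t)

/-- Quantifier-free formulas. -/
def Fm.QF : {V : Ty → Type} → Fm V → Prop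
  | _, .bot => True
  | _, .eq _ _ => True
  | _, .imp φ ψ => φ.QF ∧ ψ.QF
  | _, .all _ _ => False

/-! Defined connectives.  In `allB τ fun x => φ` and `exB τ fun x => φ`, the argument `x` is the
newly bound variable; terms from outside are used inside after weakening `t⇑`. -/

def Fm.neg {V : Ty → Type} (φ : Fm V) : Fm V := φ ⇒ₒ .bot

def Fm.and {V : Ty → Type} (φ ψ : Fm V) : Fm V := (φ ⇒ₒ ψ.neg).neg

infixr:35 " ∧ₒ " => Fm.and
prefix:40 "¬ₒ " => Fm.neg

def Fm.iff {V : Ty → Type} (φ ψ : Fm V) : Fm V := (φ ⇒ₒ ψ) ∧ₒ (ψ ⇒ₒ φ)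

infix:24 " ⇔ₒ " => Fm.iff

def allB {V : Ty → Type} (τ : Ty) (φ : Tm (Ext V τ) τ → Fm (Ext V τ)) : Fm V :=
  .all τ (φ (.var .new))

def exB {V : Ty → Type} (τ : Ty) (φ : Tm (Ext V τ) τ → Fm (Ext V τ)) : Fm V :=
  ¬ₒ allB τ fun x => ¬ₒ φ x

/-- Equality at all finite types, defined extensionally from equality of numbers. -/
def eqAt : (τ : Ty) → {V : Ty → Type} → Tm V τ → Tm V τ → Fm V
  | .N, _, s, t => s =ₒ t
  | .arr σ τ, _, s, t => allB σ fun x => eqAt τ (s⇑ ⬝ₜ x) (t⇑ ⬝ₜ x)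

/-! ### The calculus -/

/-- A theory: a set of axioms in every context (free variables of an axiom act as parameters). -/
def Theory : Type 1 := (V : Ty → Type) → Set (Fm V)

/-- Classical natural deduction, with equality of numbers, over the axioms of `T`;
`Γ` is the set of open assumptions. -/
inductive Derives (T : Theory) : {V : Ty → Type} → Set (Fm V) → Fm V → Prop
  | ax {V : Ty → Type} {Γ : Set (Fm V)} {φ : Fm V} (h : φ ∈ T V) : Derives T Γ φ
  | hyp {V : Ty → Type} {Γ : Set (Fm V)} {φ : Fm V} (h : φ ∈ Γ) : Derives T Γ φ
  | impI {V : Ty → Type} {Γ : Set (Fm V)} {φ ψ : Fm V}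
      (h : Derives T (insert φ Γ) ψ) : Derives T Γ (φ ⇒ₒ ψ)
  | impE {V : Ty → Type} {Γ : Set (Fm V)} {φ ψ : Fm V}
      (h : Derives T Γ (φ ⇒ₒ ψ)) (h' : Derives T Γ φ) : Derives T Γ ψ
  | raa {V : Ty → Type} {Γ : Set (Fm V)} {φ : Fm V}
      (h : Derives T (insert (¬ₒ φ) Γ) .bot) : Derives T Γ φ
  | allI {V : Ty → Type} {Γ : Set (Fm V)} {τ : Ty} {φ : Fm (Ext V τ)}
      (h : Derives T (Fm.wk '' Γ) φ) : Derives T Γ (.all τ φ)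
  | allE {V : Ty → Type} {Γ : Set (Fm V)} {τ : Ty} {φ : Fm (Ext V τ)}
      (h : Derives T Γ (.all τ φ)) (t : Tm V τ) : Derives T Γ (φ.inst t)
  | eqI {V : Ty → Type} {Γ : Set (Fm V)} (t : Tm V Ty.N) : Derives T Γ (t =ₒ t)
  | eqE {V : Ty → Type} {Γ : Set (Fm V)} {s t : Tm V Ty.N} (φ : Fm (Ext V Ty.N))
      (h : Derives T Γ (s =ₒ t)) (h' : Derives T Γ (φ.inst s)) : Derives T Γ (φ.inst t)

/-- No free variables. -/
abbrev NoVars : Ty → Type := fun _ => Empty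

abbrev Sentence : Type 1 := Fm NoVars

/-- The theory `T` proves the sentence `φ`. -/
def Theory.Proves (T : Theory) (φ : Sentence) : Prop := Derives T ∅ φ

/-- The theory `T` with one more axiom `φ` (a closed formula, given in every context). -/
def Theory.plus (T : Theory) (φ : (V : Ty → Type) → Fm V) : Theory :=
  fun V => insert (φ V) (T V)

/-! ### Numbers -/

section Numbers

variable {V : Ty → Type}

def Tm.S1 (t : Tm V Ty.N) : Tm V Ty.N := Tm.succ ⬝ₜ t

/-- `s + t`, by recursion on `t`. -/
def Tm.add (s t : Tm V Ty.N) : Tm V Ty.N := Tm.R ⬝ₜ (Tm.K _ _ ⬝ₜ Tm.succ) ⬝ₜ s ⬝ₜ t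

infixl:65 " +ₒ " => Tm.add

/-- `s * t`, by recursion on `t`: the step function is `n, u ↦ u + s`. -/
def Tm.mul (s t : Tm V Ty.N) : Tm V Ty.N :=
  Tm.R ⬝ₜ (Tm.K _ _ ⬝ₜ (Tm.S _ _ _ ⬝ₜ (Tm.R ⬝ₜ (Tm.K _ _ ⬝ₜ Tm.succ)) ⬝ₜ (Tm.K _ _ ⬝ₜ s)))
    ⬝ₜ Tm.zero ⬝ₜ t

infixl:70 " *ₒ " => Tm.mul

/-- The identity combinator. -/
def Tm.I (σ : Ty) : Tm V (σ ⟶ₜ σ) := Tm.S σ (σ ⟶ₜ σ) σ ⬝ₜ Tm.K _ _ ⬝ₜ Tm.K _ _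

/-- The numeral `1`. -/
def Tm.n1 : Tm V Ty.N := Tm.zero.S1

/-- The numeral `2`. -/
def Tm.n2 : Tm V Ty.N := Tm.n1.S1

/-- The numeral `4`. -/
def Tm.n4 : Tm V Ty.N := Tm.n2.S1.S1

/-- `2 ^ t`, by recursion on `t`: the step function is `n, u ↦ u + u`. -/
def Tm.pow2 (t : Tm V Ty.N) : Tm V Ty.N :=
  Tm.R ⬝ₜ (Tm.K _ _ ⬝ₜ (Tm.S _ _ _ ⬝ₜ (Tm.R ⬝ₜ (Tm.K _ _ ⬝ₜ Tm.succ)) ⬝ₜ Tm.I _))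
    ⬝ₜ Tm.n1 ⬝ₜ t

def leN (s t : Tm V Ty.N) : Fm V := exB Ty.N fun u => s⇑ +ₒ u =ₒ t⇑

def ltN (s t : Tm V Ty.N) : Fm V := leN s.S1 t

end Numbers

/-! ### The theories -/

/-- In `A(x, y)`, with `x` of type `1` and `y` of type `0` the newest variable, replace `y` by
`Y x`; in the result `Y` of type `2` precedes the newest variable `x`. -/
def choiceSubst (V : Ty → Type) :
    (τ : Ty) → Ext (Ext V Ty.one) Ty.N τ → Tm (Ext (Ext V Ty.two) Ty.one) τ
  | _, .new => Tm.var (.old .new) ⬝ₜ Tm.var .new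
  | _, .old .new => .var .new
  | _, .old (.old v) => .var (.old (.old v))

/-- In `A(n)`, with `n` the newest variable, replace `n` by its successor. -/
def succSubst (V : Ty → Type) : (τ : Ty) → Ext V Ty.N τ → Tm (Ext V Ty.N) τ
  | _, .new => (Tm.var .new).S1
  | _, .old v => .var (.old v)

/-- The axioms of Kohlenbach's base theory `RCA₀^ω`: the defining axioms of successor, the
combinators and the recursor, extensionality, induction for quantifier-free formulas, and the
quantifier-free axiom of choice `QF-AC^{1,0}`. -/
inductive RCAAxiom : {V : Ty → Type} → Fm V → Prop
  | succ_ne {V : Ty → Type} (t : Tm V Ty.N) : RCAAxiom (¬ₒ (t.S1 =ₒ Tm.zero))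
  | succ_inj {V : Ty → Type} (s t : Tm V Ty.N) : RCAAxiom (s.S1 =ₒ t.S1 ⇒ₒ s =ₒ t)
  | comb_K {V : Ty → Type} {σ τ : Ty} (s : Tm V σ) (t : Tm V τ) :
      RCAAxiom (eqAt σ (Tm.K σ τ ⬝ₜ s ⬝ₜ t) s)
  | comb_S {V : Ty → Type} {ρ σ τ : Ty} (r : Tm V (ρ ⟶ₜ σ ⟶ₜ τ)) (s : Tm V (ρ ⟶ₜ σ))
      (t : Tm V ρ) : RCAAxiom (eqAt τ (Tm.S ρ σ τ ⬝ₜ r ⬝ₜ s ⬝ₜ t) (r ⬝ₜ t ⬝ₜ (s ⬝ₜ t)))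
  | rec_zero {V : Ty → Type} (f : Tm V (Ty.N ⟶ₜ Ty.N ⟶ₜ Ty.N)) (m : Tm V Ty.N) :
      RCAAxiom (Tm.R ⬝ₜ f ⬝ₜ m ⬝ₜ Tm.zero =ₒ m)
  | rec_succ {V : Ty → Type} (f : Tm V (Ty.N ⟶ₜ Ty.N ⟶ₜ Ty.N)) (m n : Tm V Ty.N) :
      RCAAxiom (Tm.R ⬝ₜ f ⬝ₜ m ⬝ₜ n.S1 =ₒ f ⬝ₜ n ⬝ₜ (Tm.R ⬝ₜ f ⬝ₜ m ⬝ₜ n))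
  | ext {V : Ty → Type} {σ τ : Ty} (s t : Tm V σ) (f : Tm V (σ ⟶ₜ τ)) :
      RCAAxiom (eqAt σ s t ⇒ₒ eqAt τ (f ⬝ₜ s) (f ⬝ₜ t))
  | qf_ind {V : Ty → Type} (A : Fm (Ext V Ty.N)) (hA : A.QF) :
      RCAAxiom (A.inst Tm.zero ⇒ₒ .all Ty.N (A ⇒ₒ A.subst (succSubst V)) ⇒ₒ .all Ty.N A)
  | qf_ac {V : Ty → Type} (A : Fm (Ext (Ext V Ty.one) Ty.N)) (hA : A.QF) :
      RCAAxiom (.all Ty.one (¬ₒ .all Ty.N (¬ₒ A)) ⇒ₒ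
        ¬ₒ .all Ty.two (¬ₒ .all Ty.one (A.subst (choiceSubst V))))

/-- The theory `RCA₀^ω`. -/
def RCA : Theory := fun _ => {φ | RCAAxiom φ}

/-- The axiom `(∃²)`: there is `E ≤ 1` of type `2` with `(∃ n, f n = 0) ↔ E f = 0` for all `f`. -/
def existsTwo (V : Ty → Type) : Fm V :=
  exB Ty.two fun E =>
    (allB Ty.one fun f => leN (E⇑ ⬝ₜ f) Tm.n1) ∧ₒ
    allB Ty.one fun f => (exB Ty.N fun n => f⇑ ⬝ₜ n =ₒ Tm.zero) ⇔ₒ (E⇑ ⬝ₜ f =ₒ Tm.zero)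

/-- The theory `ACA₀^ω`, i.e. `RCA₀^ω + (∃²)`. -/
def ACA : Theory := RCA.plus existsTwo

/-- `f` is an element of Cantor space. -/
def isBinary {V : Ty → Type} (f : Tm V Ty.one) : Fm V :=
  allB Ty.N fun n => leN (f⇑ ⬝ₜ n) Tm.n1

/-- The axiom `IND₀`.  A finite sequence of elements of type `1` is given by its length `l` and
`w` of type `0 → 1`. -/
def IND (V : Ty → Type) : Fm V :=
  allB (Ty.one ⟶ₜ Ty.N ⟶ₜ Ty.N) fun Y =>
    (allB Ty.N fun n => allB Ty.one fun f => allB Ty.one fun g =>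
      isBinary f⇑ ⇒ₒ isBinary g ⇒ₒ
      Y⇑⇑⇑ ⬝ₜ f⇑ ⬝ₜ n⇑⇑ =ₒ Tm.zero ⇒ₒ Y⇑⇑⇑ ⬝ₜ g ⬝ₜ n⇑⇑ =ₒ Tm.zero ⇒ₒ
      eqAt Ty.one f⇑ g) ⇒ₒ
    allB Ty.N fun k =>
      exB Ty.N fun l => exB (Ty.N ⟶ₜ Ty.one) fun w =>
        allB Ty.N fun m => leN m k⇑⇑⇑ ⇒ₒ
          ((exB Ty.N fun i => ltN i l⇑⇑⇑ ∧ₒ isBinary (w⇑⇑ ⬝ₜ i) ∧ₒ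
              Y⇑⇑⇑⇑⇑ ⬝ₜ (w⇑⇑ ⬝ₜ i) ⬝ₜ m⇑ =ₒ Tm.zero) ⇔ₒ
            exB Ty.one fun f => isBinary f ∧ₒ Y⇑⇑⇑⇑⇑ ⬝ₜ f ⬝ₜ m⇑ =ₒ Tm.zero)

/-! ### Rational and real numbers -/

section Reals

variable {V : Ty → Type}

/-- `c` is the code of the pair `(a, b)`, i.e. `c = (a + b) (a + b + 1) / 2 + b`. -/
def isPair (c a b : Tm V Ty.N) : Fm V :=
  c +ₒ c =ₒ (a +ₒ b) *ₒ (a +ₒ b).S1 +ₒ (b +ₒ b)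

/-- `q` codes the rational number `(a - b) / (d + 1)`; every number codes exactly one triple. -/
def isRat (q a b d : Tm V Ty.N) : Fm V :=
  exB Ty.N fun p => isPair p a⇑ b⇑ ∧ₒ isPair q⇑ p d⇑

/-- A rational number `(pos - neg) / den` given by three terms (with `den` positive). -/
structure Frac (V : Ty → Type) where
  pos : Tm V Ty.N
  neg : Tm V Ty.N
  den : Tm V Ty.N

def Frac.wk {σ : Ty} (q : Frac V) : Frac (Ext V σ) := ⟨q.pos⇑, q.neg⇑, q.den⇑⟩

def Frac.add (q r : Frac V) : Frac V :=
  ⟨q.pos *ₒ r.den +ₒ r.pos *ₒ q.den, q.neg *ₒ r.den +ₒ r.neg *ₒ q.den, q.den *ₒ r.den⟩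

def Frac.lt (q r : Frac V) : Fm V :=
  ltN (q.pos *ₒ r.den +ₒ r.neg *ₒ q.den) (r.pos *ₒ q.den +ₒ q.neg *ₒ r.den)

def Frac.le (q r : Frac V) : Fm V :=
  leN (q.pos *ₒ r.den +ₒ r.neg *ₒ q.den) (r.pos *ₒ q.den +ₒ q.neg *ₒ r.den)

/-- The rational number `c * 2 ^ (-n)`. -/
def Frac.scaled (c n : Tm V Ty.N) : Frac V := ⟨c, Tm.zero, n.pow2⟩

/-- `φ(r)`, where `r` is the rational number coded by `q`. -/
def withRat (q : Tm V Ty.N)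
    (φ : Frac (Ext (Ext (Ext V Ty.N) Ty.N) Ty.N) → Fm (Ext (Ext (Ext V Ty.N) Ty.N) Ty.N)) : Fm V :=
  exB Ty.N fun a => exB Ty.N fun b => exB Ty.N fun d =>
    isRat q⇑⇑⇑ a⇑⇑ b⇑ d ∧ₒ φ ⟨a⇑⇑, b⇑, d.S1⟩

/-- `x` is a real number: `|x(n) - x(n+i)| < 2 ^ (-n)` for all `n, i`. -/
def isReal (x : Tm V Ty.one) : Fm V :=
  allB Ty.N fun n => allB Ty.N fun i =>
    withRat (x⇑⇑ ⬝ₜ n⇑) fun q => withRat (x⇑⇑⇑⇑⇑ ⬝ₜ (n⇑⇑⇑⇑ +ₒ i⇑⇑⇑)) fun r =>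
      Frac.lt q.wk.wk.wk (r.add (.scaled Tm.n1 n⇑⇑⇑⇑⇑⇑⇑)) ∧ₒ
      Frac.lt r (q.wk.wk.wk.add (.scaled Tm.n1 n⇑⇑⇑⇑⇑⇑⇑))

/-- `x =_ℝ y`, i.e. `|x(n) - y(n)| ≤ 2 * 2 ^ (-n)` for all `n`. -/
def eqR (x y : Tm V Ty.one) : Fm V :=
  allB Ty.N fun n =>
    withRat (x⇑ ⬝ₜ n) fun q => withRat (y⇑⇑⇑⇑ ⬝ₜ n⇑⇑⇑) fun r =>
      Frac.le q.wk.wk.wk (r.add (.scaled Tm.n2 n⇑⇑⇑⇑⇑⇑)) ∧ₒ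
      Frac.le r (q.wk.wk.wk.add (.scaled Tm.n2 n⇑⇑⇑⇑⇑⇑))

/-- `x <_ℝ y`, i.e. `x(n) + 2 * 2 ^ (-n) < y(n)` for some `n`. -/
def ltR (x y : Tm V Ty.one) : Fm V :=
  exB Ty.N fun n =>
    withRat (x⇑ ⬝ₜ n) fun q => withRat (y⇑⇑⇑⇑ ⬝ₜ n⇑⇑⇑) fun r =>
      Frac.lt (q.wk.wk.wk.add (.scaled Tm.n2 n⇑⇑⇑⇑⇑⇑)) r

/-- `x <_ℝ y + z`, i.e. `x(n) + 4 * 2 ^ (-n) < y(n) + z(n)` for some `n`. -/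
def ltAddR (x y z : Tm V Ty.one) : Fm V :=
  exB Ty.N fun n =>
    withRat (x⇑ ⬝ₜ n) fun q => withRat (y⇑⇑⇑⇑ ⬝ₜ n⇑⇑⇑) fun r =>
      withRat (z⇑⇑⇑⇑⇑⇑⇑ ⬝ₜ n⇑⇑⇑⇑⇑⇑) fun s =>
        Frac.lt (q.wk.wk.wk.wk.wk.wk.add (.scaled Tm.n4 n⇑⇑⇑⇑⇑⇑⇑⇑⇑)) (r.wk.wk.wk.add s)

/-- `|x - y| <_ℝ z`, i.e. `x` lies in the open ball `B(y, z)`. -/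
def inBall (x y z : Tm V Ty.one) : Fm V := ltAddR x y z ∧ₒ ltAddR y x z

/-- The real number `0` (the number `0` codes the rational `(0 - 0) / 1`). -/
def zeroR : Tm V Ty.one := Tm.K _ _ ⬝ₜ Tm.zero

/-- The real number `1` (the number `1` codes the rational `(1 - 0) / 1`). -/
def oneR : Tm V Ty.one := Tm.K _ _ ⬝ₜ Tm.n1

/-- `x ∈ [0,1]`. -/
def inUnit (x : Tm V Ty.one) : Fm V := isReal x ∧ₒ ¬ₒ ltR x zeroR ∧ₒ ¬ₒ ltR oneR x

/-! ### The principles -/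

/-- NIN: there is no injection from `[0,1]` to the natural numbers. -/
def NIN (V : Ty → Type) : Fm V :=
  ¬ₒ exB Ty.two fun Y =>
    allB Ty.one fun x => allB Ty.one fun y => inUnit x⇑ ⇒ₒ inUnit y ⇒ₒ
      (eqR x⇑ y ⇔ₒ Y⇑⇑ ⬝ₜ x⇑ =ₒ Y⇑⇑ ⬝ₜ y)

/-- `Ψ` is a function from `[0,1]` to the positive reals (it respects `=_ℝ`). -/
def isGauge (Ψ : Tm V (Ty.one ⟶ₜ Ty.one)) : Fm V :=
  (allB Ty.one fun x => inUnit x ⇒ₒ isReal (Ψ⇑ ⬝ₜ x) ∧ₒ ltR zeroR (Ψ⇑ ⬝ₜ x)) ∧ₒ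
  allB Ty.one fun x => allB Ty.one fun y => inUnit x⇑ ⇒ₒ inUnit y ⇒ₒ
    eqR x⇑ y ⇒ₒ eqR (Ψ⇑⇑ ⬝ₜ x⇑) (Ψ⇑⇑ ⬝ₜ y)

/-- Some `y_0, …, y_k ∈ [0,1]` satisfy `[0,1] ⊆ ⋃ i ≤ k, B(y_i, Ψ(y_i))`. -/
def hasFiniteCover (Ψ : Tm V (Ty.one ⟶ₜ Ty.one)) : Fm V :=
  exB Ty.N fun k => exB (Ty.N ⟶ₜ Ty.one) fun y =>
    (allB Ty.N fun i => leN i k⇑⇑ ⇒ₒ inUnit (y⇑ ⬝ₜ i)) ∧ₒ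
    allB Ty.one fun x => inUnit x ⇒ₒ
      exB Ty.N fun i => leN i k⇑⇑⇑ ∧ₒ inBall x⇑ (y⇑⇑ ⬝ₜ i) (Ψ⇑⇑⇑⇑ ⬝ₜ (y⇑⇑ ⬝ₜ i))

/-- `f : [0,1] → ℝ` is upper semi-continuous: for every `x₀ ∈ [0,1]` and `ε > 0` there is `δ > 0`
such that `f(x) < f(x₀) + ε` for all `x ∈ [0,1]` with `|x - x₀| < δ`. -/
def isUSC (f : Tm V (Ty.one ⟶ₜ Ty.one)) : Fm V :=
  allB Ty.one fun x₀ => inUnit x₀ ⇒ₒ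
    allB Ty.one fun ε => isReal ε ⇒ₒ ltR zeroR ε ⇒ₒ
      exB Ty.one fun δ => isReal δ ∧ₒ ltR zeroR δ ∧ₒ
        allB Ty.one fun x => inUnit x ⇒ₒ inBall x x₀⇑⇑⇑ δ⇑ ⇒ₒ
          ltAddR (f⇑⇑⇑⇑ ⬝ₜ x) (f⇑⇑⇑⇑ ⬝ₜ x₀⇑⇑⇑) ε⇑⇑

/-- `A` represents a set of reals: its values on reals are `0` or `1` and it respects `=_ℝ`. -/
def isSet (A : Tm V Ty.two) : Fm V :=
  (allB Ty.one fun x => isReal x ⇒ₒ leN (A⇑ ⬝ₜ x) Tm.n1) ∧ₒ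
  allB Ty.one fun x => allB Ty.one fun y => isReal x⇑ ⇒ₒ isReal y ⇒ₒ
    eqR x⇑ y ⇒ₒ A⇑⇑ ⬝ₜ x⇑ =ₒ A⇑⇑ ⬝ₜ y

/-- `x ∈ A`, for a set `A` given by its characteristic function. -/
def isMem {σ : Ty} (x : Tm V σ) (A : Tm V (σ ⟶ₜ Ty.N)) : Fm V := A ⬝ₜ x =ₒ Tm.n1

/-- `𝒮` is (the characteristic function of) a σ-algebra of sets of reals that contains the open
intervals. -/
def isSigmaAlgebra (𝒮 : Tm V (Ty.two ⟶ₜ Ty.N)) : Fm V :=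
  (allB Ty.two fun A => isSet A ⇒ₒ leN (𝒮⇑ ⬝ₜ A) Tm.n1) ∧ₒ
  (allB Ty.one fun a => allB Ty.one fun b => allB Ty.two fun A =>
    isReal a⇑⇑ ⇒ₒ isReal b⇑ ⇒ₒ isSet A ⇒ₒ
    (allB Ty.one fun x => isReal x ⇒ₒ (isMem x A⇑ ⇔ₒ ltR a⇑⇑⇑ x ∧ₒ ltR x b⇑⇑)) ⇒ₒ
    isMem A 𝒮⇑⇑⇑) ∧ₒ
  (allB Ty.two fun A => allB Ty.two fun B =>
    isSet A⇑ ⇒ₒ isSet B ⇒ₒ isMem A⇑ 𝒮⇑⇑ ⇒ₒ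
    (allB Ty.one fun x => isReal x ⇒ₒ (isMem x B⇑ ⇔ₒ ¬ₒ isMem x A⇑⇑)) ⇒ₒ
    isMem B 𝒮⇑⇑) ∧ₒ
  (allB (Ty.N ⟶ₜ Ty.two) fun A => allB Ty.two fun B =>
    (allB Ty.N fun n => isSet (A⇑⇑ ⬝ₜ n) ∧ₒ isMem (A⇑⇑ ⬝ₜ n) 𝒮⇑⇑⇑) ⇒ₒ isSet B ⇒ₒ
    (allB Ty.one fun x => isReal x ⇒ₒ
      (isMem x B⇑ ⇔ₒ exB Ty.N fun n => isMem x⇑ (A⇑⇑⇑ ⬝ₜ n))) ⇒ₒ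
    isMem B 𝒮⇑⇑)

/-- `B` is a Borel set of reals: it belongs to every σ-algebra containing the open intervals. -/
def isBorelSet (B : Tm V Ty.two) : Fm V :=
  isSet B ∧ₒ allB (Ty.two ⟶ₜ Ty.N) fun 𝒮 => isSigmaAlgebra 𝒮 ⇒ₒ isMem B⇑ 𝒮

/-- `f : [0,1] → ℝ` is a Borel function: for every real `a`, `{x ∈ [0,1] : f(x) > a}` is a Borel
set. -/
def isBorelFun (f : Tm V (Ty.one ⟶ₜ Ty.one)) : Fm V :=
  allB Ty.one fun a => isReal a ⇒ₒ
    exB Ty.two fun B => isBorelSet B ∧ₒ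
      allB Ty.one fun x => isReal x ⇒ₒ
        (isMem x B⇑ ⇔ₒ inUnit x ∧ₒ ltR a⇑⇑ (f⇑⇑⇑ ⬝ₜ x))

/-- Cousin's lemma for upper semi-continuous gauges. -/
def HBUsemi (V : Ty → Type) : Fm V :=
  allB (Ty.one ⟶ₜ Ty.one) fun Ψ => isGauge Ψ ⇒ₒ isUSC Ψ ⇒ₒ hasFiniteCover Ψ

/-- Cousin's lemma for Borel gauges. -/
def HBUBorel (V : Ty → Type) : Fm V :=
  allB (Ty.one ⟶ₜ Ty.one) fun Ψ => isGauge Ψ ⇒ₒ isBorelFun Ψ ⇒ₒ hasFiniteCover Ψ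

end Reals

end HigherOrder

/-! Both derivations are obtained semantically. By the completeness theorem
`Theory.proves_of_forall_models` it suffices to verify the implications in every extensional model,
and the mathematics is then done inside an arbitrary model of `ACA`. Its numbers may be nonstandard,
so the usual ℕ, ℚ and ℝ are not available. The numbers of the model form an ordered semiring, its
fractions an ordered field `Mdl.F`, and reals are internal Cauchy sequences, compared through the
cuts `Gt` and `Lt` in that field. Induction, search and sets exist only for internally definable
data; the classes `Dfn`, `DfnP` and `DfnF` find definability by instance search, with (∃²) supplying
closure under number quantifiers.

Suppose `Y` injects [0,1] into the numbers, and put Ψ(x) = 4^(-(Y(x)+1)). No finite family of balls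
B(y_i, Ψ(y_i)) covers [0,1] (`not_hasFiniteCover`). In place of measure theory there is a nested
interval argument. Cut the current interval of length 4^(-m) into quarters; up to equality of reals
at most one centre has Y-value m, and its ball has the length of a quarter as radius. According to
the side of the midpoint on which that centre lies, the first or the last quarter misses the ball.
Beyond a bound for the finitely many values Y(y_i), the left endpoint is a rational number in no
ball. So Cousin's lemma fails for Ψ, and only the regularity of Ψ remains.

Borel case (`IsInjGauge.exists_borel`): {Ψ > a} is the union over m of its parts with Y = m, each of
which is empty or a single point. A point is the complement of a countable union of rational
intervals.

Semi-continuous case (`IsInjGauge.isUSC`): only finitely many points have Y-value at most Y(x₀), so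
near x₀ every other point has a larger Y-value and a smaller Ψ. To speak of finitely many points,
`IND` must list them; as it concerns Cantor space and literal uniqueness, reals are coded by the
characteristic functions of their lower cuts, from which `exists_cutReal` recovers them. Given the
list, `exists_bound` yields one radius that excludes all of its members different from x₀. -/

namespace HigherOrder

/-! ### Substitution -/

section Substitution

variable {V W X : Ty → Type}

theorem Tm.subst_subst (f : (τ : Ty) → V τ → Tm W τ) (g : (τ : Ty) → W τ → Tm X τ) {τ : Ty}
    (t : Tm V τ) : (t.subst f).subst g = t.subst fun σ v => (f σ v).subst g := by
  induction t with
  | app s t hs ht => simp only [Tm.subst, hs, ht]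
  | _ => rfl

theorem Tm.subst_var {τ : Ty} (t : Tm V τ) : t.subst (fun _ v => .var v) = t := by
  induction t with
  | app s t hs ht => simp only [Tm.subst, hs, ht]
  | _ => rfl

theorem Tm.wk_subst {σ τ : Ty} (t : Tm V τ) (f : (τ : Ty) → Ext V σ τ → Tm W τ) :
    t⇑.subst f = t.subst fun ρ v => f ρ (.old v) := by
  simp only [Tm.wk, Tm.subst_subst, Tm.subst]

theorem Tm.subst_wk {σ τ : Ty} (t : Tm V τ) (f : (τ : Ty) → V τ → Tm W τ) :
    (t.subst f).wk (σ := σ) = t.subst fun ρ v => (f ρ v)⇑ := by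
  simp only [Tm.wk, Tm.subst_subst]

theorem liftSubst_subst (f : (τ : Ty) → V τ → Tm W τ) (g : (τ : Ty) → W τ → Tm X τ) (σ : Ty) :
    (fun τ v => (liftSubst f σ τ v).subst (liftSubst g σ)) =
      liftSubst (fun τ v => (f τ v).subst g) σ := by
  funext τ v
  cases v with
  | new => rfl
  | old v => simp only [liftSubst, Tm.wk_subst, Tm.subst_wk]

theorem Fm.subst_subst (φ : Fm V) : ∀ {W X : Ty → Type} (f : (τ : Ty) → V τ → Tm W τ)
    (g : (τ : Ty) → W τ → Tm X τ),
    (φ.subst f).subst g = φ.subst fun σ v => (f σ v).subst g := by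
  induction φ with
  | bot => intros; rfl
  | eq s t => intros; simp only [Fm.subst, Tm.subst_subst]
  | imp φ ψ hφ hψ => intros; simp only [Fm.subst, hφ, hψ]
  | all τ φ h => intros; simp only [Fm.subst, h, liftSubst_subst]

theorem liftSubst_var (σ : Ty) :
    liftSubst (fun (τ : Ty) (v : V τ) => Tm.var v) σ = fun _ v => .var v := by
  funext τ v
  cases v <;> rfl

theorem Fm.subst_var (φ : Fm V) : φ.subst (fun _ v => .var v) = φ := by
  induction φ with
  | bot => rfl
  | eq s t => simp only [Fm.subst, Tm.subst_var]
  | imp φ ψ hφ hψ => simp only [Fm.subst, hφ, hψ]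
  | all τ φ h => simp only [Fm.subst, liftSubst_var, h]

/-- Extend a substitution by a value for the newest variable. -/
def consSubst {σ : Ty} (f : (τ : Ty) → V τ → Tm W τ) (t : Tm W σ) :
    (τ : Ty) → Ext V σ τ → Tm W τ
  | _, .new => t
  | τ, .old v => f τ v

theorem Fm.inst_subst {σ : Ty} (φ : Fm (Ext V σ)) (t : Tm V σ) (f : (τ : Ty) → V τ → Tm W τ) :
    (φ.inst t).subst f = φ.subst (consSubst f (t.subst f)) := by
  rw [Fm.inst, Fm.subst_subst]
  congr 1
  funext τ v
  cases v <;> rfl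

theorem Fm.subst_lift_inst {σ : Ty} (φ : Fm (Ext V σ)) (f : (τ : Ty) → V τ → Tm W τ)
    (t : Tm W σ) : (φ.subst (liftSubst f σ)).inst t = φ.subst (consSubst f t) := by
  rw [Fm.inst, Fm.subst_subst]
  congr 1
  funext τ v
  cases v with
  | new => rfl
  | old v => simp only [liftSubst, Tm.wk_subst, instSubst, consSubst, Tm.subst_var]

theorem Fm.inst_subst' {σ : Ty} (φ : Fm (Ext V σ)) (t : Tm V σ) (f : (τ : Ty) → V τ → Tm W τ) :
    (φ.inst t).subst f = (φ.subst (liftSubst f σ)).inst (t.subst f) := by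
  rw [Fm.inst_subst, Fm.subst_lift_inst]

theorem Fm.wk_subst_lift {σ : Ty} (φ : Fm V) (f : (τ : Ty) → V τ → Tm W τ) :
    (φ.wk (σ := σ)).subst (liftSubst f σ) = (φ.subst f).wk := by
  simp only [Fm.wk, Fm.subst_subst, Tm.subst, liftSubst]
  rfl

theorem eqAt_subst : ∀ (τ : Ty) {V W : Ty → Type} (s t : Tm V τ) (f : (τ : Ty) → V τ → Tm W τ),
    (eqAt τ s t).subst f = eqAt τ (s.subst f) (t.subst f)
  | .N, _, _, _, _, _ => rfl
  | .arr σ τ, _, _, s, t, f => by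
    simp only [eqAt, allB, Fm.subst, eqAt_subst τ, Tm.subst, Tm.wk_subst, Tm.subst_wk, liftSubst]

end Substitution

/-! ### Occurrences of variables -/

section Occurrences

variable {V W : Ty → Type}

/-- The variables of a term. -/
def Tm.occ : {τ : Ty} → Tm V τ → Set (Σ τ, V τ)
  | τ, .var v => {⟨τ, v⟩}
  | _, .app s t => s.occ ∪ t.occ
  | _, _ => ∅

/-- The free variables of a formula. -/
def Fm.occ : {V : Ty → Type} → Fm V → Set (Σ τ, V τ)
  | _, .bot => ∅
  | _, .eq s t => s.occ ∪ t.occ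
  | _, .imp φ ψ => φ.occ ∪ ψ.occ
  | _, .all _ φ => {v | ⟨v.1, .old v.2⟩ ∈ φ.occ}

theorem Tm.occ_finite {τ : Ty} (t : Tm V τ) : t.occ.Finite := by
  induction t with
  | var v => exact Set.finite_singleton _
  | app s t hs ht => exact hs.union ht
  | _ => exact Set.finite_empty

/-- This guarantees an unused variable at each stage of the Henkin construction. -/
theorem Fm.occ_finite (φ : Fm V) : φ.occ.Finite := by
  induction φ with
  | bot => exact Set.finite_empty
  | eq s t => exact s.occ_finite.union t.occ_finite
  | imp φ ψ hφ hψ => exact hφ.union hψ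
  | all τ φ h =>
    refine Set.Finite.preimage (f := fun v : Σ σ, _ => (⟨v.1, .old v.2⟩ : Σ σ, Ext _ τ σ)) ?_ h
    rintro ⟨a, v⟩ - ⟨b, w⟩ - h
    simp only [Sigma.mk.injEq] at h
    obtain ⟨rfl, h⟩ := h
    cases eq_of_heq h
    rfl

theorem Tm.subst_congr {f g : (τ : Ty) → V τ → Tm W τ} {τ : Ty} (t : Tm V τ)
    (h : ∀ v ∈ t.occ, f v.1 v.2 = g v.1 v.2) : t.subst f = t.subst g := by
  induction t with
  | var v => exact h ⟨_, v⟩ rfl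
  | app s t hs ht =>
    simp only [Tm.subst]
    rw [hs fun v hv => h v (.inl hv), ht fun v hv => h v (.inr hv)]
  | _ => rfl

theorem Fm.subst_congr (φ : Fm V) : ∀ {W : Ty → Type} {f g : (τ : Ty) → V τ → Tm W τ},
    (∀ v ∈ φ.occ, f v.1 v.2 = g v.1 v.2) → φ.subst f = φ.subst g := by
  induction φ with
  | bot => intros; rfl
  | eq s t =>
    intro W f g h
    simp only [Fm.subst]
    rw [s.subst_congr fun v hv => h v (.inl hv), t.subst_congr fun v hv => h v (.inr hv)]
  | imp φ ψ hφ hψ =>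
    intro W f g h
    simp only [Fm.subst]
    rw [hφ fun v hv => h v (.inl hv), hψ fun v hv => h v (.inr hv)]
  | all τ φ ih =>
    intro W f g h
    simp only [Fm.subst]
    rw [ih]
    rintro ⟨σ, v⟩ hv
    cases v with
    | new => rfl
    | old v => exact congrArg Tm.wk (h ⟨σ, v⟩ hv)

end Occurrences

/-! ### Derivations -/

/-- A theory whose axioms are closed under substitution. -/
def Theory.Closed (T : Theory) : Prop :=
  ∀ {V W : Ty → Type} (f : (τ : Ty) → V τ → Tm W τ) (φ : Fm V), φ ∈ T V → φ.subst f ∈ T W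

theorem Derives.mono {T : Theory} {V : Ty → Type} {Γ : Set (Fm V)} {φ : Fm V}
    (h : Derives T Γ φ) : ∀ {Δ : Set (Fm V)}, Γ ⊆ Δ → Derives T Δ φ := by
  induction h with
  | ax h => exact fun _ => .ax h
  | hyp h => exact fun hs => .hyp (hs h)
  | impI _ ih => exact fun hs => .impI (ih (Set.insert_subset_insert hs))
  | impE _ _ ih ih' => exact fun hs => .impE (ih hs) (ih' hs)
  | raa _ ih => exact fun hs => .raa (ih (Set.insert_subset_insert hs))
  | allI _ ih => exact fun hs => .allI (ih (Set.image_mono hs))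
  | allE _ t ih => exact fun hs => .allE (ih hs) t
  | eqI t => exact fun _ => .eqI t
  | eqE φ _ _ ih ih' => exact fun hs => .eqE φ (ih hs) (ih' hs)

/-- Serves two purposes: turning a fresh free variable into a bound one, and replacing all variables
by closed terms to return to the empty context. -/
theorem Derives.subst {T : Theory} (hT : T.Closed) {V : Ty → Type} {Γ : Set (Fm V)} {φ : Fm V}
    (h : Derives T Γ φ) : ∀ {W : Ty → Type} (f : (τ : Ty) → V τ → Tm W τ),
      Derives T (Fm.subst f '' Γ) (φ.subst f) := by
  induction h with
  | ax h => exact fun f => .ax (hT f _ h)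
  | hyp h => exact fun f => .hyp (Set.mem_image_of_mem _ h)
  | impI _ ih => exact fun f => .impI (by simpa only [Set.image_insert_eq] using ih f)
  | impE _ _ ih ih' => exact fun f => .impE (ih f) (ih' f)
  | raa _ ih =>
    intro W f
    have := ih f
    rw [Set.image_insert_eq] at this
    exact .raa this
  | allI _ ih =>
    intro W f
    refine .allI ?_
    convert ih (liftSubst f _) using 1
    simp only [Set.image_image, Fm.wk_subst_lift]
  | allE _ t ih =>
    intro W f
    rw [Fm.inst_subst']
    exact .allE (ih f) _
  | eqI t => exact fun f => .eqI _
  | eqE φ _ _ ih ih' =>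
    intro W f
    rw [Fm.inst_subst']
    refine .eqE _ (ih f) ?_
    rw [← Fm.inst_subst']
    exact ih' f

/-! ### The countably many formulas over countably many variables -/

def Ty.enc : Ty → ℕ
  | .N => 0
  | .arr σ τ => Nat.pair σ.enc τ.enc + 1

theorem Ty.enc_inj : ∀ {σ τ : Ty}, σ.enc = τ.enc → σ = τ
  | .N, .N, _ => rfl
  | .N, .arr _ _, h => by simp [Ty.enc] at h
  | .arr _ _, .N, h => by simp [Ty.enc] at h
  | .arr a b, .arr c d, h => by
    simp only [Ty.enc, Nat.add_right_cancel_iff, Nat.pair_eq_pair] at h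
    rw [Ty.enc_inj h.1, Ty.enc_inj h.2]

def Tm.enc {V : Ty → Type} (e : (Σ τ, V τ) → ℕ) : {τ : Ty} → Tm V τ → ℕ
  | τ, .var v => Nat.pair 0 (e ⟨τ, v⟩)
  | _, .zero => Nat.pair 1 0
  | _, .succ => Nat.pair 2 0
  | _, .K σ τ => Nat.pair 3 (Nat.pair σ.enc τ.enc)
  | _, .S ρ σ τ => Nat.pair 4 (Nat.pair ρ.enc (Nat.pair σ.enc τ.enc))
  | _, .R => Nat.pair 5 0
  | _, .app s t => Nat.pair 6 (Nat.pair (s.enc e) (t.enc e))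

theorem Tm.enc_inj {V : Ty → Type} {e : (Σ τ, V τ) → ℕ} (he : Function.Injective e) {σ : Ty}
    (s : Tm V σ) : ∀ {τ : Ty} (t : Tm V τ), s.enc e = t.enc e →
      (⟨σ, s⟩ : Σ τ, Tm V τ) = ⟨τ, t⟩ := by
  induction s with
  | var v =>
    intro τ t h
    cases t <;> simp [Tm.enc, Nat.pair_eq_pair] at h
    have := he h
    cases this
    rfl
  | app s s' h h' =>
    intro τ t ht
    cases t <;> simp [Tm.enc, Nat.pair_eq_pair] at ht
    have h1 := h _ ht.1
    have h2 := h' _ ht.2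
    cases h1
    cases h2
    rfl
  | K a b =>
    intro τ t h
    cases t <;> simp [Tm.enc, Nat.pair_eq_pair] at h
    cases Ty.enc_inj h.1
    cases Ty.enc_inj h.2
    rfl
  | S a b c =>
    intro τ t h
    cases t <;> simp [Tm.enc, Nat.pair_eq_pair] at h
    cases Ty.enc_inj h.1
    cases Ty.enc_inj h.2.1
    cases Ty.enc_inj h.2.2
    rfl
  | _ =>
    intro τ t h
    cases t <;> simp [Tm.enc, Nat.pair_eq_pair] at h
    rfl

def extEnc {V : Ty → Type} (e : (Σ τ, V τ) → ℕ) (σ : Ty) : (Σ τ, Ext V σ τ) → ℕ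
  | ⟨_, .new⟩ => 0
  | ⟨τ, .old v⟩ => e ⟨τ, v⟩ + 1

theorem extEnc_injective {V : Ty → Type} {e : (Σ τ, V τ) → ℕ} (he : Function.Injective e)
    (σ : Ty) : Function.Injective (extEnc e σ) := by
  rintro ⟨a, v⟩ ⟨b, w⟩ h
  cases v <;> cases w <;> simp [extEnc] at h
  · rfl
  · cases he h
    rfl

/-- The numbering of the variables is an argument because it changes under each quantifier, where
the bound variable takes the number 0. -/
def Fm.enc : {V : Ty → Type} → Fm V → ((Σ τ, V τ) → ℕ) → ℕ
  | _, .bot, _ => Nat.pair 0 0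
  | _, .eq s t, e => Nat.pair 1 (Nat.pair (s.enc e) (t.enc e))
  | _, .imp φ ψ, e => Nat.pair 2 (Nat.pair (φ.enc e) (ψ.enc e))
  | _, .all τ φ, e => Nat.pair 3 (Nat.pair τ.enc (φ.enc (extEnc e τ)))

theorem Fm.enc_inj {V : Ty → Type} (φ : Fm V) : ∀ {e : (Σ τ, V τ) → ℕ}, Function.Injective e →
    ∀ ψ : Fm V, φ.enc e = ψ.enc e → φ = ψ := by
  induction φ with
  | bot =>
    intro e he ψ h
    cases ψ <;> simp [Fm.enc, Nat.pair_eq_pair] at h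
    rfl
  | eq s t =>
    intro e he ψ h
    cases ψ <;> simp [Fm.enc, Nat.pair_eq_pair] at h
    have h1 := s.enc_inj he _ h.1
    have h2 := t.enc_inj he _ h.2
    cases h1
    cases h2
    rfl
  | imp φ φ' ih ih' =>
    intro e he ψ h
    cases ψ <;> simp [Fm.enc, Nat.pair_eq_pair] at h
    rw [ih he _ h.1, ih' he _ h.2]
  | all τ φ ih =>
    intro e he ψ h
    cases ψ <;> simp [Fm.enc, Nat.pair_eq_pair] at h
    cases Ty.enc_inj h.1
    rw [ih (extEnc_injective he _) _ h.2]

/-- Countably many variables of each type. -/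
abbrev NatVars : Ty → Type := fun _ => ℕ

theorem countable_fm : Countable (Fm NatVars) := by
  refine Function.Injective.countable (f := fun φ : Fm NatVars =>
    φ.enc fun v => Nat.pair v.1.enc v.2) fun φ ψ h => φ.enc_inj ?_ ψ h
  rintro ⟨a, v⟩ ⟨b, w⟩ h
  simp only [Nat.pair_eq_pair] at h
  cases Ty.enc_inj h.1
  rw [h.2]

/-! ### Maximal consistent sets with witnesses -/

section Henkin

variable {T : Theory}

def Theory.Con (T : Theory) {V : Ty → Type} (Γ : Set (Fm V)) : Prop := ¬ Derives T Γ .bot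

/-- The renaming that makes the variable `k` of type `τ` the newest variable. -/
noncomputable def freshSubst (τ : Ty) (k : ℕ) : (σ : Ty) → NatVars σ → Tm (Ext NatVars τ) σ :=
  fun σ v => open Classical in
    if h : σ = τ ∧ v = k then h.1 ▸ .var .new else .var (.old v)

theorem freshSubst_self (τ : Ty) (k : ℕ) : freshSubst τ k τ k = .var .new := by
  simp [freshSubst]

theorem freshSubst_of_ne {τ : Ty} {k : ℕ} {v : Σ σ, NatVars σ} (h : v ≠ ⟨τ, k⟩) :
    freshSubst τ k v.1 v.2 = .var (.old v.2) := by
  rw [freshSubst, dif_neg]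
  rintro ⟨h1, h2⟩
  obtain ⟨a, b⟩ := v
  cases h1
  cases h2
  exact h rfl

theorem Fm.subst_freshSubst {τ : Ty} {k : ℕ} (φ : Fm NatVars)
    (h : (⟨τ, k⟩ : Σ σ, NatVars σ) ∉ φ.occ) : φ.subst (freshSubst τ k) = φ.wk :=
  φ.subst_congr fun _ hv => freshSubst_of_ne fun e => h (e ▸ hv)

theorem Fm.inst_subst_freshSubst {τ : Ty} {k : ℕ} (χ : Fm (Ext NatVars τ))
    (h : (⟨τ, k⟩ : Σ σ, NatVars σ) ∉ (Fm.all τ χ).occ) :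
    (χ.inst (.var k)).subst (freshSubst τ k) = χ := by
  rw [Fm.inst_subst]
  conv_rhs => rw [← χ.subst_var]
  refine χ.subst_congr ?_
  rintro ⟨σ, v⟩ hv
  cases v with
  | new => exact freshSubst_self τ k
  | old w => exact freshSubst_of_ne (v := ⟨σ, w⟩) fun e => h (e ▸ hv)

/-- A consistent set in which only finitely many variables occur. -/
def Theory.Good (T : Theory) (Γ : Set (Fm NatVars)) : Prop :=
  T.Con Γ ∧ (⋃ ψ ∈ Γ, ψ.occ).Finite

theorem Theory.Good.insert {Γ : Set (Fm NatVars)} (h : T.Good Γ) {φ : Fm NatVars}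
    (hφ : T.Con (insert φ Γ)) : T.Good (insert φ Γ) := by
  refine ⟨hφ, ?_⟩
  rw [Set.biUnion_insert]
  exact φ.occ_finite.union h.2

/-- `Γ` decides `θ`, with a witness if `θ` is a refuted universal statement. -/
def Decides (Γ : Set (Fm NatVars)) (θ : Fm NatVars) : Prop :=
  θ ∈ Γ ∨ ((¬ₒ θ) ∈ Γ ∧ ∀ τ χ, θ = .all τ χ → ∃ t, (¬ₒ χ.inst t) ∈ Γ)

/-- One step of Lindenbaum's construction with Henkin witnesses. A refuted universal statement
receives an unused variable as counterexample, so finiteness of the occurring variables is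
preserved. -/
theorem Theory.Good.exists_decides (hT : T.Closed) {Γ : Set (Fm NatVars)} (h : T.Good Γ)
    (θ : Fm NatVars) : ∃ Δ, T.Good Δ ∧ Γ ⊆ Δ ∧ Decides Δ θ := by
  by_cases h1 : T.Con (Insert.insert θ Γ)
  · exact ⟨_, h.insert h1, Set.subset_insert _ _, .inl (Set.mem_insert _ _)⟩
  have h2 : T.Con (Insert.insert (¬ₒ θ) Γ) := fun h3 =>
    h.1 (.impE (.impI (not_not.1 h1)) (.raa h3))
  have h3 := h.insert h2
  cases θ with
  | all τ χ =>
    obtain ⟨k, hk⟩ : ∃ k : ℕ, (⟨τ, k⟩ : Σ σ, NatVars σ) ∉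
        ⋃ ψ ∈ Insert.insert (¬ₒ Fm.all τ χ) Γ, ψ.occ := by
      have := (h3.2.preimage (f := fun k : ℕ => (⟨τ, k⟩ : Σ σ, NatVars σ))
        (fun a _ b _ h => by simpa using h)).exists_notMem
      exact this
    have hk' : ∀ ψ ∈ Insert.insert (¬ₒ Fm.all τ χ) Γ, (⟨τ, k⟩ : Σ σ, NatVars σ) ∉ ψ.occ := by
      intro ψ hψ hmem
      exact hk (Set.mem_biUnion hψ hmem)
    -- Otherwise χ(k) is derivable with k fresh; renaming k to the newest variable allows
    -- generalisation, which contradicts the negated universal statement.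
    have h4 : T.Con (Insert.insert (¬ₒ χ.inst (.var k)) (Insert.insert (¬ₒ Fm.all τ χ) Γ)) := by
      intro h4
      have h5 := (Derives.raa h4).subst hT (freshSubst τ k)
      rw [Fm.inst_subst_freshSubst _ fun hm => hk' _ (Set.mem_insert _ _) (.inl hm)] at h5
      have h6 : Fm.subst (freshSubst τ k) '' (Insert.insert (¬ₒ Fm.all τ χ) Γ) =
          Fm.wk '' (Insert.insert (¬ₒ Fm.all τ χ) Γ) :=
        Set.image_congr fun ψ hψ => ψ.subst_freshSubst (hk' ψ hψ)
      rw [h6] at h5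
      exact h2 (.impE (.hyp (Set.mem_insert _ _)) (.allI h5))
    refine ⟨_, h3.insert h4, (Set.subset_insert _ _).trans (Set.subset_insert _ _),
      .inr ⟨.inr (.inl rfl), ?_⟩⟩
    intro τ' χ' e
    cases e
    exact ⟨_, .inl rfl⟩
  | _ => exact ⟨_, h3, Set.subset_insert _ _, .inr ⟨.inl rfl, fun _ _ e => by cases e⟩⟩

/-- A set of formulas that behaves like the set of truths of a structure named by terms. -/
structure Truth (T : Theory) (H : Set (Fm NatVars)) : Prop where
  ax : ∀ φ ∈ T NatVars, φ ∈ H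
  bot : Fm.bot ∉ H
  imp : ∀ φ ψ, (φ ⇒ₒ ψ) ∈ H ↔ (φ ∈ H → ψ ∈ H)
  all : ∀ τ φ, Fm.all τ φ ∈ H ↔ ∀ t, φ.inst t ∈ H
  refl : ∀ t, (t =ₒ t) ∈ H
  leib : ∀ s t (φ : Fm (Ext NatVars Ty.N)), (s =ₒ t) ∈ H → φ.inst s ∈ H → φ.inst t ∈ H

/-- Decide the formulas one after another along an enumeration. Consistency of each stage makes the
limit commute with implication, and the witnesses make it commute with quantifiers. -/
theorem exists_truth (hT : T.Closed) {Γ : Set (Fm NatVars)} (h : T.Good Γ) :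
    ∃ H, Truth T H ∧ Γ ⊆ H := by
  classical
  have : Nonempty (Fm NatVars) := ⟨.bot⟩
  obtain ⟨θ, hθ⟩ := (@exists_surjective_nat _ _ countable_fm :
    ∃ θ : ℕ → Fm NatVars, Function.Surjective θ)
  choose! D hD1 hD2 hD3 using fun (Δ : Set (Fm NatVars)) (h : T.Good Δ) =>
    fun θ => h.exists_decides hT θ
  let G : ℕ → Set (Fm NatVars) := fun n => Nat.rec Γ (fun n Δ => D Δ (θ n)) n
  have hG : ∀ n, T.Good (G n) := fun n => by
    induction n with
    | zero => exact h
    | succ n ih => exact hD1 _ ih _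
  have hmono : Monotone G := monotone_nat_of_le_succ fun n => hD2 _ (hG n) _
  -- Derivability from some stage, not membership in it, so that closure under the rules is
  -- immediate.
  let H : Set (Fm NatVars) := {φ | ∃ n, Derives T (G n) φ}
  have hdec : ∀ φ, ∃ n, Decides (G n) φ := fun φ => by
    obtain ⟨n, rfl⟩ := hθ φ
    exact ⟨n + 1, hD3 _ (hG n) _⟩
  have hcon : ∀ φ, φ ∈ H → (¬ₒ φ) ∈ H → False := by
    rintro φ ⟨n, hn⟩ ⟨m, hm⟩
    exact (hG (max n m)).1 (.impE (hm.mono (hmono (le_max_right _ _)))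
      (hn.mono (hmono (le_max_left _ _))))
  have hneg : ∀ φ, φ ∉ H → (¬ₒ φ) ∈ H := by
    intro φ hφ
    obtain ⟨n, h | h⟩ := hdec φ
    · exact absurd ⟨n, .hyp h⟩ hφ
    · exact ⟨n, .hyp h.1⟩
  refine ⟨H, ⟨fun φ hφ => ⟨0, .ax hφ⟩, fun ⟨n, hn⟩ => (hG n).1 hn, ?_, ?_, fun t => ⟨0, .eqI t⟩, ?_⟩,
    fun φ hφ => ⟨0, .hyp hφ⟩⟩
  · intro φ ψ
    constructor
    · rintro ⟨n, hn⟩ ⟨m, hm⟩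
      exact ⟨max n m, .impE (hn.mono (hmono (le_max_left _ _)))
        (hm.mono (hmono (le_max_right _ _)))⟩
    · intro h
      by_cases hφ : φ ∈ H
      · obtain ⟨n, hn⟩ := h hφ
        exact ⟨n, .impI (hn.mono (Set.subset_insert _ _))⟩
      · obtain ⟨n, hn⟩ := hneg φ hφ
        refine ⟨n, .impI (.raa (.impE ?_ (.hyp (.inr (.inl rfl)))))⟩
        exact hn.mono ((Set.subset_insert _ _).trans (Set.subset_insert _ _))
  · intro τ φ
    constructor
    · rintro ⟨n, hn⟩ t
      exact ⟨n, .allE hn t⟩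
    · intro h
      by_contra hφ
      obtain ⟨n, hn | ⟨-, hn⟩⟩ := hdec (.all τ φ)
      · exact hφ ⟨n, .hyp hn⟩
      · obtain ⟨t, ht⟩ := hn _ _ rfl
        exact hcon _ (h t) ⟨n, .hyp ht⟩
  · rintro s t φ ⟨n, hn⟩ ⟨m, hm⟩
    exact ⟨max n m, .eqE φ (hn.mono (hmono (le_max_left _ _)))
      (hm.mono (hmono (le_max_right _ _)))⟩

end Henkin

/-! ### Structures -/

/-- An extensional structure for the language of all finite types. -/
structure Struct where
  C : Ty → Type
  app : {σ τ : Ty} → C (σ ⟶ₜ τ) → C σ → C τ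
  zero : C Ty.N
  succ : C (Ty.N ⟶ₜ Ty.N)
  K : (σ τ : Ty) → C (σ ⟶ₜ τ ⟶ₜ σ)
  S : (ρ σ τ : Ty) → C ((ρ ⟶ₜ σ ⟶ₜ τ) ⟶ₜ (ρ ⟶ₜ σ) ⟶ₜ ρ ⟶ₜ τ)
  R : C ((Ty.N ⟶ₜ Ty.N ⟶ₜ Ty.N) ⟶ₜ Ty.N ⟶ₜ Ty.N ⟶ₜ Ty.N)
  ext : ∀ {σ τ : Ty} {f g : C (σ ⟶ₜ τ)}, (∀ x, app f x = app g x) → f = g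

/-- An assignment extended by a value for the newest variable. -/
def Struct.cons {𝓜 : Struct} {V : Ty → Type} {σ : Ty} (ρ : (τ : Ty) → V τ → 𝓜.C τ) (a : 𝓜.C σ) :
    (τ : Ty) → Ext V σ τ → 𝓜.C τ
  | _, .new => a
  | τ, .old v => ρ τ v

/-- The value of a term. -/
def Tm.eval {𝓜 : Struct} {V : Ty → Type} (ρ : (τ : Ty) → V τ → 𝓜.C τ) : {τ : Ty} → Tm V τ → 𝓜.C τ
  | τ, .var v => ρ τ v
  | _, .zero => 𝓜.zero
  | _, .succ => 𝓜.succ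
  | _, .K σ τ => 𝓜.K σ τ
  | _, .S ρ σ τ => 𝓜.S ρ σ τ
  | _, .R => 𝓜.R
  | _, .app s t => 𝓜.app (s.eval ρ) (t.eval ρ)

/-- Truth of a formula. -/
def Fm.Sat {𝓜 : Struct} : {V : Ty → Type} → Fm V → ((τ : Ty) → V τ → 𝓜.C τ) → Prop
  | _, .bot, _ => False
  | _, .eq s t, ρ => s.eval ρ = t.eval ρ
  | _, .imp φ ψ, ρ => φ.Sat ρ → ψ.Sat ρ
  | _, .all _ φ, ρ => ∀ a, φ.Sat (Struct.cons ρ a)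

/-- `𝓜` satisfies every axiom of `T`. -/
def Struct.Models (𝓜 : Struct) (T : Theory) : Prop :=
  ∀ {V : Ty → Type} (φ : Fm V), φ ∈ T V → ∀ ρ : (τ : Ty) → V τ → 𝓜.C τ, φ.Sat ρ

/-- The theory proves that all functionals respect extensional equality. -/
def Theory.Extensional (T : Theory) : Prop :=
  ∀ {σ τ : Ty} (s t : Tm NatVars σ) (f : Tm NatVars (σ ⟶ₜ τ)),
    (eqAt σ s t ⇒ₒ eqAt τ (f ⬝ₜ s) (f ⬝ₜ t)) ∈ T NatVars

/-! ### The term model -/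

section TermModel

variable {T : Theory} {H : Set (Fm NatVars)}

theorem Truth.eqAt_arr (hH : Truth T H) {σ τ : Ty} (s t : Tm NatVars (σ ⟶ₜ τ)) :
    eqAt (σ ⟶ₜ τ) s t ∈ H ↔ ∀ x, eqAt τ (s ⬝ₜ x) (t ⬝ₜ x) ∈ H := by
  rw [eqAt, allB, hH.all]
  refine forall_congr' fun x => ?_
  rw [Fm.inst, eqAt_subst]
  simp only [Tm.subst, Tm.wk_subst, instSubst, Tm.subst_var]

theorem Truth.eq_equiv (hH : Truth T H) : ∀ τ : Ty,
    Equivalence fun s t : Tm NatVars τ => eqAt τ s t ∈ H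
  | .N => by
    have hs : ∀ {s t : Tm NatVars Ty.N}, (s =ₒ t) ∈ H → (t =ₒ s) ∈ H := by
      intro s t h
      -- Leibniz for the formula "x = s" turns reflexivity of s into symmetry.
      have := hH.leib s t (.var .new =ₒ s⇑) h
      simp only [Fm.inst, Fm.subst, Tm.subst, instSubst, Tm.wk_subst, Tm.subst_var] at this
      exact this (hH.refl s)
    refine ⟨hH.refl, hs, ?_⟩
    intro s t u h1 h2
    have := hH.leib t u (s⇑ =ₒ .var .new) h2
    simp only [Fm.inst, Fm.subst, Tm.subst, instSubst, Tm.wk_subst, Tm.subst_var] at this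
    exact this h1
  | .arr σ τ => by
    have ih := hH.eq_equiv τ
    simp only [hH.eqAt_arr]
    exact ⟨fun _ _ => ih.refl _, fun h x => ih.symm (h x), fun h h' x => ih.trans (h x) (h' x)⟩

def Truth.setoid (hH : Truth T H) (τ : Ty) : Setoid (Tm NatVars τ) := ⟨_, hH.eq_equiv τ⟩

/-- The structure of terms modulo provable equality. -/
def Truth.struct (hH : Truth T H) (hE : T.Extensional) : Struct where
  C τ := Quotient (hH.setoid τ)
  app {σ τ} := Quotient.map₂ (sa := hH.setoid _) (sb := hH.setoid _) (sc := hH.setoid _) Tm.app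
    -- Congruence in the function holds by definition of equality at arrow types; congruence in the
    -- argument is the extensionality axiom.
    fun f g hfg s t hst => (hH.eq_equiv τ).trans ((hH.eqAt_arr f g).1 hfg s)
      ((hH.imp _ _).1 (hH.ax _ (hE s t g)) hst)
  zero := Quotient.mk _ .zero
  succ := Quotient.mk _ .succ
  K σ τ := Quotient.mk _ (.K σ τ)
  S ρ σ τ := Quotient.mk _ (.S ρ σ τ)
  R := Quotient.mk _ .R
  ext {σ τ f g} := by
    induction f using Quotient.inductionOn
    induction g using Quotient.inductionOn
    intro h
    refine Quotient.sound ((hH.eqAt_arr _ _).2 fun x => ?_)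
    exact Quotient.exact (h (Quotient.mk _ x))

theorem Truth.eval_struct (hH : Truth T H) (hE : T.Extensional) {V : Ty → Type} {τ : Ty}
    (t : Tm V τ) (f : (τ : Ty) → V τ → Tm NatVars τ) :
    t.eval (𝓜 := hH.struct hE) (fun _ v => Quotient.mk _ (f _ v)) =
      Quotient.mk (hH.setoid τ) (t.subst f) := by
  induction t with
  | app s t hs ht => exact congrArg₂ (hH.struct hE).app hs ht
  | _ => rfl

/-- The truth lemma. Every element of the structure is named by a term, so quantifying over elements
agrees with quantifying over term instances. -/
theorem Truth.sat_struct (hH : Truth T H) (hE : T.Extensional) {V : Ty → Type}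
    (φ : Fm V) : ∀ f : (τ : Ty) → V τ → Tm NatVars τ,
    φ.Sat (𝓜 := hH.struct hE) (fun _ v => Quotient.mk _ (f _ v)) ↔ φ.subst f ∈ H := by
  induction φ with
  | bot => exact fun f => ⟨False.elim, fun h => hH.bot h⟩
  | eq s t =>
    intro f
    have hs := hH.eval_struct hE s f
    have ht := hH.eval_struct hE t f
    exact ⟨fun h => Quotient.exact (hs.symm.trans (h.trans ht)),
      fun h => hs.trans ((Quotient.sound h).trans ht.symm)⟩
  | imp φ ψ hφ hψ =>
    intro f
    exact (imp_congr (hφ f) (hψ f)).trans (hH.imp _ _).symm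
  | all τ φ ih =>
    intro f
    refine Iff.trans ?_ (hH.all _ _).symm
    have key : ∀ t, φ.Sat (𝓜 := hH.struct hE)
        (Struct.cons (fun _ v => Quotient.mk _ (f _ v)) (Quotient.mk (hH.setoid τ) t)) ↔
        (φ.subst (liftSubst f τ)).inst t ∈ H := by
      intro t
      rw [Fm.subst_lift_inst, ← ih]
      apply iff_of_eq
      congr 1
      funext σ v
      cases v <;> rfl
    constructor
    · exact fun h t => (key t).1 (h _)
    · intro h a
      induction a using Quotient.inductionOn with
      | h t => exact (key t).2 (h t)

end TermModel

/-- A closed term of each type. -/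
def closedTm {V : Ty → Type} : (τ : Ty) → Tm V τ
  | .N => .zero
  | .arr σ τ => .K τ σ ⬝ₜ closedTm τ

/-- Completeness: a sentence that holds in all extensional models of `T` is provable. -/
theorem Theory.proves_of_forall_models {T : Theory} (hT : T.Closed) (hE : T.Extensional)
    (φ : Sentence) (h : ∀ 𝓜 : Struct, 𝓜.Models T → ∀ ρ : (τ : Ty) → NoVars τ → 𝓜.C τ, φ.Sat ρ) :
    T.Proves φ := by
  by_contra hφ
  let e : (τ : Ty) → NoVars τ → Tm NatVars τ := fun _ v => v.elim
  have hgood : T.Good {¬ₒ φ.subst e} := by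
    refine ⟨fun hd => hφ ?_, by simpa using Fm.occ_finite _⟩
    -- The sentence was moved to a context with infinitely many variables; closed terms substituted
    -- for them bring a refutation back to the empty context.
    have h1 := hd.subst hT (fun τ _ => closedTm (V := NoVars) τ)
    rw [Set.image_singleton] at h1
    have h2 : (¬ₒ φ.subst e).subst (fun τ _ => closedTm (V := NoVars) τ) = (¬ₒ φ) := by
      simp only [Fm.neg, Fm.subst, Fm.subst_subst]
      congr 1
      conv_rhs => rw [← φ.subst_var]
      congr 1
      funext τ v
      exact v.elim
    rw [h2] at h1
    exact .raa (h1.mono (by simp))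
  obtain ⟨H, hH, hsub⟩ := exists_truth hT hgood
  have hmod : (hH.struct hE).Models T := by
    intro V ψ hψ ρ
    -- An assignment is a substitution by representatives, and substitution instances of axioms are
    -- axioms.
    choose f hf using fun τ v => Quotient.exists_rep (s := hH.setoid τ) (ρ τ v)
    have : ρ = fun τ v => Quotient.mk _ (f τ v) := by
      funext τ v
      exact (hf τ v).symm
    rw [this, hH.sat_struct]
    exact hH.ax _ (hT f ψ hψ)
  have h1 := h _ hmod fun τ v => Quotient.mk _ (e τ v)
  rw [hH.sat_struct] at h1
  exact hH.bot ((hH.imp _ _).1 (hsub rfl) h1)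

/-! ### The axioms are closed under substitution -/

theorem Fm.QF.subst {V : Ty → Type} {φ : Fm V} : φ.QF → ∀ {W : Ty → Type}
    (f : (τ : Ty) → V τ → Tm W τ), (φ.subst f).QF := by
  induction φ with
  | bot => exact fun h _ _ => h
  | eq s t => exact fun h _ _ => h
  | imp φ ψ hφ hψ => exact fun h _ f => ⟨hφ h.1 f, hψ h.2 f⟩
  | all τ φ ih => exact fun h => h.elim

theorem Fm.subst_succSubst {V W : Ty → Type} (A : Fm (Ext V Ty.N))
    (f : (τ : Ty) → V τ → Tm W τ) :
    (A.subst (succSubst V)).subst (liftSubst f Ty.N) =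
      (A.subst (liftSubst f Ty.N)).subst (succSubst W) := by
  rw [Fm.subst_subst, Fm.subst_subst]
  congr 1
  funext τ v
  cases v with
  | new => rfl
  | old v => exact (Tm.wk_subst (f τ v) (succSubst W)).symm

theorem Fm.subst_choiceSubst {V W : Ty → Type} (A : Fm (Ext (Ext V Ty.one) Ty.N))
    (f : (τ : Ty) → V τ → Tm W τ) :
    (A.subst (choiceSubst V)).subst (liftSubst (liftSubst f Ty.two) Ty.one) =
      (A.subst (liftSubst (liftSubst f Ty.one) Ty.N)).subst (choiceSubst W) := by
  rw [Fm.subst_subst, Fm.subst_subst]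
  congr 1
  funext τ v
  cases v with
  | new => rfl
  | old v => cases v with
    | new => rfl
    | old v =>
      simp only [choiceSubst, Tm.subst, liftSubst, Tm.wk, Tm.subst_subst]

theorem RCAAxiom.subst {V : Ty → Type} {φ : Fm V} (h : RCAAxiom φ) {W : Ty → Type}
    (f : (τ : Ty) → V τ → Tm W τ) : RCAAxiom (φ.subst f) := by
  cases h with
  | succ_ne t => exact .succ_ne _
  | succ_inj s t => exact .succ_inj _ _
  | comb_K s t => rw [eqAt_subst]; exact .comb_K _ _
  | comb_S r s t => rw [eqAt_subst]; exact .comb_S _ _ _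
  | rec_zero g m => exact .rec_zero _ _
  | rec_succ g m n => exact .rec_succ _ _ _
  | ext s t g => simp only [Fm.subst, eqAt_subst]; exact .ext _ _ _
  | qf_ind A hA =>
    have h := RCAAxiom.qf_ind (A.subst (liftSubst f Ty.N)) (hA.subst _)
    rw [← Fm.subst_succSubst] at h
    simp only [Fm.subst, Fm.inst_subst']
    exact h
  | qf_ac A hA =>
    have h := RCAAxiom.qf_ac (A.subst (liftSubst (liftSubst f Ty.one) Ty.N)) (hA.subst _)
    rw [← Fm.subst_choiceSubst] at h
    exact h

theorem Theory.Closed.plus {T : Theory} (hT : T.Closed) {φ : (V : Ty → Type) → Fm V}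
    (hφ : ∀ {V W : Ty → Type} (f : (τ : Ty) → V τ → Tm W τ), (φ V).subst f = φ W) :
    (T.plus φ).Closed := by
  rintro V W f ψ (rfl | h)
  · exact .inl (hφ f)
  · exact .inr (hT f ψ h)

theorem RCA_closed : RCA.Closed := fun f _ h => RCAAxiom.subst h f

theorem ACA_closed : ACA.Closed := RCA_closed.plus fun _ => rfl

theorem ACA_IND_closed : (ACA.plus IND).Closed := ACA_closed.plus fun _ => rfl

theorem ACA_extensional : ACA.Extensional := fun s t f => .inr (.ext s t f)

theorem ACA_IND_extensional : (ACA.plus IND).Extensional := fun s t f => .inr (.inr (.ext s t f))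

/-! ### Truth of defined connectives -/

section Sat

variable {𝓜 : Struct} {V W : Ty → Type} (ρ : (τ : Ty) → V τ → 𝓜.C τ)

theorem Tm.eval_subst (f : (τ : Ty) → W τ → Tm V τ) {τ : Ty} (t : Tm W τ) :
    (t.subst f).eval ρ = t.eval fun σ v => (f σ v).eval ρ := by
  induction t with
  | app s t hs ht => simp only [Tm.subst, Tm.eval, hs, ht]
  | _ => rfl

@[simp] theorem Tm.eval_wk {σ τ : Ty} (t : Tm V τ) (a : 𝓜.C σ) :
    t⇑.eval (Struct.cons ρ a) = t.eval ρ := by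
  rw [Tm.wk, Tm.eval_subst]
  rfl

theorem Fm.sat_subst (φ : Fm W) : ∀ {V : Ty → Type} (ρ : (τ : Ty) → V τ → 𝓜.C τ)
    (f : (τ : Ty) → W τ → Tm V τ), (φ.subst f).Sat ρ ↔ φ.Sat fun σ v => (f σ v).eval ρ := by
  induction φ with
  | bot => exact fun _ _ => Iff.rfl
  | eq s t => intro V ρ f; simp only [Fm.subst, Fm.Sat, Tm.eval_subst]
  | imp φ ψ hφ hψ => exact fun ρ f => imp_congr (hφ ρ f) (hψ ρ f)
  | all τ φ ih =>
    intro V ρ f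
    refine forall_congr' fun a => ?_
    rw [ih]
    apply iff_of_eq
    congr 1
    funext σ v
    cases v with
    | new => rfl
    | old v => simp only [liftSubst, Tm.eval_wk, Struct.cons]

@[simp] theorem Fm.sat_eq (s t : Tm V Ty.N) : (s =ₒ t).Sat ρ ↔ s.eval ρ = t.eval ρ := Iff.rfl
@[simp] theorem Fm.sat_imp (φ ψ : Fm V) : (φ ⇒ₒ ψ).Sat ρ ↔ (φ.Sat ρ → ψ.Sat ρ) := Iff.rfl
@[simp] theorem Fm.sat_neg (φ : Fm V) : (¬ₒ φ).Sat ρ ↔ ¬ φ.Sat ρ := Iff.rfl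
@[simp] theorem Fm.sat_and (φ ψ : Fm V) : (φ ∧ₒ ψ).Sat ρ ↔ φ.Sat ρ ∧ ψ.Sat ρ := by
  simp [Fm.and]
@[simp] theorem Fm.sat_iff (φ ψ : Fm V) : (φ ⇔ₒ ψ).Sat ρ ↔ (φ.Sat ρ ↔ ψ.Sat ρ) := by
  simp [Fm.iff, iff_def]
@[simp] theorem sat_allB (τ : Ty) (φ : Tm (Ext V τ) τ → Fm (Ext V τ)) :
    (allB τ φ).Sat ρ ↔ ∀ a : 𝓜.C τ, (φ (.var .new)).Sat (Struct.cons ρ a) := Iff.rfl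
@[simp] theorem sat_exB (τ : Ty) (φ : Tm (Ext V τ) τ → Fm (Ext V τ)) :
    (exB τ φ).Sat ρ ↔ ∃ a : 𝓜.C τ, (φ (.var .new)).Sat (Struct.cons ρ a) := by
  simp [exB]
@[simp] theorem Tm.eval_new {σ : Ty} (a : 𝓜.C σ) :
    (Tm.var (.new : Ext V σ σ)).eval (Struct.cons ρ a) = a := rfl
@[simp] theorem Tm.eval_app {σ τ : Ty} (s : Tm V (σ ⟶ₜ τ)) (t : Tm V σ) :
    (s ⬝ₜ t).eval ρ = 𝓜.app (s.eval ρ) (t.eval ρ) := rfl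

-- Extensionality of the structure makes the defined equality genuine identity, so the combinator
-- axioms become equations that can be rewritten with.
@[simp] theorem sat_eqAt : ∀ (τ : Ty) {V : Ty → Type} (ρ : (τ : Ty) → V τ → 𝓜.C τ)
    (s t : Tm V τ), (eqAt τ s t).Sat ρ ↔ s.eval ρ = t.eval ρ
  | .N, _, _, _, _ => Iff.rfl
  | .arr σ τ, _, ρ, s, t => by
    simp only [eqAt, sat_allB, sat_eqAt τ, Tm.eval_app, Tm.eval_wk, Tm.eval_new]
    exact ⟨𝓜.ext, fun h x => by rw [h]⟩

end Sat

/-! ### Models of `ACA₀^ω` -/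

/-- A structure with the properties that the axioms of `ACA₀^ω` express. -/
structure Mdl extends Struct where
  S1_ne : ∀ n, app succ n ≠ zero
  S1_inj : ∀ m n, app succ m = app succ n → m = n
  app_K : ∀ {σ τ : Ty} (a : C σ) (b : C τ), app (app (K σ τ) a) b = a
  app_S : ∀ {ρ σ τ : Ty} (a : C (ρ ⟶ₜ σ ⟶ₜ τ)) (b : C (ρ ⟶ₜ σ)) (c : C ρ),
    app (app (app (S ρ σ τ) a) b) c = app (app a c) (app b c)
  R_zero : ∀ f m, app (app (app R f) m) zero = m
  R_succ : ∀ f m n, app (app (app R f) m) (app succ n) = app (app f n) (app (app (app R f) m) n)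
  zero_or_succ : ∀ n, n = zero ∨ ∃ m, n = app succ m
  ind : ∀ f : C Ty.one, app f zero = zero → (∀ n, app f n = zero → app f (app succ n) = zero) →
    ∀ n, app f n = zero
  eqChar : ∃ e : C Ty.two, ∀ x, app e x = zero ↔ app x zero = app x (app succ zero)
  exTwo : ∃ E : C Ty.two, ∀ f, app E f = zero ↔ ∃ n, app f n = zero
  qfac : ∀ f : C (Ty.one ⟶ₜ Ty.one), (∀ x, ∃ n, app (app f x) n = zero) →
    ∃ Y : C Ty.two, ∀ x, app (app f x) (app Y x) = zero

section Extraction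

variable {𝓜 : Struct}

theorem Struct.Models.qf_ind (h : 𝓜.Models ACA) {V : Ty → Type} (ρ : (τ : Ty) → V τ → 𝓜.C τ)
    (A : Fm (Ext V Ty.N)) (hA : A.QF) (h0 : A.Sat (Struct.cons ρ 𝓜.zero))
    (h1 : ∀ n, A.Sat (Struct.cons ρ n) → A.Sat (Struct.cons ρ (𝓜.app 𝓜.succ n))) (n : 𝓜.C Ty.N) :
    A.Sat (Struct.cons ρ n) := by
  have := h _ (.inr (.qf_ind A hA)) ρ
  refine this ?_ ?_ n
  · rw [Fm.inst, Fm.sat_subst]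
    convert h0 using 1
    funext τ v
    cases v <;> rfl
  · intro a ha
    rw [Fm.sat_subst]
    convert h1 a ha using 1
    funext τ v
    cases v <;> rfl

theorem Struct.Models.qf_ac (h : 𝓜.Models ACA) {V : Ty → Type} (ρ : (τ : Ty) → V τ → 𝓜.C τ)
    (A : Fm (Ext (Ext V Ty.one) Ty.N)) (hA : A.QF)
    (h0 : ∀ x, ∃ n, A.Sat (Struct.cons (Struct.cons ρ x) n)) :
    ∃ Y : 𝓜.C Ty.two, ∀ x, A.Sat (Struct.cons (Struct.cons ρ x) (𝓜.app Y x)) := by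
  have := h _ (.inr (.qf_ac A hA)) ρ
  simp only [Fm.sat_neg, Fm.Sat, not_forall, not_not] at this
  obtain ⟨Y, hY⟩ := this h0
  rw [not_exists_not] at hY
  refine ⟨Y, fun x => ?_⟩
  have h2 := hY x
  rw [Fm.sat_subst] at h2
  convert h2 using 1
  funext τ v
  cases v with
  | new => rfl
  | old v => cases v <;> simp only [choiceSubst, Tm.eval, Struct.cons]

/-- The empty assignment. -/
abbrev noAssign : (τ : Ty) → NoVars τ → 𝓜.C τ := fun _ v => v.elim

theorem Struct.Models.mdl (h : 𝓜.Models ACA) : ∃ 𝓝 : Mdl, 𝓝.toStruct = 𝓜 := by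
  have hE : ∃ E : 𝓜.C Ty.two, ∀ f, 𝓜.app E f = 𝓜.zero ↔ ∃ n, 𝓜.app f n = 𝓜.zero := by
    have := h _ (.inl rfl) (noAssign (𝓜 := 𝓜))
    simp only [existsTwo, sat_exB, Fm.sat_and, sat_allB, Fm.sat_iff, Fm.sat_eq, Tm.eval_app,
      Tm.eval_wk, Tm.eval_new] at this
    obtain ⟨E, -, hE⟩ := this
    exact ⟨E, fun f => (hE f).symm⟩
  let v0 {V : Ty → Type} {σ : Ty} : Tm (Ext V σ) σ := .var .new
  let v1 {V : Ty → Type} {σ τ : Ty} : Tm (Ext (Ext V σ) τ) σ := .var (.old .new)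
  let v2 {V : Ty → Type} {σ τ υ : Ty} : Tm (Ext (Ext (Ext V σ) τ) υ) σ := .var (.old (.old .new))
  let r2 {σ τ : Ty} (a : 𝓜.C σ) (b : 𝓜.C τ) := Struct.cons (Struct.cons (noAssign (𝓜 := 𝓜)) a) b
  refine ⟨⟨𝓜, ?_, ?_, ?_, ?_, ?_, ?_, ?_, ?_, ?_, hE, ?_⟩, rfl⟩
  · intro n
    exact h _ (.inr (.succ_ne v0)) (Struct.cons noAssign n)
  · intro m n
    exact h _ (.inr (.succ_inj v1 v0)) (r2 m n)
  · intro σ τ a b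
    have := h _ (.inr (.comb_K v1 v0)) (r2 a b)
    rwa [sat_eqAt] at this
  · intro _ _ _ a b c
    have := h _ (.inr (.comb_S v2 v1 v0)) (Struct.cons (r2 a b) c)
    rwa [sat_eqAt] at this
  · intro f m
    exact h _ (.inr (.rec_zero v1 v0)) (r2 f m)
  · intro f m n
    exact h _ (.inr (.rec_succ v2 v1 v0)) (Struct.cons (r2 f m) n)
  · intro n
    -- The term `R K 0` computes the predecessor, so "n is zero or the successor of its predecessor"
    -- is quantifier-free.
    have := h.qf_ind noAssign
      ((¬ₒ (v0 =ₒ .zero)) ⇒ₒ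
        v0 =ₒ .succ ⬝ₜ (.R ⬝ₜ .K _ _ ⬝ₜ .zero ⬝ₜ v0)) ⟨⟨trivial, trivial⟩, trivial⟩
      (fun h => absurd rfl h) ?_ n
    · by_cases hn : n = 𝓜.zero
      · exact .inl hn
      · exact .inr ⟨_, this hn⟩
    · intro n _ _
      have h1 := h _ (.inr (.rec_succ v2 v1 v0)) (Struct.cons (r2 (𝓜.K _ _) 𝓜.zero) n)
      have h2 := h _ (.inr (.comb_K v1 v0))
        (r2 n (𝓜.app (𝓜.app (𝓜.app 𝓜.R (𝓜.K _ _)) 𝓜.zero) n))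
      rw [sat_eqAt] at h2
      exact congrArg (𝓜.app 𝓜.succ) (h1.trans h2).symm
  · intro f
    exact h.qf_ind (Struct.cons noAssign f) (v1 ⬝ₜ v0 =ₒ .zero) trivial
  -- Choice is available only for arguments of type 1, so a pair of numbers is coded as the values
  -- at 0 and 1; the chosen value is 0 if they agree and 1 if not.
  · obtain ⟨Y, hY⟩ := h.qf_ac noAssign
      (((v1 ⬝ₜ .zero =ₒ v1 ⬝ₜ Tm.n1) ⇒ₒ v0 =ₒ .zero) ∧ₒ
        ((¬ₒ (v1 ⬝ₜ .zero =ₒ v1 ⬝ₜ Tm.n1)) ⇒ₒ v0 =ₒ Tm.n1))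
      (by simp [Fm.and, Fm.neg, Fm.QF]) (by
        intro x
        simp only [Fm.sat_and, Fm.sat_imp, Fm.sat_neg, Fm.sat_eq]
        by_cases hx : (v1 ⬝ₜ .zero : Tm (Ext (Ext NoVars Ty.one) Ty.N) _).eval (r2 x 𝓜.zero) =
            (v1 ⬝ₜ Tm.n1).eval (r2 x 𝓜.zero)
        · exact ⟨𝓜.zero, fun _ => rfl, fun h => absurd hx h⟩
        · exact ⟨𝓜.app 𝓜.succ 𝓜.zero, fun h => absurd h hx, fun _ => rfl⟩)
    refine ⟨Y, fun x => ?_⟩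
    have := hY x
    simp only [Fm.sat_and, Fm.sat_imp, Fm.sat_neg, Fm.sat_eq] at this
    refine ⟨fun hx => ?_, this.1⟩
    by_contra hne
    have h1 := this.2 hne
    exact h _ (.inr (.succ_ne v0)) (Struct.cons noAssign 𝓜.zero) (h1.symm.trans hx)
  · intro f hf
    obtain ⟨Y, hY⟩ := h.qf_ac (Struct.cons noAssign f) (v2 ⬝ₜ v1 ⬝ₜ v0 =ₒ .zero) trivial hf
    exact ⟨Y, hY⟩

end Extraction

/-! ### Definable functions and predicates in a model -/

infixl:75 " ⬝ " => Struct.app _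

/-- A product of types of the model, with the internal functions on it. -/
class Ctx (𝓜 : Mdl) (X : Type) where
  arr : Ty → Ty
  ev : {τ : Ty} → 𝓜.C (arr τ) → X → 𝓜.C τ
  exists_const : ∀ {τ : Ty} (c : 𝓜.C τ), ∃ e : 𝓜.C (arr τ), ∀ x, ev e x = c
  exists_app : ∀ {σ τ : Ty} (f : 𝓜.C (arr (σ ⟶ₜ τ))) (a : 𝓜.C (arr σ)),
    ∃ e : 𝓜.C (arr τ), ∀ x, ev e x = ev f x ⬝ ev a x

instance Ctx.unit (𝓜 : Mdl) : Ctx 𝓜 Unit where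
  arr τ := τ
  ev e _ := e
  exists_const c := ⟨c, fun _ => rfl⟩
  exists_app f a := ⟨f ⬝ a, fun _ => rfl⟩

/-- Functions of several variables are curried. This is bracket abstraction: `K` abstracts a
constant and `S` an application. -/
instance Ctx.prod (𝓜 : Mdl) (X : Type) [Ctx 𝓜 X] (ρ : Ty) : Ctx 𝓜 (X × 𝓜.C ρ) where
  arr τ := Ctx.arr 𝓜 X (ρ ⟶ₜ τ)
  ev e p := Ctx.ev e p.1 ⬝ p.2
  exists_const {τ} c := by
    obtain ⟨e, he⟩ := Ctx.exists_const (X := X) (𝓜.K τ ρ ⬝ c)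
    exact ⟨e, fun p => by rw [he, 𝓜.app_K]⟩
  exists_app {σ τ} f a := by
    obtain ⟨s, hs⟩ := Ctx.exists_const (X := X) (𝓜.S ρ σ τ)
    obtain ⟨e₁, he₁⟩ := Ctx.exists_app s f
    obtain ⟨e, he⟩ := Ctx.exists_app e₁ a
    exact ⟨e, fun p => by rw [he, he₁, hs, 𝓜.app_S]⟩

section

variable {𝓜 : Mdl} {X : Type} [Ctx 𝓜 X]

/-- `f` is given by an element of the model. -/
class Dfn {τ : Ty} (f : X → 𝓜.C τ) : Prop where
  exists_ev : ∃ e : 𝓜.C (Ctx.arr 𝓜 X τ), ∀ x, Ctx.ev e x = f x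

theorem Dfn.congr {τ : Ty} {f g : X → 𝓜.C τ} (hf : Dfn f) (h : ∀ x, f x = g x) : Dfn g :=
  (funext h : f = g) ▸ hf

instance Dfn.const {τ : Ty} (c : 𝓜.C τ) : Dfn fun _ : X => c := ⟨Ctx.exists_const c⟩

instance Dfn.app {σ τ : Ty} (f : X → 𝓜.C (σ ⟶ₜ τ)) (a : X → 𝓜.C σ) [hf : Dfn f] [ha : Dfn a] :
    Dfn fun x => f x ⬝ a x := by
  obtain ⟨e₁, h₁⟩ := hf
  obtain ⟨e₂, h₂⟩ := ha
  obtain ⟨e, he⟩ := Ctx.exists_app e₁ e₂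
  exact ⟨e, fun x => by rw [he, h₁, h₂]⟩

theorem Dfn.fst {σ τ : Ty} {f : X → 𝓜.C τ} (hf : Dfn f) : Dfn fun p : X × 𝓜.C σ => f p.1 := by
  obtain ⟨e, he⟩ := (Dfn.app (fun _ => 𝓜.K τ σ) f).exists_ev
  exact ⟨e, fun p => (congrArg (· ⬝ p.2) (he p.1)).trans (𝓜.app_K _ _)⟩

instance Dfn.v0 {σ : Ty} : Dfn fun p : X × 𝓜.C σ => p.2 := by
  obtain ⟨e, he⟩ := Ctx.exists_const (X := X) (𝓜.S σ (σ ⟶ₜ σ) σ ⬝ 𝓜.K _ _ ⬝ 𝓜.K _ _)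
  exact ⟨e, fun p => (congrArg (· ⬝ p.2) (he p.1)).trans
    ((𝓜.app_S _ _ _).trans (𝓜.app_K _ _))⟩

instance Dfn.v1 {σ σ₁ : Ty} : Dfn fun p : (X × 𝓜.C σ) × 𝓜.C σ₁ => p.1.2 := Dfn.v0.fst

instance Dfn.v2 {σ σ₁ σ₂ : Ty} : Dfn fun p : ((X × 𝓜.C σ) × 𝓜.C σ₁) × 𝓜.C σ₂ => p.1.1.2 :=
  Dfn.v1.fst

instance Dfn.v3 {σ σ₁ σ₂ σ₃ : Ty} :
    Dfn fun p : (((X × 𝓜.C σ) × 𝓜.C σ₁) × 𝓜.C σ₂) × 𝓜.C σ₃ => p.1.1.1.2 := Dfn.v2.fst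

instance Dfn.v4 {σ σ₁ σ₂ σ₃ σ₄ : Ty} :
    Dfn fun p : ((((X × 𝓜.C σ) × 𝓜.C σ₁) × 𝓜.C σ₂) × 𝓜.C σ₃) × 𝓜.C σ₄ => p.1.1.1.1.2 :=
  Dfn.v3.fst

/-- Internal λ-abstraction with parameters; it is mere evaluation because internal functions on a
product are already curried. -/
theorem Dfn.lam {σ τ : Ty} (f : X → 𝓜.C σ → 𝓜.C τ) [hf : Dfn fun p : X × 𝓜.C σ => f p.1 p.2] :
    ∃ g : X → 𝓜.C (σ ⟶ₜ τ), Dfn g ∧ ∀ x y, g x ⬝ y = f x y := by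
  obtain ⟨e, he⟩ := hf
  exact ⟨fun x => Ctx.ev e x, ⟨e, fun _ => rfl⟩, fun x y => he (x, y)⟩

theorem Dfn.exists_elt {σ τ : Ty} (f : 𝓜.C σ → 𝓜.C τ)
    [hf : Dfn fun p : Unit × 𝓜.C σ => f p.2] : ∃ e : 𝓜.C (σ ⟶ₜ τ), ∀ x, e ⬝ x = f x := by
  obtain ⟨g, -, hg⟩ := Dfn.lam (𝓜 := 𝓜) (fun _ : Unit => f)
  exact ⟨g (), hg ()⟩

theorem Dfn.comp1 {σ τ : Ty} {f : 𝓜.C σ → 𝓜.C τ} (hf : Dfn fun p : Unit × 𝓜.C σ => f p.2)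
    (a : X → 𝓜.C σ) [Dfn a] : Dfn fun x => f (a x) := by
  obtain ⟨e, he⟩ := Dfn.exists_elt f
  exact (Dfn.app (fun _ => e) a).congr fun x => he _

theorem Dfn.comp2 {σ ρ τ : Ty} {f : 𝓜.C σ → 𝓜.C ρ → 𝓜.C τ}
    (hf : Dfn fun p : (Unit × 𝓜.C σ) × 𝓜.C ρ => f p.1.2 p.2)
    (a : X → 𝓜.C σ) (b : X → 𝓜.C ρ) [Dfn a] [Dfn b] : Dfn fun x => f (a x) (b x) := by
  obtain ⟨g, hg, h⟩ := Dfn.lam (fun (x : Unit × 𝓜.C σ) (y : 𝓜.C ρ) => f x.2 y)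
  obtain ⟨e, he⟩ := Dfn.exists_elt (fun x => g ((), x)) (hf := hg)
  exact (Dfn.app (fun x => e ⬝ a x) b).congr fun x => by rw [he, h]

/-- `P` has a characteristic function in the model. -/
class DfnP (𝓜 : Mdl) {X : Type} [Ctx 𝓜 X] (P : X → Prop) : Prop where
  exists_char : ∃ c : X → 𝓜.C Ty.N, Dfn c ∧ ∀ x, P x ↔ c x = 𝓜.zero

variable {P Q : X → Prop}

theorem DfnP.congr (hP : DfnP 𝓜 P) (h : ∀ x, P x ↔ Q x) : DfnP 𝓜 Q :=
  (funext fun x => propext (h x) : P = Q) ▸ hP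

theorem DfnP.comp1 {σ : Ty} {P : 𝓜.C σ → Prop}
    (hP : DfnP 𝓜 fun p : Unit × 𝓜.C σ => P p.2) (a : X → 𝓜.C σ) [Dfn a] :
    DfnP 𝓜 fun x => P (a x) := by
  obtain ⟨c, hc, h⟩ := hP
  exact ⟨_, Dfn.comp1 (f := fun y => c ((), y)) hc a, fun x => h ((), a x)⟩

theorem DfnP.comp2 {σ ρ : Ty} {P : 𝓜.C σ → 𝓜.C ρ → Prop}
    (hP : DfnP 𝓜 fun p : (Unit × 𝓜.C σ) × 𝓜.C ρ => P p.1.2 p.2)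
    (a : X → 𝓜.C σ) (b : X → 𝓜.C ρ) [Dfn a] [Dfn b] : DfnP 𝓜 fun x => P (a x) (b x) := by
  obtain ⟨c, hc, h⟩ := hP
  exact ⟨_, Dfn.comp2 (f := fun y z => c (((), y), z)) hc a b, fun x => h (((), a x), b x)⟩

instance DfnP.eq (a b : X → 𝓜.C Ty.N) [Dfn a] [Dfn b] : DfnP 𝓜 fun x => a x = b x := by
  obtain ⟨e, he⟩ := 𝓜.eqChar
  -- The recursor builds a sequence with value `a x` at 0 and `b x` at 1, the form that `eqChar`
  -- compares.
  refine ⟨fun x => e ⬝ (𝓜.R ⬝ (𝓜.K _ _ ⬝ (𝓜.K _ _ ⬝ b x)) ⬝ a x), inferInstance, fun x => ?_⟩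
  rw [he, 𝓜.R_zero, 𝓜.R_succ, 𝓜.app_K, 𝓜.app_K]

open Classical in
instance Dfn.ite (P : X → Prop) (a b : X → 𝓜.C Ty.N) [hP : DfnP 𝓜 P] [Dfn a] [Dfn b] :
    Dfn fun x => if P x then a x else b x := by
  obtain ⟨c, hc, h⟩ := hP
  refine Dfn.congr (f := fun x => 𝓜.R ⬝ (𝓜.K _ _ ⬝ (𝓜.K _ _ ⬝ b x)) ⬝ a x ⬝ c x)
    inferInstance fun x => ?_
  split_ifs with hx
  · rw [(h x).1 hx, 𝓜.R_zero]
  · rw [h] at hx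
    obtain h0 | ⟨m, hm⟩ := 𝓜.zero_or_succ (c x)
    · exact absurd h0 hx
    · rw [hm, 𝓜.R_succ, 𝓜.app_K, 𝓜.app_K]

/-- The number one of the model. -/
def Mdl.one (𝓜 : Mdl) : 𝓜.C Ty.N := 𝓜.succ ⬝ 𝓜.zero

theorem Mdl.one_ne (𝓜 : Mdl) : 𝓜.one ≠ 𝓜.zero := 𝓜.S1_ne _

open Classical in
instance DfnP.imp (P Q : X → Prop) [DfnP 𝓜 P] [hQ : DfnP 𝓜 Q] : DfnP 𝓜 fun x => P x → Q x := by
  obtain ⟨q, hq, h⟩ := hQ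
  refine ⟨fun x => if P x then q x else 𝓜.zero, inferInstance, fun x => ?_⟩
  by_cases hx : P x <;> simp [hx, h]

instance DfnP.false : DfnP 𝓜 fun _ : X => False :=
  ⟨fun _ => 𝓜.one, inferInstance, fun _ => by simp [𝓜.one_ne]⟩

instance DfnP.not (P : X → Prop) [DfnP 𝓜 P] : DfnP 𝓜 fun x => ¬ P x := DfnP.imp _ _

instance DfnP.and (P Q : X → Prop) [DfnP 𝓜 P] [DfnP 𝓜 Q] : DfnP 𝓜 fun x => P x ∧ Q x :=
  DfnP.congr (P := fun x => ¬ (P x → ¬ Q x)) inferInstance fun x => by simp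

instance DfnP.or (P Q : X → Prop) [DfnP 𝓜 P] [DfnP 𝓜 Q] : DfnP 𝓜 fun x => P x ∨ Q x :=
  DfnP.congr (P := fun x => ¬ P x → Q x) inferInstance fun _ => or_iff_not_imp_left.symm

instance DfnP.iff (P Q : X → Prop) [DfnP 𝓜 P] [DfnP 𝓜 Q] : DfnP 𝓜 fun x => P x ↔ Q x :=
  DfnP.congr (P := fun x => (P x → Q x) ∧ (Q x → P x)) inferInstance fun _ => iff_def.symm

/-- The use of (∃²): definable predicates are closed under number quantifiers, so that induction
extends from quantifier-free to arithmetical predicates. -/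
instance DfnP.ex (P : X → 𝓜.C Ty.N → Prop) [hP : DfnP 𝓜 fun p : X × 𝓜.C Ty.N => P p.1 p.2] :
    DfnP 𝓜 fun x => ∃ n, P x n := by
  obtain ⟨c, hc, h⟩ := hP
  obtain ⟨g, hg, hgc⟩ := Dfn.lam (fun x n => c (x, n))
  obtain ⟨E, hE⟩ := 𝓜.exTwo
  refine ⟨fun x => E ⬝ g x, inferInstance, fun x => ?_⟩
  rw [hE]
  simp only [hgc]
  exact exists_congr fun n => h (x, n)

instance DfnP.all (P : X → 𝓜.C Ty.N → Prop) [hP : DfnP 𝓜 fun p : X × 𝓜.C Ty.N => P p.1 p.2] :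
    DfnP 𝓜 fun x => ∀ n, P x n :=
  DfnP.congr (P := fun x => ¬ ∃ n, ¬ P x n) inferInstance fun x => by simp

theorem DfnP.exists_char_elt {σ : Ty} (P : 𝓜.C σ → Prop)
    [hP : DfnP 𝓜 fun p : Unit × 𝓜.C σ => P p.2] :
    ∃ e : 𝓜.C (σ ⟶ₜ Ty.N), ∀ x, (P x ∧ e ⬝ x = 𝓜.one) ∨ (¬ P x ∧ e ⬝ x = 𝓜.zero) := by
  classical
  obtain ⟨e, he⟩ := Dfn.exists_elt fun x => if P x then 𝓜.one else 𝓜.zero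
  refine ⟨e, fun x => ?_⟩
  by_cases hx : P x <;> simp [hx, he]

/-- The search operator. -/
theorem Mdl.exists_mu (𝓜 : Mdl) :
    ∃ μ : 𝓜.C Ty.two, ∀ f, (∃ n, f ⬝ n = 𝓜.zero) → f ⬝ (μ ⬝ f) = 𝓜.zero := by
  classical
  -- The guard makes every argument have a witness, as choice demands, even if `f` has no zero.
  let P : Unit × 𝓜.C Ty.one → 𝓜.C Ty.N → Prop :=
    fun p n => (∃ m, p.2 ⬝ m = 𝓜.zero) → p.2 ⬝ n = 𝓜.zero
  obtain ⟨c, hc, h⟩ : DfnP 𝓜 fun p : (Unit × 𝓜.C Ty.one) × 𝓜.C Ty.N => P p.1 p.2 := by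
    dsimp only [P]
    infer_instance
  obtain ⟨g, hg, hgc⟩ := Dfn.lam (fun x n => c (x, n))
  obtain ⟨e, he⟩ := Dfn.exists_elt (fun x => g ((), x)) (hf := hg)
  obtain ⟨μ, hμ⟩ := 𝓜.qfac e fun f => by
    by_cases hf : ∃ m, f ⬝ m = 𝓜.zero
    · obtain ⟨m, hm⟩ := hf
      exact ⟨m, by rw [he, hgc, ← h (((), f), m)]; exact fun _ => hm⟩
    · exact ⟨𝓜.zero, by rw [he, hgc, ← h (((), f), _)]; exact fun h => absurd h hf⟩
  refine ⟨μ, fun f => (h (((), f), _)).2 ?_⟩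
  rw [← hgc, ← he]
  exact hμ f

theorem Dfn.choose (P : X → 𝓜.C Ty.N → Prop) [hP : DfnP 𝓜 fun p : X × 𝓜.C Ty.N => P p.1 p.2] :
    ∃ g : X → 𝓜.C Ty.N, Dfn g ∧ ∀ x, (∃ n, P x n) → P x (g x) := by
  obtain ⟨c, hc, h⟩ := hP
  obtain ⟨g, hg, hgc⟩ := Dfn.lam (fun x n => c (x, n))
  obtain ⟨μ, hμ⟩ := 𝓜.exists_mu
  refine ⟨fun x => μ ⬝ g x, inferInstance, fun x ⟨n, hn⟩ => (h (x, _)).2 ?_⟩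
  rw [← hgc]
  exact hμ _ ⟨n, by rw [hgc]; exact (h (x, n)).1 hn⟩

theorem Dfn.choose_elt {σ : Ty} (P : 𝓜.C σ → 𝓜.C Ty.N → Prop)
    [hP : DfnP 𝓜 fun p : (Unit × 𝓜.C σ) × 𝓜.C Ty.N => P p.1.2 p.2] :
    ∃ e : 𝓜.C (σ ⟶ₜ Ty.N), ∀ x, (∃ n, P x n) → P x (e ⬝ x) := by
  obtain ⟨g, hg, h⟩ := Dfn.choose (fun (x : Unit × 𝓜.C σ) n => P x.2 n)
  obtain ⟨e, he⟩ := Dfn.exists_elt (fun x => g ((), x)) (hf := hg)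
  exact ⟨e, fun x hx => by rw [he]; exact h ((), x) hx⟩

theorem Dfn.exists_rec (a : 𝓜.C Ty.N) (s : 𝓜.C Ty.N → 𝓜.C Ty.N → 𝓜.C Ty.N)
    [hs : Dfn fun p : (Unit × 𝓜.C Ty.N) × 𝓜.C Ty.N => s p.1.2 p.2] :
    ∃ e : 𝓜.C Ty.one, e ⬝ 𝓜.zero = a ∧ ∀ n, e ⬝ (𝓜.succ ⬝ n) = s n (e ⬝ n) := by
  obtain ⟨g, hg, h⟩ := Dfn.lam (fun (x : Unit × 𝓜.C Ty.N) n => s x.2 n)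
  obtain ⟨e, he⟩ := Dfn.exists_elt (fun x => g ((), x)) (hf := hg)
  exact ⟨𝓜.R ⬝ e ⬝ a, 𝓜.R_zero _ _, fun n => by rw [𝓜.R_succ, he, h]⟩

/-- The model may be nonstandard, so induction needs an internal characteristic function. Its
existence is the extra case `dfn` of every induction below. -/
theorem Mdl.induction (P : 𝓜.C Ty.N → Prop) (dfn : DfnP 𝓜 fun p : Unit × 𝓜.C Ty.N => P p.2)
    (zero : P 𝓜.zero) (succ : ∀ n, P n → P (𝓜.succ ⬝ n)) (n : 𝓜.C Ty.N) : P n := by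
  obtain ⟨c, hc, h⟩ := dfn
  obtain ⟨e, he⟩ := Dfn.exists_elt (fun x => c ((), x)) (hf := hc)
  have key : ∀ x, P x ↔ e ⬝ x = 𝓜.zero := fun x => by rw [he]; exact h ((), x)
  rw [key]
  refine 𝓜.ind e ((key _).1 zero) (fun m hm => ?_) n
  rw [← key] at hm ⊢
  exact succ m hm

end

/-! ### Arithmetic in a model -/

namespace Mdl

variable {𝓜 : Mdl}

instance : Zero (𝓜.C Ty.N) := ⟨𝓜.zero⟩
instance : One (𝓜.C Ty.N) := ⟨𝓜.succ ⬝ 𝓜.zero⟩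
-- The operations are literally the values of the object-language terms, so that terms evaluate to
-- them definitionally.
instance : Add (𝓜.C Ty.N) := ⟨fun s t => 𝓜.R ⬝ (𝓜.K _ _ ⬝ 𝓜.succ) ⬝ s ⬝ t⟩
instance : Mul (𝓜.C Ty.N) := ⟨fun s t =>
  𝓜.R ⬝ (𝓜.K _ _ ⬝ (𝓜.S _ _ _ ⬝ (𝓜.R ⬝ (𝓜.K _ _ ⬝ 𝓜.succ)) ⬝ (𝓜.K _ _ ⬝ s))) ⬝ 𝓜.zero ⬝ t⟩

/-- `2 ^ t` in the model. -/
def pow2 (t : 𝓜.C Ty.N) : 𝓜.C Ty.N :=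
  𝓜.R ⬝ (𝓜.K _ _ ⬝ (𝓜.S _ _ _ ⬝ (𝓜.R ⬝ (𝓜.K _ _ ⬝ 𝓜.succ)) ⬝ (𝓜.S _ (Ty.N ⟶ₜ Ty.N) _ ⬝ 𝓜.K _ _ ⬝ 𝓜.K _ _)))
    ⬝ (𝓜.succ ⬝ 𝓜.zero) ⬝ t

section

variable {X : Type} [Ctx 𝓜 X] (a b : X → 𝓜.C Ty.N) [Dfn a] [Dfn b]

instance _root_.HigherOrder.Dfn.add : Dfn fun x => a x + b x :=
  inferInstanceAs (Dfn fun x => 𝓜.R ⬝ (𝓜.K _ _ ⬝ 𝓜.succ) ⬝ a x ⬝ b x)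

instance _root_.HigherOrder.Dfn.mul : Dfn fun x => a x * b x :=
  inferInstanceAs (Dfn fun x => 𝓜.R ⬝ (𝓜.K _ _ ⬝
    (𝓜.S _ _ _ ⬝ (𝓜.R ⬝ (𝓜.K _ _ ⬝ 𝓜.succ)) ⬝ (𝓜.K _ _ ⬝ a x))) ⬝ 𝓜.zero ⬝ b x)

instance _root_.HigherOrder.Dfn.pow2 : Dfn fun x => pow2 (a x) := by
  unfold Mdl.pow2
  infer_instance

end

theorem add_zero' (a : 𝓜.C Ty.N) : a + 0 = a := 𝓜.R_zero _ _

theorem add_succ' (a b : 𝓜.C Ty.N) : a + 𝓜.succ ⬝ b = 𝓜.succ ⬝ (a + b) :=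
  (𝓜.R_succ _ _ _).trans (congrArg (· ⬝ _) (𝓜.app_K _ _))

theorem mul_zero' (a : 𝓜.C Ty.N) : a * 0 = 0 := 𝓜.R_zero _ _

theorem mul_succ' (a b : 𝓜.C Ty.N) : a * 𝓜.succ ⬝ b = a * b + a := by
  refine (𝓜.R_succ _ _ _).trans ((congrArg (· ⬝ _) (𝓜.app_K _ _)).trans ((𝓜.app_S _ _ _).trans ?_))
  exact congrArg (_ ⬝ ·) (𝓜.app_K _ _)

theorem succ_eq (a : 𝓜.C Ty.N) : 𝓜.succ ⬝ a = a + 1 :=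
  ((add_succ' a 0).trans (by rw [add_zero'])).symm

theorem pow2_zero : pow2 (0 : 𝓜.C Ty.N) = 1 := 𝓜.R_zero _ _

theorem pow2_succ' (a : 𝓜.C Ty.N) : pow2 (𝓜.succ ⬝ a) = pow2 a + pow2 a := by
  refine (𝓜.R_succ _ _ _).trans ((congrArg (· ⬝ _) (𝓜.app_K _ _)).trans ((𝓜.app_S _ _ _).trans ?_))
  exact congrArg (_ ⬝ ·) ((𝓜.app_S _ _ _).trans (𝓜.app_K _ _))

theorem zero_add' (a : 𝓜.C Ty.N) : 0 + a = a := by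
  induction a using Mdl.induction with
  | dfn => infer_instance
  | zero => exact add_zero' _
  | succ n ih => rw [add_succ', ih]

theorem succ_add' (a b : 𝓜.C Ty.N) : 𝓜.succ ⬝ a + b = 𝓜.succ ⬝ (a + b) := by
  induction b using Mdl.induction with
  | dfn => infer_instance
  | zero => exact (add_zero' _).trans (congrArg _ (add_zero' _).symm)
  | succ n ih => rw [add_succ', add_succ', ih]

theorem add_comm' (a b : 𝓜.C Ty.N) : a + b = b + a := by
  induction b using Mdl.induction with
  | dfn => infer_instance
  | zero => exact (add_zero' _).trans (zero_add' _).symm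
  | succ n ih => rw [add_succ', succ_add', ih]

theorem add_assoc' (a b c : 𝓜.C Ty.N) : a + b + c = a + (b + c) := by
  induction c using Mdl.induction with
  | dfn => infer_instance
  | zero => exact (add_zero' _).trans (congrArg _ (add_zero' _).symm)
  | succ n ih => rw [add_succ', add_succ', add_succ', ih]

theorem mul_add' (a b c : 𝓜.C Ty.N) : a * (b + c) = a * b + a * c := by
  induction c using Mdl.induction with
  | dfn => infer_instance
  | zero =>
    change a * (b + 0) = a * b + a * 0
    rw [add_zero', mul_zero', add_zero']
  | succ n ih => rw [add_succ', mul_succ', mul_succ', ih, add_assoc']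

theorem zero_mul' (a : 𝓜.C Ty.N) : 0 * a = 0 := by
  induction a using Mdl.induction with
  | dfn => infer_instance
  | zero => exact mul_zero' _
  | succ n ih => rw [mul_succ', ih, add_zero']

theorem succ_mul' (a b : 𝓜.C Ty.N) : 𝓜.succ ⬝ a * b = a * b + b := by
  induction b using Mdl.induction with
  | dfn => infer_instance
  | zero =>
    change _ * 0 = a * 0 + 0
    rw [mul_zero', mul_zero', add_zero']
  | succ n ih =>
    rw [mul_succ', mul_succ', ih, add_succ', add_succ', add_assoc', add_assoc', add_comm' n a]

theorem mul_comm' (a b : 𝓜.C Ty.N) : a * b = b * a := by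
  induction b using Mdl.induction with
  | dfn => infer_instance
  | zero => exact (mul_zero' _).trans (zero_mul' _).symm
  | succ n ih => rw [mul_succ', succ_mul', ih]

theorem mul_assoc' (a b c : 𝓜.C Ty.N) : a * b * c = a * (b * c) := by
  induction c using Mdl.induction with
  | dfn => infer_instance
  | zero =>
    change a * b * 0 = a * (b * 0)
    rw [mul_zero', mul_zero', mul_zero']
  | succ n ih => rw [mul_succ', mul_succ', mul_add', ih]

theorem mul_one' (a : 𝓜.C Ty.N) : a * 1 = a :=
  (mul_succ' a 0).trans (by rw [mul_zero', zero_add'])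

instance : CommSemiring (𝓜.C Ty.N) where
  add_assoc := add_assoc'
  zero_add := zero_add'
  add_zero := add_zero'
  add_comm := add_comm'
  nsmul := nsmulRec
  left_distrib := mul_add'
  right_distrib a b c := by rw [mul_comm', mul_add', mul_comm' c a, mul_comm' c b]
  zero_mul := zero_mul'
  mul_zero := mul_zero'
  mul_assoc := mul_assoc'
  one_mul a := (mul_comm' 1 a).trans (mul_one' a)
  mul_one := mul_one'
  mul_comm := mul_comm'

theorem pow2_add_one (a : 𝓜.C Ty.N) : pow2 (a + 1) = 2 * pow2 a := by
  rw [← succ_eq, pow2_succ', two_mul]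

theorem num_induction (P : 𝓜.C Ty.N → Prop) (dfn : DfnP 𝓜 fun p : Unit × 𝓜.C Ty.N => P p.2)
    (zero : P 0) (succ : ∀ n, P n → P (n + 1)) (n : 𝓜.C Ty.N) : P n :=
  Mdl.induction P dfn zero (fun n hn => succ_eq n ▸ succ n hn) n

theorem eq_zero_or (n : 𝓜.C Ty.N) : n = 0 ∨ ∃ m, n = m + 1 := by
  obtain h | ⟨m, h⟩ := 𝓜.zero_or_succ n
  · exact .inl h
  · exact .inr ⟨m, h.trans (succ_eq m)⟩

theorem add_one_ne (n : 𝓜.C Ty.N) : n + 1 ≠ 0 := succ_eq n ▸ 𝓜.S1_ne n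

theorem add_one_inj {m n : 𝓜.C Ty.N} (h : m + 1 = n + 1) : m = n := by
  rw [← succ_eq, ← succ_eq] at h
  exact 𝓜.S1_inj _ _ h

theorem add_cancel {a b c : 𝓜.C Ty.N} : a + c = b + c → a = b := by
  induction c using Mdl.num_induction with
  | dfn => infer_instance
  | zero => simp
  | succ n ih =>
    intro h
    rw [← add_assoc, ← add_assoc] at h
    exact ih (add_one_inj h)

theorem eq_zero_of_add {a b : 𝓜.C Ty.N} (h : a + b = 0) : b = 0 := by
  obtain h0 | ⟨m, rfl⟩ := eq_zero_or b
  · exact h0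
  · rw [← add_assoc] at h
    exact absurd h (add_one_ne _)

theorem exists_add (a b : 𝓜.C Ty.N) : (∃ u, a + u = b) ∨ ∃ u, b + u = a := by
  induction a using Mdl.num_induction with
  | dfn => infer_instance
  | zero => exact .inl ⟨b, zero_add b⟩
  | succ n ih =>
    obtain ⟨u, rfl⟩ | ⟨u, rfl⟩ := ih
    · obtain rfl | ⟨m, rfl⟩ := eq_zero_or u
      · exact .inr ⟨1, by ring⟩
      · exact .inl ⟨m, by ring⟩
    · exact .inr ⟨u + 1, by ring⟩

noncomputable instance : LinearOrder (𝓜.C Ty.N) where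
  le a b := ∃ u, a + u = b
  le_refl a := ⟨0, add_zero a⟩
  le_trans := by
    rintro a _ _ ⟨u, rfl⟩ ⟨v, rfl⟩
    exact ⟨u + v, by ring⟩
  le_antisymm := by
    rintro a _ ⟨u, rfl⟩ ⟨v, h⟩
    have : u + v = 0 := add_cancel (c := a) (by rw [zero_add, add_comm, ← add_assoc, h])
    rw [add_comm] at this
    rw [eq_zero_of_add this, add_zero]
  le_total := exists_add
  toDecidableLE := Classical.decRel _

theorem le_iff {a b : 𝓜.C Ty.N} : a ≤ b ↔ ∃ u, a + u = b := Iff.rfl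

theorem num_nonneg (a : 𝓜.C Ty.N) : 0 ≤ a := ⟨a, zero_add a⟩

theorem add_one_le_iff {a b : 𝓜.C Ty.N} : a + 1 ≤ b ↔ a < b := by
  constructor
  · rintro ⟨u, rfl⟩
    refine lt_of_le_of_ne ⟨1 + u, by ring⟩ fun h => ?_
    exact add_one_ne u (add_cancel (c := a) (by rw [zero_add]; conv_rhs => rw [h]
                                                ring))
  · rintro h
    obtain ⟨u, rfl⟩ := h.le
    obtain rfl | ⟨m, rfl⟩ := eq_zero_or u
    · exact absurd h (by rw [add_zero]; exact lt_irrefl a)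
    · exact ⟨m, by ring⟩

instance : IsStrictOrderedRing (𝓜.C Ty.N) where
  add_le_add_left a b h c := by
    obtain ⟨u, rfl⟩ := h
    exact ⟨u, by ring⟩
  le_of_add_le_add_left a b c h := by
    obtain ⟨u, hu⟩ := h
    exact ⟨u, add_cancel (c := a) (by rw [← add_comm a c, ← hu]; ring)⟩
  zero_le_one := num_nonneg 1
  exists_pair_ne := ⟨0, 1, fun h => add_one_ne 0 (by rw [zero_add, ← h])⟩
  mul_lt_mul_of_pos_left a ha b c h := by
    obtain ⟨u, rfl⟩ := add_one_le_iff.2 ha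
    obtain ⟨v, rfl⟩ := add_one_le_iff.2 h
    exact add_one_le_iff.1 ⟨u + v + u * v, by ring⟩
  mul_lt_mul_of_pos_right a ha b c h := by
    obtain ⟨u, rfl⟩ := add_one_le_iff.2 ha
    obtain ⟨v, rfl⟩ := add_one_le_iff.2 h
    exact add_one_le_iff.1 ⟨u + v + u * v, by ring⟩

section

variable {X : Type} [Ctx 𝓜 X] (a b : X → 𝓜.C Ty.N) [Dfn a] [Dfn b]

instance _root_.HigherOrder.DfnP.le : DfnP 𝓜 fun x => a x ≤ b x :=
  DfnP.comp2 (P := fun a b => a ≤ b)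
    (inferInstanceAs (DfnP 𝓜 fun p : (Unit × 𝓜.C Ty.N) × 𝓜.C Ty.N => ∃ u, p.1.2 + u = p.2)) a b

instance _root_.HigherOrder.DfnP.lt : DfnP 𝓜 fun x => a x < b x :=
  DfnP.congr (P := fun x => a x + 1 ≤ b x) inferInstance fun _ => add_one_le_iff

end

/-- Behind this lies the Archimedean property relative to the model: the numbers 2^(-n) become
arbitrarily small in its rationals. -/
theorem lt_pow2 (n : 𝓜.C Ty.N) : n < pow2 n := by
  induction n using Mdl.num_induction with
  | dfn => infer_instance
  | zero => rw [pow2_zero]; exact one_pos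
  | succ n ih =>
    rw [pow2_add_one]
    rw [two_mul]
    exact (add_one_le_iff.2 ih).trans_lt (lt_add_of_pos_left _ ((num_nonneg n).trans_lt ih))

/-- The claim is arithmetical in `f`, so internal induction covers lengths `n` that may be
nonstandard. It is the only finiteness principle needed about the centres of a cover. -/
theorem exists_bound (f : 𝓜.C Ty.one) (n : 𝓜.C Ty.N) : ∃ B, ∀ i, i ≤ n → f ⬝ i ≤ B := by
  induction n using Mdl.num_induction with
  | dfn => infer_instance
  | zero => exact ⟨f ⬝ 0, fun i hi => by rw [le_antisymm hi (num_nonneg i)]⟩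
  | succ n ih =>
    obtain ⟨B, hB⟩ := ih
    refine ⟨max B (f ⬝ (n + 1)), fun i hi => ?_⟩
    obtain h | rfl := hi.lt_or_eq
    · exact (hB i (le_of_add_le_add_right (add_one_le_iff.2 h))).trans (le_max_left _ _)
    · exact le_max_right _ _

end Mdl

/-! ### The ordered field of fractions of an ordered semiring -/

section FieldOfFractions

variable (N : Type) [CommSemiring N]

section

variable [LinearOrder N] [IsStrictOrderedRing N]

/-- The congruence `(a, b) ∼ (c, d) ↔ a + d = c + b` on formal differences. -/
def diffCon : RingCon (QuadraticAlgebra N 1 0) where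
  -- In `QuadraticAlgebra N 1 0` the generator has square 1; the congruence sends it to -1, so an
  -- element stands for `re - im`.
  r x y := x.re + y.im = y.re + x.im
  iseqv := by
    refine ⟨fun _ => rfl, fun h => h.symm, fun {x y z} h h' => ?_⟩
    apply add_right_cancel (b := y.re + y.im)
    calc x.re + z.im + (y.re + y.im) = (x.re + y.im) + (y.re + z.im) := by ring
      _ = (y.re + x.im) + (z.re + y.im) := by rw [h, h']
      _ = _ := by ring
  add' {w x y z} h h' := by
    simp only [QuadraticAlgebra.re_add, QuadraticAlgebra.im_add]
    calc w.re + y.re + (x.im + z.im) = (w.re + x.im) + (y.re + z.im) := by ring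
      _ = (x.re + w.im) + (z.re + y.im) := by rw [h, h']
      _ = _ := by ring
  mul' {w x y z} h h' := by
    simp only [QuadraticAlgebra.re_mul, QuadraticAlgebra.im_mul, one_mul, zero_mul, add_zero]
    apply add_right_cancel (b := x.re * y.im + x.im * y.re + x.re * y.re + x.im * y.im)
    calc _ = (w.re + x.im) * y.re + (x.re + w.im) * y.im + x.re * (y.re + z.im)
          + x.im * (z.re + y.im) := by ring
      _ = (x.re + w.im) * y.re + (w.re + x.im) * y.im + x.re * (z.re + y.im)
          + x.im * (y.re + z.im) := by rw [h, h']
      _ = _ := by ring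

/-- The ring of differences. -/
abbrev DiffRing : Type := (diffCon N).Quotient

instance : Neg (DiffRing N) :=
  ⟨Quotient.map (fun x => ⟨x.im, x.re⟩) fun x y h => by
    change x.im + y.re = y.im + x.re
    rw [add_comm, add_comm y.im]
    exact (show x.re + y.im = y.re + x.im from h).symm⟩

noncomputable instance : CommRing (DiffRing N) where
  zsmul := zsmulRec
  neg_add_cancel x := by
    induction x using Quotient.inductionOn with
    | h x =>
      refine Quotient.sound (s := (diffCon N).toSetoid) ?_
      change (x.im + x.re) + 0 = 0 + (x.re + x.im)
      ring

/-- The embedding of the semiring into its ring of differences. -/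
def toDiff : N →+* DiffRing N :=
  (diffCon N).mk'.comp (algebraMap N (QuadraticAlgebra N 1 0))

variable {N}

theorem toDiff_eq {a b : N} : toDiff N a = toDiff N b ↔ a = b := by
  refine (RingCon.eq _).trans ?_
  change a + 0 = b + 0 ↔ _
  simp

theorem exists_toDiff (x : DiffRing N) : ∃ a b, x = toDiff N a - toDiff N b := by
  induction x using Quotient.inductionOn with
  | h x =>
    refine ⟨x.re, x.im, ?_⟩
    rw [sub_eq_add_neg]
    refine Quotient.sound (s := (diffCon N).toSetoid) ?_
    change x.re + (0 + x.im) = (x.re + 0) + x.im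
    ring

/-- Of two elements of `N`, the larger is the smaller plus something. This reduces the absence of
zero divisors and the totality of the order to `N`. -/
theorem toDiff_cases [CanonicallyOrderedAdd N] (x : DiffRing N) : ∃ u, x = toDiff N u ∨ x = -toDiff N u := by
  obtain ⟨a, b, rfl⟩ := exists_toDiff x
  obtain h | h := le_total a b
  · obtain ⟨u, rfl⟩ := le_iff_exists_add.1 h
    exact ⟨u, .inr (by rw [map_add]; ring)⟩
  · obtain ⟨u, rfl⟩ := le_iff_exists_add.1 h
    exact ⟨u, .inl (by rw [map_add]; ring)⟩

instance [CanonicallyOrderedAdd N] : IsDomain (DiffRing N) := by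
  have : Nontrivial (DiffRing N) :=
    ⟨toDiff N 0, toDiff N 1, fun h => zero_ne_one (toDiff_eq.1 h)⟩
  have : NoZeroDivisors (DiffRing N) := by
    constructor
    intro x y h
    obtain ⟨u, hu⟩ := toDiff_cases x
    obtain ⟨v, hv⟩ := toDiff_cases y
    have h1 : toDiff N (u * v) = toDiff N 0 := by
      rw [map_mul, map_zero]
      obtain rfl | rfl := hu <;> obtain rfl | rfl := hv <;> simpa using h
    obtain h2 | h2 := mul_eq_zero.1 (toDiff_eq.1 h1) <;> simp_all
  exact NoZeroDivisors.to_isDomain _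

end

variable {N} in
/-- The cone of a field whose elements are, up to sign, quotients of elements of `N`. -/
def quotientCone [PartialOrder N] [CanonicallyOrderedAdd N] [NoZeroDivisors N] [Nontrivial N]
    {F : Type} [Field F] (j : N →+* F) (hj : Function.Injective j) : RingCone F where
  carrier := {x | ∃ u d, j d ≠ 0 ∧ x = j u / j d}
  zero_mem' := ⟨0, 1, by simp⟩
  one_mem' := ⟨1, 1, by simp⟩
  add_mem' := by
    rintro _ _ ⟨u, d, hd, rfl⟩ ⟨v, e, he, rfl⟩
    refine ⟨u * e + v * d, d * e, ?_, ?_⟩ <;> simp only [map_mul, map_add]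
    · exact mul_ne_zero hd he
    · field_simp
  mul_mem' := by
    rintro _ _ ⟨u, d, hd, rfl⟩ ⟨v, e, he, rfl⟩
    refine ⟨u * v, d * e, ?_, ?_⟩ <;> simp only [map_mul]
    · exact mul_ne_zero hd he
    · field_simp
  eq_zero_of_mem_of_neg_mem' := by
    rintro _ ⟨u, d, hd, rfl⟩ ⟨v, e, he, h⟩
    have h1 : j (u * e + v * d) = j 0 := by
      rw [map_add, map_mul, map_mul, map_zero]
      field_simp at h
      linear_combination -h
    -- In a canonically ordered semiring the summands of a vanishing sum vanish.
    have h2 : u * e = 0 := by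
      have := hj h1
      exact le_antisymm (this ▸ le_self_add) zero_le
    obtain rfl | rfl := mul_eq_zero.1 h2
    · simp
    · simp at he

theorem exists_orderedField [LinearOrder N] [IsStrictOrderedRing N] [CanonicallyOrderedAdd N] :
    ∃ (F : Type) (_ : Field F) (_ : LinearOrder F) (_ : IsStrictOrderedRing F) (ι : N →+* F),
      StrictMono ι ∧ ∀ x : F, ∃ a b d : N, d ≠ 0 ∧ x = (ι a - ι b) / ι d := by
  classical
  let F := FractionRing (DiffRing N)
  let j : N →+* F := (algebraMap (DiffRing N) F).comp (toDiff N)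
  have hj : Function.Injective j := fun a b h => toDiff_eq.1 (IsFractionRing.injective _ F h)
  have hform : ∀ x : F, ∃ u d, j d ≠ 0 ∧ (x = j u / j d ∨ x = -(j u / j d)) := by
    intro x
    obtain ⟨r, s, hs, rfl⟩ := IsFractionRing.div_surjective (A := DiffRing N) x
    have hs' := IsFractionRing.to_map_ne_zero_of_mem_nonZeroDivisors (K := F) hs
    obtain ⟨u, rfl | rfl⟩ := toDiff_cases r <;> obtain ⟨d, rfl | rfl⟩ := toDiff_cases s
    · exact ⟨u, d, hs', .inl rfl⟩
    · exact ⟨u, d, by rw [map_neg] at hs'; exact neg_ne_zero.1 hs', .inr (by simp [j, div_neg])⟩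
    · exact ⟨u, d, hs', .inr (by simp [j, neg_div])⟩
    · exact ⟨u, d, by rw [map_neg] at hs'; exact neg_ne_zero.1 hs', .inl (by simp [j])⟩
  let P := quotientCone j hj
  have hP : HasMemOrNegMem P := ⟨fun x => by
    obtain ⟨u, d, hd, h | h⟩ := hform x
    · exact .inl ⟨u, d, hd, h⟩
    · exact .inr ⟨u, d, hd, by rw [h, neg_neg]⟩⟩
  let _ : LinearOrder F := LinearOrder.mkOfAddGroupCone P
  have h1 : IsOrderedRing F := IsOrderedRing.mkOfCone P
  have h2 : IsStrictOrderedRing F := IsOrderedRing.toIsStrictOrderedRing F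
  refine ⟨F, inferInstance, inferInstance, h2, j, ?_, ?_⟩
  · refine Monotone.strictMono_of_injective (fun a b h => ?_) hj
    obtain ⟨u, rfl⟩ := le_iff_exists_add.1 h
    exact ⟨u, 1, by simp, by simp⟩
  · intro x
    obtain ⟨u, d, hd, h | h⟩ := hform x
    · exact ⟨u, 0, d, fun h0 => hd (by rw [h0, map_zero]), by rw [h, map_zero, sub_zero]⟩
    · exact ⟨0, u, d, fun h0 => hd (by rw [h0, map_zero]), by rw [h, map_zero, zero_sub, neg_div]⟩

end FieldOfFractions

/-! ### Rational numbers in a model -/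

namespace Mdl

variable {𝓜 : Mdl}

instance : CanonicallyOrderedAdd (𝓜.C Ty.N) where
  exists_add_of_le h := by
    obtain ⟨u, rfl⟩ := h
    exact ⟨u, rfl⟩
  le_add_self a b := ⟨b, add_comm _ _⟩
  le_self_add _ b := ⟨b, rfl⟩

/-- The ordered field of rational numbers of the model. -/
def F (𝓜 : Mdl) : Type := (exists_orderedField (𝓜.C Ty.N)).choose

noncomputable instance : Field 𝓜.F := (exists_orderedField (𝓜.C Ty.N)).choose_spec.choose

noncomputable instance : LinearOrder 𝓜.F :=
  (exists_orderedField (𝓜.C Ty.N)).choose_spec.choose_spec.choose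

instance : IsStrictOrderedRing 𝓜.F :=
  (exists_orderedField (𝓜.C Ty.N)).choose_spec.choose_spec.choose_spec.choose

/-- The embedding of the natural numbers of the model into its rational numbers. -/
noncomputable def ι (𝓜 : Mdl) : 𝓜.C Ty.N →+* 𝓜.F :=
  (exists_orderedField (𝓜.C Ty.N)).choose_spec.choose_spec.choose_spec.choose_spec.choose

theorem ι_strictMono : StrictMono 𝓜.ι :=
  (exists_orderedField (𝓜.C Ty.N)).choose_spec.choose_spec.choose_spec.choose_spec.choose_spec.1

theorem exists_eq_div (x : 𝓜.F) : ∃ a b d, d ≠ 0 ∧ x = (𝓜.ι a - 𝓜.ι b) / 𝓜.ι d :=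
  (exists_orderedField (𝓜.C Ty.N)).choose_spec.choose_spec.choose_spec.choose_spec.choose_spec.2 x

theorem ι_nonneg (a : 𝓜.C Ty.N) : 0 ≤ 𝓜.ι a := by
  rw [← map_zero 𝓜.ι]
  exact ι_strictMono.monotone (num_nonneg a)

theorem ι_pos {a : 𝓜.C Ty.N} (h : a ≠ 0) : 0 < 𝓜.ι a := by
  rw [← map_zero 𝓜.ι]
  exact ι_strictMono (lt_of_le_of_ne (num_nonneg a) h.symm)

theorem ι_le {a b : 𝓜.C Ty.N} : 𝓜.ι a ≤ 𝓜.ι b ↔ a ≤ b := ι_strictMono.le_iff_le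
theorem ι_lt {a b : 𝓜.C Ty.N} : 𝓜.ι a < 𝓜.ι b ↔ a < b := ι_strictMono.lt_iff_lt
theorem ι_eq {a b : 𝓜.C Ty.N} : 𝓜.ι a = 𝓜.ι b ↔ a = b := ι_strictMono.injective.eq_iff

theorem pow2_ne_zero (n : 𝓜.C Ty.N) : pow2 n ≠ 0 :=
  ((num_nonneg n).trans_lt (lt_pow2 n)).ne'

/-- `2 ^ (-n)`. -/
noncomputable def pw (n : 𝓜.C Ty.N) : 𝓜.F := (𝓜.ι (pow2 n))⁻¹

theorem pw_pos (n : 𝓜.C Ty.N) : 0 < pw n := inv_pos.2 (ι_pos (pow2_ne_zero n))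

theorem pw_zero : pw (0 : 𝓜.C Ty.N) = 1 := by rw [pw, pow2_zero, map_one, inv_one]

theorem pw_add_one (n : 𝓜.C Ty.N) : 2 * pw (n + 1) = pw n := by
  have := (ι_pos (pow2_ne_zero n)).ne'
  rw [pw, pw, pow2_add_one, map_mul, map_ofNat]
  field_simp

theorem pw_add_le (n i : 𝓜.C Ty.N) : pw (n + i) ≤ pw n := by
  rw [pw, pw, inv_le_inv₀ (ι_pos (pow2_ne_zero _)) (ι_pos (pow2_ne_zero _)), ι_le]
  induction i using Mdl.num_induction with
  | dfn => infer_instance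
  | zero => rw [add_zero]
  | succ i ih =>
    rw [← add_assoc, pow2_add_one, two_mul]
    exact ih.trans le_self_add

theorem pw_le {m n : 𝓜.C Ty.N} (h : m ≤ n) : pw n ≤ pw m := by
  obtain ⟨i, rfl⟩ := h
  exact pw_add_le m i

/-- Write 1/e = (a - b)/d with d ≥ 1; this is at most a, hence less than 2^a. -/
theorem exists_pw_lt {e : 𝓜.F} (he : 0 < e) : ∃ n : 𝓜.C Ty.N, pw n < e := by
  obtain ⟨a, b, d, hd, h⟩ := exists_eq_div e⁻¹
  refine ⟨a, (inv_lt_comm₀ he (ι_pos (pow2_ne_zero _))).1 ?_⟩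
  have h1 : 1 ≤ 𝓜.ι d := by
    rw [← map_one 𝓜.ι, ι_le, ← zero_add 1]
    exact add_one_le_iff.2 (lt_of_le_of_ne (num_nonneg d) hd.symm)
  have h2 : 𝓜.ι a < 𝓜.ι (pow2 a) := ι_lt.2 (lt_pow2 a)
  rw [h, div_lt_iff₀ (by linarith)]
  nlinarith [ι_nonneg b, ι_nonneg a]

/-- `c` is the code of the pair `(a, b)`. -/
def Pair (c a b : 𝓜.C Ty.N) : Prop := c + c = (a + b) * (a + b + 1) + (b + b)

theorem exists_pair (a b : 𝓜.C Ty.N) : ∃ c, Pair c a b := by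
  have h : ∀ s : 𝓜.C Ty.N, ∃ t, t + t = s * (s + 1) := fun s => by
    induction s using Mdl.num_induction with
    | dfn => infer_instance
    | zero => exact ⟨0, by ring⟩
    | succ s ih =>
      obtain ⟨t, ht⟩ := ih
      refine ⟨t + s + 1, ?_⟩
      calc t + s + 1 + (t + s + 1) = (t + t) + 2 * s + 2 := by ring
        _ = _ := by rw [ht]; ring
  obtain ⟨t, ht⟩ := h (a + b)
  refine ⟨t + b, ?_⟩
  rw [Pair, ← ht]
  ring

/-- The next code moves along the diagonal from (a+1, b) to (a, b+1), or from the end (0, b) to the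
start (b+1, 0) of the next diagonal. -/
theorem exists_unpair (c : 𝓜.C Ty.N) : ∃ a b, Pair c a b := by
  induction c using Mdl.num_induction with
  | dfn => unfold Pair; infer_instance
  | zero => exact ⟨0, 0, by rw [Pair]; ring⟩
  | succ c ih =>
    obtain ⟨a, b, h⟩ := ih
    have h' : c + 1 + (c + 1) = (c + c) + 2 := by ring
    rw [Pair] at h
    obtain rfl | ⟨a, rfl⟩ := eq_zero_or a
    · exact ⟨b + 1, 0, by rw [Pair, h', h]; ring⟩
    · exact ⟨a, b + 1, by rw [Pair, h', h]; ring⟩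

/-- Codes on different diagonals do not overlap: with s = a + b, twice a code on diagonal s is at
most s(s+1) + 2s, which is less than (s+1)(s+2). -/
theorem Pair.add_le {c a b a' b' : 𝓜.C Ty.N} (h : Pair c a b) (h' : Pair c a' b') :
    a' + b' ≤ a + b := by
  by_contra hlt
  obtain ⟨u, hu⟩ := add_one_le_iff.2 (not_le.1 hlt)
  have h1 := congrArg 𝓜.ι (h.symm.trans h')
  rw [← hu] at h1
  simp only [map_add, map_mul, map_one] at h1
  nlinarith [ι_nonneg a, ι_nonneg b, ι_nonneg u, ι_nonneg b', mul_nonneg (ι_nonneg a) (ι_nonneg u),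
    mul_nonneg (ι_nonneg b) (ι_nonneg u), mul_nonneg (ι_nonneg u) (ι_nonneg u)]

theorem Pair.unique {c a b a' b' : 𝓜.C Ty.N} (h : Pair c a b) (h' : Pair c a' b') :
    a = a' ∧ b = b' := by
  have hs : a + b = a' + b' := le_antisymm (h'.add_le h) (h.add_le h')
  have h1 := congrArg 𝓜.ι (h.symm.trans h')
  have h2 := congrArg 𝓜.ι hs
  rw [hs] at h1
  simp only [map_add, map_mul, map_one] at h1 h2
  constructor <;> rw [← ι_eq] <;> linarith

/-- `q` codes `(a - b) / (d + 1)`. -/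
def RatCode (q a b d : 𝓜.C Ty.N) : Prop := ∃ p, Pair p a b ∧ Pair q p d

theorem exists_ratCode (a b d : 𝓜.C Ty.N) : ∃ q, RatCode q a b d := by
  obtain ⟨p, hp⟩ := exists_pair a b
  obtain ⟨q, hq⟩ := exists_pair p d
  exact ⟨q, p, hp, hq⟩

theorem exists_decode (q : 𝓜.C Ty.N) : ∃ a b d, RatCode q a b d := by
  obtain ⟨p, d, hq⟩ := exists_unpair q
  obtain ⟨a, b, hp⟩ := exists_unpair p
  exact ⟨a, b, d, p, hp, hq⟩

theorem RatCode.unique {q a b d a' b' d' : 𝓜.C Ty.N} (h : RatCode q a b d)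
    (h' : RatCode q a' b' d') : a = a' ∧ b = b' ∧ d = d' := by
  obtain ⟨p, hp, hq⟩ := h
  obtain ⟨p', hp', hq'⟩ := h'
  obtain ⟨rfl, rfl⟩ := hq.unique hq'
  obtain ⟨rfl, rfl⟩ := hp.unique hp'
  exact ⟨rfl, rfl, rfl⟩

theorem exists_rat (q : 𝓜.C Ty.N) :
    ∃ x : 𝓜.F, ∀ a b d, RatCode q a b d → x = (𝓜.ι a - 𝓜.ι b) / (𝓜.ι d + 1) := by
  obtain ⟨a, b, d, h⟩ := exists_decode q
  refine ⟨(𝓜.ι a - 𝓜.ι b) / (𝓜.ι d + 1), fun a' b' d' h' => ?_⟩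
  obtain ⟨rfl, rfl, rfl⟩ := h.unique h'
  rfl

/-- The rational number coded by `q`. -/
noncomputable def rat (q : 𝓜.C Ty.N) : 𝓜.F := (exists_rat q).choose

theorem RatCode.rat_eq {q a b d : 𝓜.C Ty.N} (h : RatCode q a b d) :
    rat q = (𝓜.ι a - 𝓜.ι b) / (𝓜.ι d + 1) := (exists_rat q).choose_spec a b d h

theorem exists_rat_eq (x : 𝓜.F) : ∃ q, rat q = x := by
  obtain ⟨a, b, d, hd, rfl⟩ := exists_eq_div x
  obtain h | ⟨d, rfl⟩ := eq_zero_or d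
  · exact absurd h hd
  obtain ⟨q, hq⟩ := exists_ratCode a b d
  exact ⟨q, by rw [hq.rat_eq, map_add, map_one]⟩

theorem rat_zero : rat (0 : 𝓜.C Ty.N) = 0 := by
  have : RatCode (0 : 𝓜.C Ty.N) 0 0 0 := ⟨0, by rw [Pair]; ring, by rw [Pair]; ring⟩
  rw [this.rat_eq]
  simp

theorem rat_one : rat (1 : 𝓜.C Ty.N) = 1 := by
  have : RatCode (1 : 𝓜.C Ty.N) 1 0 0 := ⟨1, by rw [Pair]; ring, by rw [Pair]; ring⟩
  rw [this.rat_eq]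
  simp

/-! ### Definable functions with rational values -/

section

variable {X : Type} [Ctx 𝓜 X]

/-- `g` is a quotient of definable functions. -/
class DfnF (g : X → 𝓜.F) : Prop where
  exists_quot : ∃ a b d : X → 𝓜.C Ty.N, Dfn a ∧ Dfn b ∧ Dfn d ∧
    ∀ x, d x ≠ 0 ∧ g x = (𝓜.ι (a x) - 𝓜.ι (b x)) / 𝓜.ι (d x)

instance DfnF.const (c : 𝓜.F) : DfnF fun _ : X => c := by
  obtain ⟨a, b, d, h⟩ := exists_eq_div c
  exact ⟨fun _ => a, fun _ => b, fun _ => d, inferInstance, inferInstance, inferInstance,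
    fun _ => h⟩

instance DfnF.ι (a : X → 𝓜.C Ty.N) [Dfn a] : DfnF fun x => 𝓜.ι (a x) :=
  ⟨a, fun _ => 0, fun _ => 1, inferInstance, inferInstance, inferInstance,
    fun x => ⟨one_ne_zero, by simp⟩⟩

instance DfnF.pw (a : X → 𝓜.C Ty.N) [Dfn a] : DfnF fun x => pw (a x) :=
  ⟨fun _ => 1, fun _ => 0, fun x => pow2 (a x), inferInstance, inferInstance, inferInstance,
    fun x => ⟨pow2_ne_zero _, by simp [Mdl.pw]⟩⟩

instance DfnF.rat (a : X → 𝓜.C Ty.N) [Dfn a] : DfnF fun x => rat (a x) := by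
  -- Decoding is done by search: each component is found separately with the others quantified away,
  -- and uniqueness of codes reassembles them.
  obtain ⟨f, hf⟩ := Dfn.choose_elt (fun (q a : 𝓜.C Ty.N) => ∃ b d p, Pair p a b ∧ Pair q p d)
    (hP := by unfold Pair; infer_instance)
  obtain ⟨g, hg⟩ := Dfn.choose_elt (fun (q b : 𝓜.C Ty.N) => ∃ a d p, Pair p a b ∧ Pair q p d)
    (hP := by unfold Pair; infer_instance)
  obtain ⟨h, hh⟩ := Dfn.choose_elt (fun (q d : 𝓜.C Ty.N) => ∃ a b p, Pair p a b ∧ Pair q p d)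
    (hP := by unfold Pair; infer_instance)
  refine ⟨fun x => f ⬝ a x, fun x => g ⬝ a x, fun x => h ⬝ a x + 1, inferInstance, inferInstance,
    inferInstance, fun x => ⟨add_one_ne _, ?_⟩⟩
  obtain ⟨u, v, w, huvw⟩ := exists_decode (a x)
  obtain ⟨b₁, d₁, h₁⟩ := hf _ ⟨u, v, w, huvw⟩
  obtain ⟨a₂, d₂, h₂⟩ := hg _ ⟨v, u, w, huvw⟩
  obtain ⟨a₃, b₃, h₃⟩ := hh _ ⟨w, u, v, huvw⟩
  beta_reduce
  rw [huvw.rat_eq, (RatCode.unique h₁ huvw).1, (RatCode.unique h₂ huvw).2.1,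
    (RatCode.unique h₃ huvw).2.2, map_add, map_one]

variable (f g : X → 𝓜.F) [hf : DfnF f] [hg : DfnF g]

instance DfnF.add : DfnF fun x => f x + g x := by
  obtain ⟨a, b, d, ha, hb, hd, h⟩ := hf
  obtain ⟨a', b', d', ha', hb', hd', h'⟩ := hg
  refine ⟨fun x => a x * d' x + a' x * d x, fun x => b x * d' x + b' x * d x,
    fun x => d x * d' x, inferInstance, inferInstance, inferInstance, fun x => ?_⟩
  have h1 := (ι_pos (h x).1).ne'
  have h2 := (ι_pos (h' x).1).ne'
  refine ⟨mul_ne_zero (h x).1 (h' x).1, ?_⟩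
  rw [(h x).2, (h' x).2]
  simp only [map_add, map_mul]
  field_simp
  ring

instance DfnF.mul : DfnF fun x => f x * g x := by
  obtain ⟨a, b, d, ha, hb, hd, h⟩ := hf
  obtain ⟨a', b', d', ha', hb', hd', h'⟩ := hg
  refine ⟨fun x => a x * a' x + b x * b' x, fun x => a x * b' x + b x * a' x,
    fun x => d x * d' x, inferInstance, inferInstance, inferInstance, fun x => ?_⟩
  have h1 := (ι_pos (h x).1).ne'
  have h2 := (ι_pos (h' x).1).ne'
  refine ⟨mul_ne_zero (h x).1 (h' x).1, ?_⟩
  rw [(h x).2, (h' x).2]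
  simp only [map_add, map_mul]
  field_simp
  ring

instance _root_.HigherOrder.DfnP.leF : DfnP 𝓜 fun x => f x ≤ g x := by
  obtain ⟨a, b, d, ha, hb, hd, h⟩ := hf
  obtain ⟨a', b', d', ha', hb', hd', h'⟩ := hg
  refine DfnP.congr (P := fun x => a x * d' x + b' x * d x ≤ a' x * d x + b x * d' x)
    inferInstance fun x => ?_
  rw [(h x).2, (h' x).2, div_le_div_iff₀ (ι_pos (h x).1) (ι_pos (h' x).1), ← ι_le]
  simp only [map_add, map_mul]
  constructor <;> intro h <;> linarith

instance _root_.HigherOrder.DfnP.ltF : DfnP 𝓜 fun x => f x < g x :=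
  DfnP.congr (P := fun x => ¬ g x ≤ f x) inferInstance fun _ => not_le

instance _root_.HigherOrder.DfnP.eqF : DfnP 𝓜 fun x => f x = g x :=
  DfnP.congr (P := fun x => f x ≤ g x ∧ g x ≤ f x) inferInstance fun _ => le_antisymm_iff.symm

end

end Mdl

/-! ### Truth of formulas about numbers and real numbers -/

namespace Mdl

variable {𝓜 : Mdl}

section Predicates

/-- `x` is a real number of the model. -/
def IsReal (x : 𝓜.C Ty.one) : Prop :=
  ∀ n i, rat (x ⬝ n) < rat (x ⬝ (n + i)) + pw n ∧ rat (x ⬝ (n + i)) < rat (x ⬝ n) + pw n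

def EqR (x y : 𝓜.C Ty.one) : Prop :=
  ∀ n, rat (x ⬝ n) ≤ rat (y ⬝ n) + 2 * pw n ∧ rat (y ⬝ n) ≤ rat (x ⬝ n) + 2 * pw n

def LtR (x y : 𝓜.C Ty.one) : Prop := ∃ n, rat (x ⬝ n) + 2 * pw n < rat (y ⬝ n)

def LtAddR (x y z : 𝓜.C Ty.one) : Prop :=
  ∃ n, rat (x ⬝ n) + 4 * pw n < rat (y ⬝ n) + rat (z ⬝ n)

def InBall (x y z : 𝓜.C Ty.one) : Prop := LtAddR x y z ∧ LtAddR y x z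

/-- The constant sequence with value `q`. -/
def cst (q : 𝓜.C Ty.N) : 𝓜.C Ty.one := 𝓜.K _ _ ⬝ q

def InUnit (x : 𝓜.C Ty.one) : Prop := IsReal x ∧ ¬ LtR x (cst 0) ∧ ¬ LtR (cst 1) x

variable {X : Type} [Ctx 𝓜 X] (x y z : X → 𝓜.C Ty.one) [Dfn x] [Dfn y] [Dfn z]

instance : DfnP 𝓜 fun p => IsReal (x p) :=
  DfnP.comp1 (P := IsReal) (by unfold IsReal; infer_instance) x

instance : DfnP 𝓜 fun p => EqR (x p) (y p) :=
  DfnP.comp2 (P := EqR) (by unfold EqR; infer_instance) x y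

instance : DfnP 𝓜 fun p => LtR (x p) (y p) :=
  DfnP.comp2 (P := LtR) (by unfold LtR; infer_instance) x y

instance (a : X → 𝓜.C Ty.N) [Dfn a] : Dfn fun p => cst (a p) := by
  unfold cst
  infer_instance

instance : DfnP 𝓜 fun p => InUnit (x p) := by
  unfold InUnit
  infer_instance

end Predicates

section Sat

variable {V : Ty → Type} (ρ : (τ : Ty) → V τ → 𝓜.C τ)

@[simp] theorem eval_S1 (t : Tm V Ty.N) : t.S1.eval ρ = t.eval ρ + 1 := succ_eq _
@[simp] theorem eval_add (s t : Tm V Ty.N) : (s +ₒ t).eval ρ = s.eval ρ + t.eval ρ := rfl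
@[simp] theorem eval_mul (s t : Tm V Ty.N) : (s *ₒ t).eval ρ = s.eval ρ * t.eval ρ := rfl
@[simp] theorem eval_pow2 (t : Tm V Ty.N) : t.pow2.eval ρ = pow2 (t.eval ρ) := rfl
@[simp] theorem eval_zero : (Tm.zero : Tm V _).eval ρ = (0 : 𝓜.C Ty.N) := rfl
@[simp] theorem eval_n1 : (Tm.n1 : Tm V _).eval ρ = (1 : 𝓜.C Ty.N) := rfl
@[simp] theorem eval_n2 : (Tm.n2 : Tm V _).eval ρ = (2 : 𝓜.C Ty.N) := by
  rw [Tm.n2, eval_S1, eval_n1, one_add_one_eq_two]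
@[simp] theorem eval_n4 : (Tm.n4 : Tm V _).eval ρ = (4 : 𝓜.C Ty.N) := by
  rw [Tm.n4, eval_S1, eval_S1, eval_n2]
  norm_num
@[simp] theorem eval_zeroR : (zeroR : Tm V _).eval ρ = cst (0 : 𝓜.C Ty.N) := rfl
@[simp] theorem eval_oneR : (oneR : Tm V _).eval ρ = cst (1 : 𝓜.C Ty.N) := rfl

@[simp] theorem sat_leN (s t : Tm V Ty.N) : (leN s t).Sat ρ ↔ s.eval ρ ≤ t.eval ρ := by
  simp only [leN, sat_exB, Fm.sat_eq, eval_add, Tm.eval_wk, Tm.eval_new, le_iff]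

@[simp] theorem sat_ltN (s t : Tm V Ty.N) : (ltN s t).Sat ρ ↔ s.eval ρ < t.eval ρ := by
  rw [ltN, sat_leN, eval_S1, add_one_le_iff]

/-- The value of a fraction. -/
noncomputable def evalF (q : Frac V) : 𝓜.F :=
  (𝓜.ι (q.pos.eval ρ) - 𝓜.ι (q.neg.eval ρ)) / 𝓜.ι (q.den.eval ρ)

/-- `q` is a fraction with value `v`. -/
def HasVal (q : Frac V) (v : 𝓜.F) : Prop := q.den.eval ρ ≠ 0 ∧ evalF ρ q = v

variable {ρ}

theorem HasVal.wk {q : Frac V} {v : 𝓜.F} (h : HasVal ρ q v) {σ : Ty} (a : 𝓜.C σ) :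
    HasVal (Struct.cons ρ a) q.wk v := by
  simpa only [HasVal, evalF, Frac.wk, Tm.eval_wk] using h

theorem HasVal.add {q r : Frac V} {v w : 𝓜.F} (h : HasVal ρ q v) (h' : HasVal ρ r w) :
    HasVal ρ (q.add r) (v + w) := by
  obtain ⟨h1, rfl⟩ := h
  obtain ⟨h2, rfl⟩ := h'
  refine ⟨mul_ne_zero h1 h2, ?_⟩
  have h3 := (ι_pos h1).ne'
  have h4 := (ι_pos h2).ne'
  simp only [evalF, Frac.add, eval_add, eval_mul, map_add, map_mul]
  field_simp
  ring

theorem HasVal.scaled (c n : Tm V Ty.N) :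
    HasVal ρ (.scaled c n) (𝓜.ι (c.eval ρ) * pw (n.eval ρ)) := by
  refine ⟨pow2_ne_zero _, ?_⟩
  simp only [evalF, Frac.scaled, eval_zero, map_zero, sub_zero, eval_pow2, pw, div_eq_mul_inv]

theorem HasVal.sat_lt {q r : Frac V} {v w : 𝓜.F} (h : HasVal ρ q v) (h' : HasVal ρ r w) :
    (Frac.lt q r).Sat ρ ↔ v < w := by
  obtain ⟨h1, rfl⟩ := h
  obtain ⟨h2, rfl⟩ := h'
  rw [Frac.lt, sat_ltN, ← ι_lt, evalF, evalF, div_lt_div_iff₀ (ι_pos h1) (ι_pos h2)]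
  simp only [eval_add, eval_mul, map_add, map_mul]
  constructor <;> intro h <;> linarith

theorem HasVal.sat_le {q r : Frac V} {v w : 𝓜.F} (h : HasVal ρ q v) (h' : HasVal ρ r w) :
    (Frac.le q r).Sat ρ ↔ v ≤ w := by
  obtain ⟨h1, rfl⟩ := h
  obtain ⟨h2, rfl⟩ := h'
  rw [Frac.le, sat_leN, ← ι_le, evalF, evalF, div_le_div_iff₀ (ι_pos h1) (ι_pos h2)]
  simp only [eval_add, eval_mul, map_add, map_mul]
  constructor <;> intro h <;> linarith

theorem sat_isRat (q a b d : Tm V Ty.N) :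
    (isRat q a b d).Sat ρ ↔ RatCode (q.eval ρ) (a.eval ρ) (b.eval ρ) (d.eval ρ) := by
  simp only [isRat, isPair, sat_exB, Fm.sat_and, Fm.sat_eq, eval_add, eval_mul, eval_S1,
    Tm.eval_wk, Tm.eval_new, RatCode, Pair]

/-- Every number codes exactly one triple, so the existential reading has a definite value. The
hypothesis ranges over all fractions with that value, so that nested uses need not track which terms
represent it. -/
theorem sat_withRat {q : Tm V Ty.N}
    {φ : Frac (Ext (Ext (Ext V Ty.N) Ty.N) Ty.N) → Fm (Ext (Ext (Ext V Ty.N) Ty.N) Ty.N)}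
    {P : Prop}
    (h : ∀ (a b d : 𝓜.C Ty.N) (r : Frac (Ext (Ext (Ext V Ty.N) Ty.N) Ty.N)),
      HasVal (Struct.cons (Struct.cons (Struct.cons ρ a) b) d) r (rat (q.eval ρ)) →
      ((φ r).Sat (Struct.cons (Struct.cons (Struct.cons ρ a) b) d) ↔ P)) :
    (withRat q φ).Sat ρ ↔ P := by
  simp only [withRat, sat_exB, Fm.sat_and, sat_isRat, Tm.eval_wk, Tm.eval_new]
  have key : ∀ a b d, RatCode (q.eval ρ) a b d →
      HasVal (Struct.cons (Struct.cons (Struct.cons ρ a) b) d)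
        ⟨(Tm.var .new)⇑⇑, (Tm.var .new)⇑, (Tm.var .new).S1⟩ (rat (q.eval ρ)) := by
    intro a b d hc
    refine ⟨?_, ?_⟩
    · simpa only [eval_S1, Tm.eval_new] using add_one_ne d
    · simp only [evalF, eval_S1, Tm.eval_new, Tm.eval_wk, hc.rat_eq, map_add, map_one]
  constructor
  · rintro ⟨a, b, d, hc, hφ⟩
    exact (h a b d _ (key a b d hc)).1 hφ
  · intro hP
    obtain ⟨a, b, d, hc⟩ := exists_decode (q.eval ρ)
    exact ⟨a, b, d, hc, (h a b d _ (key a b d hc)).2 hP⟩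

variable (ρ)

@[simp] theorem sat_isReal (x : Tm V Ty.one) : (isReal x).Sat ρ ↔ IsReal (x.eval ρ) := by
  rw [isReal, sat_allB]
  refine forall_congr' fun n => ?_
  rw [sat_allB]
  refine forall_congr' fun i => ?_
  refine sat_withRat fun a b d q hq => ?_
  refine sat_withRat fun a' b' d' r hr => ?_
  have hq' := ((hq.wk a').wk b').wk d'
  have hn := HasVal.scaled (ρ := Struct.cons (Struct.cons (Struct.cons (Struct.cons (Struct.cons
    (Struct.cons (Struct.cons (Struct.cons ρ n) i) a) b) d) a') b') d') Tm.n1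
    (Tm.var .new)⇑⇑⇑⇑⇑⇑⇑
  rw [Fm.sat_and, hq'.sat_lt (hr.add hn), hr.sat_lt (hq'.add hn)]
  simp only [Tm.eval_app, eval_add, Tm.eval_wk, Tm.eval_new, eval_n1, map_one, one_mul]

@[simp] theorem sat_eqR (x y : Tm V Ty.one) : (eqR x y).Sat ρ ↔ EqR (x.eval ρ) (y.eval ρ) := by
  rw [eqR, sat_allB]
  refine forall_congr' fun n => ?_
  refine sat_withRat fun a b d q hq => ?_
  refine sat_withRat fun a' b' d' r hr => ?_
  have hq' := ((hq.wk a').wk b').wk d'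
  have hn := HasVal.scaled (ρ := Struct.cons (Struct.cons (Struct.cons (Struct.cons (Struct.cons
    (Struct.cons (Struct.cons ρ n) a) b) d) a') b') d') Tm.n2 (Tm.var .new)⇑⇑⇑⇑⇑⇑
  rw [Fm.sat_and, hq'.sat_le (hr.add hn), hr.sat_le (hq'.add hn)]
  simp only [Tm.eval_app, Tm.eval_wk, Tm.eval_new, eval_n2, map_ofNat]

@[simp] theorem sat_ltR (x y : Tm V Ty.one) : (ltR x y).Sat ρ ↔ LtR (x.eval ρ) (y.eval ρ) := by
  rw [ltR, sat_exB]
  refine exists_congr fun n => ?_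
  refine sat_withRat fun a b d q hq => ?_
  refine sat_withRat fun a' b' d' r hr => ?_
  have hq' := ((hq.wk a').wk b').wk d'
  have hn := HasVal.scaled (ρ := Struct.cons (Struct.cons (Struct.cons (Struct.cons (Struct.cons
    (Struct.cons (Struct.cons ρ n) a) b) d) a') b') d') Tm.n2 (Tm.var .new)⇑⇑⇑⇑⇑⇑
  rw [(hq'.add hn).sat_lt hr]
  simp only [Tm.eval_app, Tm.eval_wk, Tm.eval_new, eval_n2, map_ofNat]

@[simp] theorem sat_ltAddR (x y z : Tm V Ty.one) :
    (ltAddR x y z).Sat ρ ↔ LtAddR (x.eval ρ) (y.eval ρ) (z.eval ρ) := by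
  rw [ltAddR, sat_exB]
  refine exists_congr fun n => ?_
  refine sat_withRat fun a b d q hq => ?_
  refine sat_withRat fun a' b' d' r hr => ?_
  refine sat_withRat fun a'' b'' d'' s hs => ?_
  have hq' := (((((hq.wk a').wk b').wk d').wk a'').wk b'').wk d''
  have hr' := ((hr.wk a'').wk b'').wk d''
  have hn := HasVal.scaled (ρ := Struct.cons (Struct.cons (Struct.cons (Struct.cons (Struct.cons
    (Struct.cons (Struct.cons (Struct.cons (Struct.cons (Struct.cons ρ n) a) b) d) a') b') d') a'')
    b'') d'') Tm.n4 (Tm.var .new)⇑⇑⇑⇑⇑⇑⇑⇑⇑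
  rw [(hq'.add hn).sat_lt (hr'.add hs)]
  simp only [Tm.eval_app, Tm.eval_wk, Tm.eval_new, eval_n4, map_ofNat]

@[simp] theorem sat_inBall (x y z : Tm V Ty.one) :
    (inBall x y z).Sat ρ ↔ InBall (x.eval ρ) (y.eval ρ) (z.eval ρ) := by
  simp only [inBall, Fm.sat_and, sat_ltAddR, InBall]

@[simp] theorem sat_inUnit (x : Tm V Ty.one) : (inUnit x).Sat ρ ↔ InUnit (x.eval ρ) := by
  simp only [inUnit, Fm.sat_and, Fm.sat_neg, sat_isReal, sat_ltR, InUnit, eval_zeroR, eval_oneR]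

@[simp] theorem sat_isMem {σ : Ty} (x : Tm V σ) (A : Tm V (σ ⟶ₜ Ty.N)) :
    (isMem x A).Sat ρ ↔ A.eval ρ ⬝ x.eval ρ = (1 : 𝓜.C Ty.N) := by
  simp only [isMem, Fm.sat_eq, Tm.eval_app, eval_n1]

@[simp] theorem sat_isBinary (f : Tm V Ty.one) :
    (isBinary f).Sat ρ ↔ ∀ n, f.eval ρ ⬝ n ≤ (1 : 𝓜.C Ty.N) := by
  simp only [isBinary, sat_allB, sat_leN, Tm.eval_app, Tm.eval_wk, Tm.eval_new, eval_n1]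

end Sat

/-! ### Truth of the principles -/

section Principles

variable {V : Ty → Type} (ρ : (τ : Ty) → V τ → 𝓜.C τ)

/-- `Y` is an injection from `[0,1]` to the numbers. -/
def IsInj (Y : 𝓜.C Ty.two) : Prop :=
  ∀ x y, InUnit x → InUnit y → (EqR x y ↔ Y ⬝ x = Y ⬝ y)

theorem sat_NIN : (NIN V).Sat ρ ↔ ¬ ∃ Y : 𝓜.C Ty.two, IsInj Y := by
  simp only [NIN, Fm.sat_neg, sat_exB, sat_allB, Fm.sat_imp, Fm.sat_iff, Fm.sat_eq, sat_inUnit,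
    sat_eqR, Tm.eval_app, Tm.eval_wk, Tm.eval_new, IsInj]

def IsGauge (Ψ : 𝓜.C (Ty.one ⟶ₜ Ty.one)) : Prop :=
  (∀ x, InUnit x → IsReal (Ψ ⬝ x) ∧ LtR (cst 0) (Ψ ⬝ x)) ∧
    ∀ x y, InUnit x → InUnit y → EqR x y → EqR (Ψ ⬝ x) (Ψ ⬝ y)

theorem sat_isGauge (Ψ : Tm V (Ty.one ⟶ₜ Ty.one)) :
    (isGauge Ψ).Sat ρ ↔ IsGauge (Ψ.eval ρ) := by
  simp only [isGauge, Fm.sat_and, sat_allB, Fm.sat_imp, sat_inUnit, sat_isReal, sat_ltR, eval_zeroR,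
    sat_eqR, Tm.eval_app, Tm.eval_wk, Tm.eval_new, IsGauge]

def HasFiniteCover (Ψ : 𝓜.C (Ty.one ⟶ₜ Ty.one)) : Prop :=
  ∃ (k : 𝓜.C Ty.N) (y : 𝓜.C (Ty.N ⟶ₜ Ty.one)), (∀ i, i ≤ k → InUnit (y ⬝ i)) ∧
    ∀ x, InUnit x → ∃ i, i ≤ k ∧ InBall x (y ⬝ i) (Ψ ⬝ (y ⬝ i))

theorem sat_hasFiniteCover (Ψ : Tm V (Ty.one ⟶ₜ Ty.one)) :
    (hasFiniteCover Ψ).Sat ρ ↔ HasFiniteCover (Ψ.eval ρ) := by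
  simp only [hasFiniteCover, Fm.sat_and, sat_allB, sat_exB, Fm.sat_imp, sat_inUnit, sat_leN,
    sat_inBall, Tm.eval_app, Tm.eval_wk, Tm.eval_new, HasFiniteCover]

def IsUSC (f : 𝓜.C (Ty.one ⟶ₜ Ty.one)) : Prop :=
  ∀ x₀, InUnit x₀ → ∀ ε, IsReal ε → LtR (cst 0) ε → ∃ δ, IsReal δ ∧ LtR (cst 0) δ ∧
    ∀ x, InUnit x → InBall x x₀ δ → LtAddR (f ⬝ x) (f ⬝ x₀) ε

theorem sat_isUSC (f : Tm V (Ty.one ⟶ₜ Ty.one)) : (isUSC f).Sat ρ ↔ IsUSC (f.eval ρ) := by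
  simp only [isUSC, Fm.sat_and, sat_allB, sat_exB, Fm.sat_imp, sat_inUnit, sat_isReal, sat_ltR,
    eval_zeroR, sat_inBall, sat_ltAddR, Tm.eval_app, Tm.eval_wk, Tm.eval_new, IsUSC]

def IsSet (A : 𝓜.C Ty.two) : Prop :=
  (∀ x, IsReal x → A ⬝ x ≤ 1) ∧ ∀ x y, IsReal x → IsReal y → EqR x y → A ⬝ x = A ⬝ y

@[simp] theorem sat_isSet (A : Tm V Ty.two) : (isSet A).Sat ρ ↔ IsSet (A.eval ρ) := by
  simp only [isSet, Fm.sat_and, sat_allB, Fm.sat_imp, sat_isReal, sat_leN, eval_n1, sat_eqR,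
    Fm.sat_eq, Tm.eval_app, Tm.eval_wk, Tm.eval_new, IsSet]

structure IsSigmaAlgebra (𝒮 : 𝓜.C (Ty.two ⟶ₜ Ty.N)) : Prop where
  interval : ∀ a b A, IsReal a → IsReal b → IsSet A →
    (∀ x, IsReal x → (A ⬝ x = 1 ↔ LtR a x ∧ LtR x b)) → 𝒮 ⬝ A = 1
  compl : ∀ A B, IsSet A → IsSet B → 𝒮 ⬝ A = 1 →
    (∀ x, IsReal x → (B ⬝ x = 1 ↔ ¬ A ⬝ x = 1)) → 𝒮 ⬝ B = 1
  union : ∀ (A : 𝓜.C (Ty.N ⟶ₜ Ty.two)) (B : 𝓜.C Ty.two),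
    (∀ n, IsSet (A ⬝ n) ∧ 𝒮 ⬝ (A ⬝ n) = 1) → IsSet B →
    (∀ x, IsReal x → (B ⬝ x = 1 ↔ ∃ n, A ⬝ n ⬝ x = 1)) → 𝒮 ⬝ B = 1

/-- One direction suffices: `IsSigmaAlgebra` drops the bound on the values of `𝒮`, and belonging to
all of these possibly more numerous algebras still implies being Borel. -/
theorem isSigmaAlgebra_of_sat (𝒮 : Tm V (Ty.two ⟶ₜ Ty.N)) (h : (isSigmaAlgebra 𝒮).Sat ρ) :
    IsSigmaAlgebra (𝒮.eval ρ) := by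
  simp only [isSigmaAlgebra, Fm.sat_and, sat_allB, sat_exB, Fm.sat_imp, Fm.sat_iff, Fm.sat_neg,
    sat_isReal, sat_isSet, sat_isMem, sat_ltR, sat_leN, Tm.eval_app, Tm.eval_wk,
    Tm.eval_new] at h
  exact ⟨h.2.1, h.2.2.1, h.2.2.2⟩

theorem sat_isBorelFun (f : Tm V (Ty.one ⟶ₜ Ty.one))
    (h : ∀ a : 𝓜.C Ty.one, IsReal a → ∃ B : 𝓜.C Ty.two,
      (IsSet B ∧ ∀ 𝒮 : 𝓜.C (Ty.two ⟶ₜ Ty.N), IsSigmaAlgebra 𝒮 → 𝒮 ⬝ B = 1) ∧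
      ∀ x, IsReal x → (B ⬝ x = 1 ↔ InUnit x ∧ LtR a (f.eval ρ ⬝ x))) :
    (isBorelFun f).Sat ρ := by
  simp only [isBorelFun, isBorelSet, Fm.sat_and, sat_allB, sat_exB, Fm.sat_imp, Fm.sat_iff,
    sat_isReal, sat_isSet, sat_isMem, sat_ltR, sat_inUnit, Tm.eval_app, Tm.eval_wk, Tm.eval_new]
  intro a ha
  obtain ⟨B, ⟨hB, hS⟩, hx⟩ := h a ha
  refine ⟨B, ⟨hB, fun 𝒮 h𝒮 => hS 𝒮 ?_⟩, hx⟩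
  exact isSigmaAlgebra_of_sat _ _ h𝒮

/-- The semantic content of `IND₀`. -/
theorem of_sat_IND (h : (IND V).Sat ρ) (Y : 𝓜.C (Ty.one ⟶ₜ Ty.N ⟶ₜ Ty.N))
    (hY : ∀ n f g, (∀ i, f ⬝ i ≤ 1) → (∀ i, g ⬝ i ≤ 1) → Y ⬝ f ⬝ n = 0 → Y ⬝ g ⬝ n = 0 → f = g)
    (k : 𝓜.C Ty.N) :
    ∃ (l : 𝓜.C Ty.N) (w : 𝓜.C (Ty.N ⟶ₜ Ty.one)), ∀ m, m ≤ k →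
      ((∃ i, i < l ∧ (∀ j, w ⬝ i ⬝ j ≤ 1) ∧ Y ⬝ (w ⬝ i) ⬝ m = 0) ↔
        ∃ f, (∀ j, f ⬝ j ≤ 1) ∧ Y ⬝ f ⬝ m = 0) := by
  simp only [IND, Fm.sat_and, sat_allB, sat_exB, Fm.sat_imp, Fm.sat_iff, Fm.sat_eq, sat_eqAt,
    sat_isBinary, sat_leN, sat_ltN, eval_zero, Tm.eval_app, Tm.eval_wk, Tm.eval_new] at h
  exact h Y hY k

end Principles

end Mdl

/-! ### Real numbers and cuts -/

namespace Mdl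

variable {𝓜 : Mdl}

/-- The real number `x` is above the rational number `q`. -/
def Gt (x : 𝓜.C Ty.one) (q : 𝓜.F) : Prop := ∃ n, q + pw n < rat (x ⬝ n)

/-- The real number `x` is below the rational number `q`. -/
def Lt (x : 𝓜.C Ty.one) (q : 𝓜.F) : Prop := ∃ n, rat (x ⬝ n) + pw n < q

theorem isReal_cst (q : 𝓜.C Ty.N) : IsReal (cst q) := fun n i => by
  simp only [cst, 𝓜.app_K]
  constructor <;> linarith [pw_pos n]

theorem rat_cst (q n : 𝓜.C Ty.N) : rat (cst q ⬝ n) = rat q := by rw [cst, 𝓜.app_K]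

theorem EqR.refl (x : 𝓜.C Ty.one) : EqR x x := fun n => by
  constructor <;> linarith [pw_pos n]

theorem EqR.symm {x y : 𝓜.C Ty.one} (h : EqR x y) : EqR y x := fun n => (h n).symm

theorem exists_pw_lt_of_le {e : 𝓜.F} (he : 0 < e) (n : 𝓜.C Ty.N) : ∃ m, n ≤ m ∧ pw m < e := by
  obtain ⟨m, hm⟩ := exists_pw_lt he
  exact ⟨max n m, le_max_left _ _, (pw_le (le_max_right _ _)).trans_lt hm⟩

theorem IsReal.abs_lt {x : 𝓜.C Ty.one} (hx : IsReal x) {n m : 𝓜.C Ty.N} (h : n ≤ m) :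
    rat (x ⬝ n) < rat (x ⬝ m) + pw n ∧ rat (x ⬝ m) < rat (x ⬝ n) + pw n := by
  obtain ⟨i, rfl⟩ := h
  exact hx n i

/-- The Cauchy condition spreads a strict inequality at one stage to all later ones with a fixed
margin, which makes approximations of several reals comparable at a common stage. -/
theorem Gt.exists_forall {x : 𝓜.C Ty.one} (hx : IsReal x) {q : 𝓜.F} (h : Gt x q) :
    ∃ e > 0, ∃ n, ∀ m, n ≤ m → q + e < rat (x ⬝ m) := by
  obtain ⟨n, hn⟩ := h
  refine ⟨rat (x ⬝ n) - pw n - q, by linarith, n, fun m hm => ?_⟩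
  linarith [(hx.abs_lt hm).1]

theorem Lt.exists_forall {x : 𝓜.C Ty.one} (hx : IsReal x) {q : 𝓜.F} (h : Lt x q) :
    ∃ e > 0, ∃ n, ∀ m, n ≤ m → rat (x ⬝ m) + e < q := by
  obtain ⟨n, hn⟩ := h
  refine ⟨q - rat (x ⬝ n) - pw n, by linarith, n, fun m hm => ?_⟩
  linarith [(hx.abs_lt hm).2]

theorem Gt.lt_of_lt {x : 𝓜.C Ty.one} (hx : IsReal x) {p q : 𝓜.F} (h : Gt x p) (h' : Lt x q) :
    p < q := by
  obtain ⟨e, he, n, hn⟩ := h.exists_forall hx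
  obtain ⟨e', he', n', hn'⟩ := h'.exists_forall hx
  linarith [hn _ (le_max_left n n'), hn' _ (le_max_right n n')]

theorem Gt.mono {x : 𝓜.C Ty.one} {p q : 𝓜.F} (h : Gt x q) (hpq : p ≤ q) : Gt x p := by
  obtain ⟨n, hn⟩ := h
  exact ⟨n, by linarith⟩

theorem Lt.mono {x : 𝓜.C Ty.one} {p q : 𝓜.F} (h : Lt x p) (hpq : p ≤ q) : Lt x q := by
  obtain ⟨n, hn⟩ := h
  exact ⟨n, by linarith⟩

theorem Gt.exists_gt {x : 𝓜.C Ty.one} {q : 𝓜.F} (h : Gt x q) : ∃ p, q < p ∧ Gt x p := by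
  obtain ⟨n, hn⟩ := h
  exact ⟨(q + (rat (x ⬝ n) - pw n)) / 2, by linarith, n, by linarith⟩

theorem Lt.exists_lt {x : 𝓜.C Ty.one} {q : 𝓜.F} (h : Lt x q) : ∃ p, p < q ∧ Lt x p := by
  obtain ⟨n, hn⟩ := h
  exact ⟨(q + (rat (x ⬝ n) + pw n)) / 2, by linarith, n, by linarith⟩

theorem EqR.gt {x y : 𝓜.C Ty.one} (hx : IsReal x) (h : EqR x y) {q : 𝓜.F} (hq : Gt x q) :
    Gt y q := by
  obtain ⟨e, he, n, hn⟩ := hq.exists_forall hx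
  -- The margin must exceed 3 · 2^(-m): two parts are lost to `EqR` and one is required by `Gt`.
  obtain ⟨m, hm, hme⟩ := exists_pw_lt_of_le (show 0 < e / 4 by linarith) n
  exact ⟨m, by linarith [hn m hm, (h m).1]⟩

theorem EqR.lt {x y : 𝓜.C Ty.one} (hx : IsReal x) (h : EqR x y) {q : 𝓜.F} (hq : Lt x q) :
    Lt y q := by
  obtain ⟨e, he, n, hn⟩ := hq.exists_forall hx
  obtain ⟨m, hm, hme⟩ := exists_pw_lt_of_le (show 0 < e / 4 by linarith) n
  exact ⟨m, by linarith [hn m hm, (h m).2]⟩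

theorem ltR_iff {x y : 𝓜.C Ty.one} (hx : IsReal x) (hy : IsReal y) :
    LtR x y ↔ ∃ q, Lt x q ∧ Gt y q := by
  constructor
  · rintro ⟨n, hn⟩
    exact ⟨(rat (x ⬝ n) + rat (y ⬝ n)) / 2, ⟨n, by linarith⟩, n, by linarith⟩
  · rintro ⟨q, h, h'⟩
    obtain ⟨e, he, n, hn⟩ := h.exists_forall hx
    obtain ⟨e', he', n', hn'⟩ := h'.exists_forall hy
    obtain ⟨m, hm, hme⟩ := exists_pw_lt_of_le (show 0 < e / 2 by linarith) (max n n')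
    exact ⟨m, by linarith [hn m ((le_max_left _ _).trans hm), hn' m ((le_max_right _ _).trans hm)]⟩

theorem ltR_or_of_not_eqR {x y : 𝓜.C Ty.one} (h : ¬ EqR x y) : LtR x y ∨ LtR y x := by
  simp only [EqR, not_forall, not_and_or, not_le] at h
  obtain ⟨n, h | h⟩ := h
  · exact .inr ⟨n, h⟩
  · exact .inl ⟨n, h⟩

theorem eqR_of_gt {x y : 𝓜.C Ty.one} (hx : IsReal x) (hy : IsReal y)
    (h : ∀ q, Gt x q ↔ Gt y q) : EqR x y := by
  by_contra hne
  obtain h' | h' := ltR_or_of_not_eqR hne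
  · obtain ⟨q, h1, h2⟩ := (ltR_iff hx hy).1 h'
    exact lt_irrefl q (((h q).2 h2).lt_of_lt hx h1)
  · obtain ⟨q, h1, h2⟩ := (ltR_iff hy hx).1 h'
    exact lt_irrefl q (((h q).1 h2).lt_of_lt hy h1)

theorem lt_cst {q : 𝓜.C Ty.N} {p : 𝓜.F} : Lt (cst q) p ↔ rat q < p := by
  simp only [Lt, rat_cst]
  constructor
  · rintro ⟨n, hn⟩
    linarith [pw_pos n]
  · intro h
    obtain ⟨n, hn⟩ := exists_pw_lt (show 0 < p - rat q by linarith)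
    exact ⟨n, by linarith⟩

theorem gt_cst {q : 𝓜.C Ty.N} {p : 𝓜.F} : Gt (cst q) p ↔ p < rat q := by
  simp only [Gt, rat_cst]
  constructor
  · rintro ⟨n, hn⟩
    linarith [pw_pos n]
  · intro h
    obtain ⟨n, hn⟩ := exists_pw_lt (show 0 < rat q - p by linarith)
    exact ⟨n, by linarith⟩

theorem cst_ltR {q : 𝓜.C Ty.N} {x : 𝓜.C Ty.one} (hx : IsReal x) :
    LtR (cst q) x ↔ Gt x (rat q) := by
  rw [ltR_iff (isReal_cst q) hx]
  simp only [lt_cst]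
  constructor
  · rintro ⟨p, hp, h⟩
    exact h.mono hp.le
  · intro h
    obtain ⟨p, hp, h⟩ := h.exists_gt
    exact ⟨p, hp, h⟩

theorem ltR_cst {q : 𝓜.C Ty.N} {x : 𝓜.C Ty.one} (hx : IsReal x) :
    LtR x (cst q) ↔ Lt x (rat q) := by
  rw [ltR_iff hx (isReal_cst q)]
  simp only [gt_cst]
  constructor
  · rintro ⟨p, h, hp⟩
    exact h.mono hp.le
  · intro h
    obtain ⟨p, hp, h⟩ := h.exists_lt
    exact ⟨p, h, hp⟩

theorem inUnit_iff {x : 𝓜.C Ty.one} : InUnit x ↔ IsReal x ∧ ¬ Lt x 0 ∧ ¬ Gt x 1 := by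
  refine and_congr_right fun hx => ?_
  rw [ltR_cst hx, cst_ltR hx, rat_zero, rat_one]

theorem inUnit_cst {q : 𝓜.C Ty.N} (h0 : 0 ≤ rat q) (h1 : rat q ≤ 1) : InUnit (cst q) := by
  rw [inUnit_iff, lt_cst, gt_cst]
  exact ⟨isReal_cst q, h0.not_gt, h1.not_gt⟩

theorem InUnit.congr {x y : 𝓜.C Ty.one} (hx : InUnit x) (hy : IsReal y) (h : EqR x y) :
    InUnit y := by
  rw [inUnit_iff] at hx ⊢
  exact ⟨hy, fun h' => hx.2.1 (h.symm.lt hy h'), fun h' => hx.2.2 (h.symm.gt hy h')⟩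

theorem InBall.gt_lt {x y : 𝓜.C Ty.one} {r : 𝓜.C Ty.N} (h : InBall x y (cst r)) :
    (∃ q, Lt x q ∧ Gt y (q - rat r)) ∧ ∃ q, Lt y q ∧ Gt x (q - rat r) := by
  obtain ⟨⟨n, hn⟩, ⟨m, hm⟩⟩ := h
  rw [rat_cst] at hn hm
  have := pw_pos n
  have := pw_pos m
  exact ⟨⟨rat (x ⬝ n) + 2 * pw n, ⟨n, by linarith⟩, n, by linarith⟩,
    ⟨rat (y ⬝ m) + 2 * pw m, ⟨m, by linarith⟩, m, by linarith⟩⟩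

/-! ### Gauges given by injections -/

/-- `Ψ x = 4 ^ (-(Y x + 1))`, as a constant sequence. -/
def IsInjGauge (Y : 𝓜.C Ty.two) (Ψ : 𝓜.C (Ty.one ⟶ₜ Ty.one)) : Prop :=
  ∀ x, ∃ r, Ψ ⬝ x = cst r ∧ rat r = pw (2 * (Y ⬝ x + 1))

/-- One internal function chooses a code for each 2^(-n), so equal values of `Y` give identical
sequences, not just equal reals. -/
theorem exists_injGauge (Y : 𝓜.C Ty.two) :
    ∃ Ψ : 𝓜.C (Ty.one ⟶ₜ Ty.one), IsInjGauge Y Ψ ∧ ∀ x y, Y ⬝ x = Y ⬝ y → Ψ ⬝ x = Ψ ⬝ y := by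
  obtain ⟨e, he⟩ := Dfn.choose_elt (fun (n q : 𝓜.C Ty.N) => rat q = pw n)
  obtain ⟨Ψ, hΨ⟩ := Dfn.exists_elt
    (fun x : 𝓜.C Ty.one => (cst (e ⬝ (2 * (Y ⬝ x + 1))) : 𝓜.C Ty.one))
  refine ⟨Ψ, fun x => ⟨_, hΨ x, he _ (exists_rat_eq _)⟩, fun x y h => ?_⟩
  rw [hΨ, hΨ, h]

theorem IsInjGauge.isGauge {Y : 𝓜.C Ty.two} {Ψ : 𝓜.C (Ty.one ⟶ₜ Ty.one)} (h : IsInjGauge Y Ψ)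
    (hY : IsInj Y) (hΨ : ∀ x y, Y ⬝ x = Y ⬝ y → Ψ ⬝ x = Ψ ⬝ y) : IsGauge Ψ := by
  refine ⟨fun x _ => ?_, fun x y hx hy hxy => ?_⟩
  · obtain ⟨r, hr, hr'⟩ := h x
    rw [hr, cst_ltR (isReal_cst r), gt_cst, rat_zero, hr']
    exact ⟨isReal_cst r, pw_pos _⟩
  · rw [hΨ x y ((hY x y hx hy).1 hxy)]
    exact EqR.refl _

theorem pw_two_mul_add_one (n : 𝓜.C Ty.N) : 4 * pw (2 * (n + 1)) = pw (2 * n) := by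
  have h : 2 * (n + 1) = 2 * n + 1 + 1 := by ring
  rw [h]
  linarith [pw_add_one (2 * n), pw_add_one (2 * n + 1)]

/-- Stage m of a nested interval construction avoids the only possible ball of radius 4^(-(m+1)).
Numerators `A m` encode the intervals [A m, A m + 1] · 4^(-m), which keeps the recursion at type 0.
-/
theorem not_hasFiniteCover {Y : 𝓜.C Ty.two} (hY : IsInj Y) {Ψ : 𝓜.C (Ty.one ⟶ₜ Ty.one)}
    (hΨ : IsInjGauge Y Ψ) : ¬ HasFiniteCover Ψ := by
  classical
  rintro ⟨k, y, hy, hcov⟩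
  -- Some centre with Y-value m lies left of the midpoint of [a, a+1] · 4^(-m). Then the last
  -- quarter is taken, otherwise the first.
  let Right : 𝓜.C Ty.N → 𝓜.C Ty.N → Prop := fun m a => ∃ i, i ≤ k ∧ Y ⬝ (y ⬝ i) = m ∧
    ∃ n, rat (y ⬝ i ⬝ n) + pw n < (4 * 𝓜.ι a + 2) * pw (2 * (m + 1))
  have hR : DfnP 𝓜 fun p : (Unit × 𝓜.C Ty.N) × 𝓜.C Ty.N => Right p.1.2 p.2 := by
    dsimp only [Right]
    infer_instance
  obtain ⟨A, hA0, hA⟩ := Dfn.exists_rec 0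
    (fun m a : 𝓜.C Ty.N => if Right m a then 4 * a + 3 else 4 * a)
  simp only [succ_eq] at hA
  change A ⬝ 0 = 0 at hA0
  let L : 𝓜.C Ty.N → 𝓜.F := fun m => 𝓜.ι (A ⬝ m) * pw (2 * m)
  have hstep : ∀ m, L m ≤ L (m + 1) ∧ L (m + 1) + pw (2 * (m + 1)) ≤ L m + pw (2 * m) := by
    intro m
    dsimp only [L]
    rw [hA, ← pw_two_mul_add_one m]
    have := pw_pos (2 * (m + 1))
    split_ifs <;> simp only [map_add, map_mul, map_ofNat] <;> constructor <;> nlinarith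
  have hnest : ∀ m i, L m ≤ L (m + i) ∧ L (m + i) + pw (2 * (m + i)) ≤ L m + pw (2 * m) := by
    intro m i
    induction i using Mdl.num_induction with
    | dfn => dsimp only [L]; infer_instance
    | zero => rw [add_zero]; exact ⟨le_rfl, le_rfl⟩
    | succ i ih =>
      rw [← add_assoc]
      have := hstep (m + i)
      exact ⟨ih.1.trans this.1, this.2.trans ih.2⟩
  obtain ⟨f, hf⟩ := Dfn.exists_elt (fun i : 𝓜.C Ty.N => Y ⬝ (y ⬝ i))
  obtain ⟨B, hB⟩ := exists_bound f k
  -- All Y-values of centres are at most `B`, so after `B + 1` stages every ball has been avoided.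
  obtain ⟨q, hq⟩ := exists_rat_eq (L (B + 1))
  have hL0 : L 0 = 0 := by
    dsimp only [L]
    rw [hA0, map_zero, zero_mul]
  have hunit : InUnit (cst q) := by
    have h := hnest 0 (B + 1)
    rw [zero_add, hL0, mul_zero, pw_zero] at h
    have := pw_pos (2 * (B + 1))
    exact inUnit_cst (by rw [hq]; exact h.1) (by rw [hq]; linarith [h.2])
  obtain ⟨i, hi, hball⟩ := hcov _ hunit
  obtain ⟨r, hr, hr'⟩ := hΨ (y ⬝ i)
  obtain ⟨m, hm⟩ : ∃ m, m = Y ⬝ (y ⬝ i) := ⟨_, rfl⟩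
  rw [hr] at hball
  rw [← hm] at hr'
  have hyr := (hy i hi).1
  obtain ⟨⟨p, hp1, hp2⟩, ⟨p', hp1', hp2'⟩⟩ := hball.gt_lt
  rw [lt_cst, hq] at hp1
  rw [gt_cst, hq, hr'] at hp2'
  rw [hr'] at hp2
  obtain ⟨j, hj⟩ : ∃ j, m + 1 + j = B + 1 := by
    have := hB i hi
    rw [hf, ← hm] at this
    obtain ⟨j, rfl⟩ := this
    exact ⟨j, by ring⟩
  have hn := hnest (m + 1) j
  rw [hj] at hn
  have hpos := pw_pos (2 * (m + 1))
  have hpos' := pw_pos (2 * (B + 1))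
  have hLm : L (m + 1) = 𝓜.ι (if Right m (A ⬝ m) then 4 * A ⬝ m + 3 else 4 * A ⬝ m) *
      pw (2 * (m + 1)) := by
    dsimp only [L]
    rw [hA]
  split_ifs at hLm with hcase
  -- The centre that decided the stage may have another index, but injectivity makes it the same
  -- real. It lies left of the midpoint, whereas the ball forces it to the right.
  · obtain ⟨i', hi', hm', hlt⟩ := hcase
    have heq : EqR (y ⬝ i') (y ⬝ i) := (hY _ _ (hy i' hi') (hy i hi)).2 (hm'.trans hm)
    have hlt' : Lt (y ⬝ i) _ := heq.lt (hy i' hi').1 hlt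
    have := hp2.lt_of_lt hyr hlt'
    simp only [map_add, map_mul, map_ofNat] at hLm
    linarith
  -- The centre is not left of the midpoint, yet a ball meeting the first quarter strictly inside
  -- its right end would put it there.
  · have hnlt : ¬ Lt (y ⬝ i) ((4 * 𝓜.ι (A ⬝ m) + 2) * pw (2 * (m + 1))) :=
      fun h => hcase ⟨i, hi, hm.symm, h⟩
    refine hnlt (hp1'.mono ?_)
    simp only [map_mul, map_ofNat] at hLm
    linarith

end Mdl

/-! ### Borel gauges -/

namespace Mdl

variable {𝓜 : Mdl}

/-- `A` is the set of reals with the property `P`. -/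
def IsSetOf (A : 𝓜.C Ty.two) (P : 𝓜.C Ty.one → Prop) : Prop :=
  IsSet A ∧ ∀ x, IsReal x → (A ⬝ x = 1 ↔ P x)

theorem isSetOf_of_char {A : 𝓜.C Ty.two} {P : 𝓜.C Ty.one → Prop}
    (hA : ∀ x, (P x ∧ A ⬝ x = 1) ∨ (¬ P x ∧ A ⬝ x = 0))
    (hP : ∀ x y, IsReal x → IsReal y → EqR x y → P x → P y) : IsSetOf A P := by
  refine ⟨⟨fun x _ => ?_, fun x y hx hy h => ?_⟩, fun x _ => ?_⟩
  · obtain ⟨-, h⟩ | ⟨-, h⟩ := hA x <;> rw [h]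
    exact zero_le_one
  · have hPxy : P x ↔ P y := ⟨hP x y hx hy h, hP y x hy hx h.symm⟩
    obtain ⟨h1, h⟩ | ⟨h1, h⟩ := hA x <;> obtain ⟨h2, h'⟩ | ⟨h2, h'⟩ := hA y <;> rw [h, h'] <;>
      exact absurd hPxy (by tauto)
  · obtain ⟨h1, h⟩ | ⟨h1, h⟩ := hA x <;> rw [h]
    · exact ⟨fun _ => h1, fun _ => rfl⟩
    · exact ⟨fun h => absurd h zero_ne_one, fun h => absurd h h1⟩

theorem exists_isSetOf (P : 𝓜.C Ty.one → Prop) [DfnP 𝓜 fun p : Unit × 𝓜.C Ty.one => P p.2]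
    (hP : ∀ x y, IsReal x → IsReal y → EqR x y → P x → P y) : ∃ A, IsSetOf A P := by
  obtain ⟨A, hA⟩ := DfnP.exists_char_elt P
  exact ⟨A, isSetOf_of_char hA hP⟩

theorem exists_isSetOf_seq (P : 𝓜.C Ty.N → 𝓜.C Ty.one → Prop)
    [hd : DfnP 𝓜 fun p : (Unit × 𝓜.C Ty.N) × 𝓜.C Ty.one => P p.1.2 p.2]
    (hP : ∀ n x y, IsReal x → IsReal y → EqR x y → P n x → P n y) :
    ∃ A : 𝓜.C (Ty.N ⟶ₜ Ty.two), ∀ n, IsSetOf (A ⬝ n) (P n) := by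
  classical
  obtain ⟨g, hg, h⟩ := Dfn.lam fun (p : Unit × 𝓜.C Ty.N) (x : 𝓜.C Ty.one) =>
    if P p.2 x then (1 : 𝓜.C Ty.N) else 0
  obtain ⟨A, hA⟩ := Dfn.exists_elt (fun n => g ((), n)) (hf := hg)
  refine ⟨A, fun n => isSetOf_of_char (fun x => ?_) (hP n)⟩
  rw [hA, h]
  by_cases hx : P n x <;> simp [hx]

/-! ### Points and their complements in σ-algebras -/

namespace IsSigmaAlgebra

variable {𝒮 : 𝓜.C (Ty.two ⟶ₜ Ty.N)}

theorem mem_Ioo (h𝒮 : IsSigmaAlgebra 𝒮) {A : 𝓜.C Ty.two} {p q : 𝓜.F}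
    (hA : IsSetOf A fun x => Gt x p ∧ Lt x q) : 𝒮 ⬝ A = 1 := by
  obtain ⟨a, rfl⟩ := exists_rat_eq p
  obtain ⟨b, rfl⟩ := exists_rat_eq q
  refine h𝒮.interval (cst a) (cst b) A (isReal_cst a) (isReal_cst b) hA.1 fun x hx => ?_
  rw [hA.2 x hx, cst_ltR hx, ltR_cst hx]

theorem mem_empty (h𝒮 : IsSigmaAlgebra 𝒮) {A : 𝓜.C Ty.two} (hA : IsSetOf A fun _ => False) :
    𝒮 ⬝ A = 1 := by
  refine h𝒮.mem_Ioo (p := 0) (q := 0) ⟨hA.1, fun x hx => (hA.2 x hx).trans ?_⟩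
  exact ⟨False.elim, fun h => lt_irrefl _ (h.1.lt_of_lt hx h.2)⟩

/-- The complement of a point is the union of the rational intervals that miss the point. They are
indexed by pair codes, with the empty set in place of an interval that contains it. -/
theorem mem_ne (h𝒮 : IsSigmaAlgebra 𝒮) {x₀ : 𝓜.C Ty.one} (hx₀ : IsReal x₀) {A : 𝓜.C Ty.two}
    (hA : IsSetOf A fun x => ¬ EqR x x₀) : 𝒮 ⬝ A = 1 := by
  let P : 𝓜.C Ty.N → 𝓜.C Ty.one → Prop := fun c x => ∃ p q, Pair c p q ∧
    ¬ ((∃ n, rat p + pw n < rat (x₀ ⬝ n)) ∧ ∃ n, rat (x₀ ⬝ n) + pw n < rat q) ∧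
    (∃ n, rat p + pw n < rat (x ⬝ n)) ∧ ∃ n, rat (x ⬝ n) + pw n < rat q
  have hd : DfnP 𝓜 fun p : (Unit × 𝓜.C Ty.N) × 𝓜.C Ty.one => P p.1.2 p.2 := by
    dsimp only [P, Pair]
    infer_instance
  obtain ⟨B, hB⟩ := exists_isSetOf_seq P (by
    rintro c x y hx hy h ⟨p, q, hc, h1, h2, h3⟩
    exact ⟨p, q, hc, h1, h.gt hx h2, h.lt hx h3⟩)
  refine h𝒮.union B A (fun c => ⟨(hB c).1, ?_⟩) hA.1 fun x hx => ?_
  · obtain ⟨p, q, hc⟩ := exists_unpair c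
    by_cases h : Gt x₀ (rat p) ∧ Lt x₀ (rat q)
    · refine h𝒮.mem_empty ⟨(hB c).1, fun x hx => ((hB c).2 x hx).trans ⟨?_, False.elim⟩⟩
      rintro ⟨p', q', hc', h', -⟩
      obtain ⟨rfl, rfl⟩ := hc.unique hc'
      exact h' h
    · refine h𝒮.mem_Ioo (p := rat p) (q := rat q)
        ⟨(hB c).1, fun x hx => ((hB c).2 x hx).trans ⟨?_, fun h' => ⟨p, q, hc, h, h'⟩⟩⟩
      rintro ⟨p', q', hc', -, h'⟩
      obtain ⟨rfl, rfl⟩ := hc.unique hc'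
      exact h'
  · rw [hA.2 x hx]
    simp only [fun c => (hB c).2 x hx]
    constructor
    · intro hne
      have hub : ∃ q, Lt x q := ⟨rat (x ⬝ 0) + pw 0 + 1, 0, by linarith⟩
      have hlb : ∃ q, Gt x q := ⟨rat (x ⬝ 0) - pw 0 - 1, 0, by linarith⟩
      -- A rational between x and x₀ is one endpoint; the other is any bound for x on the far side.
      obtain ⟨p, q, hp, hq, h⟩ : ∃ p q, Gt x p ∧ Lt x q ∧ ¬ (Gt x₀ p ∧ Lt x₀ q) := by
        obtain h | h := ltR_or_of_not_eqR hne
        · obtain ⟨q, h1, h2⟩ := (ltR_iff hx hx₀).1 h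
          obtain ⟨p, hp⟩ := hlb
          exact ⟨p, q, hp, h1, fun h => lt_irrefl _ (h2.lt_of_lt hx₀ h.2)⟩
        · obtain ⟨p, h1, h2⟩ := (ltR_iff hx₀ hx).1 h
          obtain ⟨q, hq⟩ := hub
          exact ⟨p, q, h2, hq, fun h => lt_irrefl _ (h.1.lt_of_lt hx₀ h1)⟩
      obtain ⟨a, rfl⟩ := exists_rat_eq p
      obtain ⟨b, rfl⟩ := exists_rat_eq q
      obtain ⟨c, hc⟩ := exists_pair a b
      exact ⟨c, a, b, hc, h, hp, hq⟩
    · rintro ⟨c, p, q, -, h, h1, h2⟩ heq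
      exact h ⟨heq.gt hx h1, heq.lt hx h2⟩

theorem mem_singleton (h𝒮 : IsSigmaAlgebra 𝒮) {x₀ : 𝓜.C Ty.one} (hx₀ : IsReal x₀)
    {A : 𝓜.C Ty.two} (hA : IsSetOf A fun x => EqR x x₀) : 𝒮 ⬝ A = 1 := by
  obtain ⟨B, hB⟩ := exists_isSetOf (fun x => ¬ EqR x x₀) (by
    intro x y hx hy h hne hy'
    exact hne ((hA.2 x hx).1 ((hA.1.2 x y hx hy h).trans ((hA.2 y hy).2 hy'))))
  refine h𝒮.compl B A hB.1 hA.1 (h𝒮.mem_ne hx₀ hB) fun x hx => ?_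
  rw [hA.2 x hx, hB.2 x hx, not_not]

end IsSigmaAlgebra

/-- Split the set by the value of `Y`. Each part is empty or one point by injectivity, and the
sequence of parts is internal, so each σ-algebra contains the union. -/
theorem IsInjGauge.exists_borel {Y : 𝓜.C Ty.two} (hY : IsInj Y) {Ψ : 𝓜.C (Ty.one ⟶ₜ Ty.one)}
    (hΨ : ∀ x y, Y ⬝ x = Y ⬝ y → Ψ ⬝ x = Ψ ⬝ y) (a : 𝓜.C Ty.one) :
    ∃ B : 𝓜.C Ty.two, (IsSet B ∧ ∀ 𝒮 : 𝓜.C (Ty.two ⟶ₜ Ty.N), IsSigmaAlgebra 𝒮 → 𝒮 ⬝ B = 1) ∧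
      ∀ x, IsReal x → (B ⬝ x = 1 ↔ InUnit x ∧ LtR a (Ψ ⬝ x)) := by
  have hresp : ∀ x y, InUnit x → IsReal y → EqR x y → InUnit y ∧ Y ⬝ x = Y ⬝ y :=
    fun x y hx hy h => ⟨hx.congr hy h, (hY x y hx (hx.congr hy h)).1 h⟩
  obtain ⟨B, hB⟩ := exists_isSetOf (fun x => InUnit x ∧ LtR a (Ψ ⬝ x)) (by
    rintro x y - hy h ⟨hx, hlt⟩
    obtain ⟨h1, h2⟩ := hresp x y hx hy h
    exact ⟨h1, hΨ x y h2 ▸ hlt⟩)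
  obtain ⟨A, hA⟩ := exists_isSetOf_seq
    (fun m x => InUnit x ∧ Y ⬝ x = m ∧ LtR a (Ψ ⬝ x)) (by
    rintro m x y - hy h ⟨hx, hm, hlt⟩
    obtain ⟨h1, h2⟩ := hresp x y hx hy h
    exact ⟨h1, h2 ▸ hm, hΨ x y h2 ▸ hlt⟩)
  refine ⟨B, ⟨hB.1, fun 𝒮 h𝒮 => h𝒮.union A B (fun m => ⟨(hA m).1, ?_⟩) hB.1 fun x hx => ?_⟩, hB.2⟩
  · by_cases h : ∃ x, InUnit x ∧ Y ⬝ x = m ∧ LtR a (Ψ ⬝ x)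
    · obtain ⟨x₀, hx₀, hm, hlt⟩ := h
      refine h𝒮.mem_singleton hx₀.1 ⟨(hA m).1, fun x hx => ((hA m).2 x hx).trans ⟨?_, ?_⟩⟩
      · rintro ⟨h1, h2, -⟩
        exact (hY x x₀ h1 hx₀).2 (h2.trans hm.symm)
      · intro h
        obtain ⟨h1, h2⟩ := hresp x₀ x hx₀ hx h.symm
        exact ⟨h1, h2 ▸ hm, hΨ _ _ h2 ▸ hlt⟩
    · exact h𝒮.mem_empty ⟨(hA m).1, fun x hx => ((hA m).2 x hx).trans
        ⟨fun h' => h ⟨x, h'⟩, False.elim⟩⟩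
  · rw [hB.2 x hx]
    simp only [fun m => (hA m).2 x hx]
    exact ⟨fun h => ⟨_, h.1, rfl, h.2⟩, fun ⟨m, h1, _, h2⟩ => ⟨h1, h2⟩⟩

end Mdl

theorem ACA_proves_HBUBorel_imp_NIN : ACA.Proves (HBUBorel _ ⇒ₒ NIN _) := by
  refine ACA.proves_of_forall_models ACA_closed ACA_extensional _ fun 𝓜 h𝓜 ρ => ?_
  obtain ⟨𝓜, rfl⟩ := h𝓜.mdl
  intro hHBU
  rw [Mdl.sat_NIN]
  rintro ⟨Y, hY⟩
  obtain ⟨Ψ, hΨ, hΨ'⟩ := Mdl.exists_injGauge Y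
  refine Mdl.not_hasFiniteCover hY hΨ ?_
  have h := hHBU Ψ ((Mdl.sat_isGauge _ _).2 (hΨ.isGauge hY hΨ'))
    (Mdl.sat_isBorelFun _ _ fun a _ => Mdl.IsInjGauge.exists_borel hY hΨ' a)
  exact (Mdl.sat_hasFiniteCover _ _).1 h

/-! ### Upper semi-continuous gauges -/

namespace Mdl

variable {𝓜 : Mdl}

theorem ltAddR_cst {x y : 𝓜.C Ty.one} (hx : IsReal x) (hy : IsReal y) {r : 𝓜.C Ty.N} :
    LtAddR x y (cst r) ↔ ∃ q, Lt x q ∧ Gt y (q - rat r) := by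
  simp only [LtAddR, rat_cst]
  constructor
  · rintro ⟨n, hn⟩
    have := pw_pos n
    exact ⟨rat (x ⬝ n) + 2 * pw n, ⟨n, by linarith⟩, n, by linarith⟩
  · rintro ⟨q, h, h'⟩
    obtain ⟨e, he, n, hn⟩ := h.exists_forall hx
    obtain ⟨e', he', n', hn'⟩ := h'.exists_forall hy
    obtain ⟨m, hm, hme⟩ := exists_pw_lt_of_le (show 0 < e / 4 by linarith) (max n n')
    exact ⟨m, by linarith [hn m ((le_max_left _ _).trans hm), hn' m ((le_max_right _ _).trans hm)]⟩

theorem InBall.of_eqR {x y z : 𝓜.C Ty.one} (hx : IsReal x) (hy : IsReal y) (hz : IsReal z)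
    {r s : 𝓜.C Ty.N} (h : InBall x y (cst r)) (hxz : EqR x z) (hrs : rat r ≤ rat s) :
    InBall z y (cst s) := by
  rw [InBall, ltAddR_cst hz hy, ltAddR_cst hy hz]
  obtain ⟨⟨p, h1, h2⟩, ⟨q, h3, h4⟩⟩ := h.gt_lt
  exact ⟨⟨p, hxz.lt hx h1, h2.mono (by linarith)⟩, q, h3, (hxz.gt hx h4).mono (by linarith)⟩

/-- A rational below one of the reals can be raised a little and stay below it; a ball smaller than
this slack carries the original rational over to the other real. -/
theorem eqR_of_forall_inBall {x y : 𝓜.C Ty.one} (hx : IsReal x) (hy : IsReal y)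
    (h : ∀ n : 𝓜.C Ty.N, ∃ r, rat r = pw n ∧ InBall x y (cst r)) : EqR x y := by
  refine eqR_of_gt hx hy fun q => ⟨fun hq => ?_, fun hq => ?_⟩ <;>
    obtain ⟨p, hp, hq⟩ := hq.exists_gt <;>
    obtain ⟨n, hn⟩ := exists_pw_lt (sub_pos.2 hp) <;>
    obtain ⟨r, hr, hb⟩ := h n <;>
    obtain ⟨⟨p₁, h1, h2⟩, ⟨p₂, h3, h4⟩⟩ := hb.gt_lt
  · exact h2.mono (by linarith [hq.lt_of_lt hx h1])
  · exact h4.mono (by linarith [hq.lt_of_lt hy h3])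

theorem eq_one_of_le {a : 𝓜.C Ty.N} (h : a ≤ 1) (h0 : a ≠ 0) : a = 1 := by
  obtain h1 | ⟨m, rfl⟩ := eq_zero_or a
  · exact absurd h1 h0
  · exact le_antisymm h le_add_self

/-- A real number can be recovered from the characteristic function of its lower cut. -/
theorem exists_cutReal (𝓜 : Mdl) : ∃ G : 𝓜.C (Ty.one ⟶ₜ Ty.one), ∀ x f : 𝓜.C Ty.one, IsReal x →
    (∀ c, f ⬝ c = 1 ↔ Gt x (rat c)) → IsReal (G ⬝ f) ∧ EqR (G ⬝ f) x := by
  -- The n-th approximation is a rational in the cut with some rational outside the cut at most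
  -- 2^(-(n+1)) above it.
  obtain ⟨g, hg, h⟩ := Dfn.choose fun (p : (Unit × 𝓜.C Ty.one) × 𝓜.C Ty.N) c =>
    p.1.2 ⬝ c = 1 ∧ ∃ c', ¬ p.1.2 ⬝ c' = 1 ∧ rat c' ≤ rat c + pw (p.2 + 1)
  obtain ⟨g₁, hg₁, h₁⟩ := Dfn.lam fun (p : Unit × 𝓜.C Ty.one) n => g (p, n)
  obtain ⟨G, hG⟩ := Dfn.exists_elt (fun f => g₁ ((), f)) (hf := hg₁)
  refine ⟨G, fun x f hx hf => ?_⟩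
  have hin : ∀ n, Gt x (rat (G ⬝ f ⬝ n)) ∧ ¬ Gt x (rat (G ⬝ f ⬝ n) + pw (n + 1)) := by
    intro n
    rw [hG, h₁]
    obtain ⟨h2, c', h3, h4⟩ := h (((), f), n) (by
      -- Such rationals lie at distance 2 · 2^(-(n+3)) on either side of x(n+3), so their gap is
      -- exactly 2^(-(n+1)).
      obtain ⟨c, hc⟩ := exists_rat_eq (rat (x ⬝ (n + 1 + 1 + 1)) - 2 * pw (n + 1 + 1 + 1))
      obtain ⟨c', hc'⟩ := exists_rat_eq (rat (x ⬝ (n + 1 + 1 + 1)) + 2 * pw (n + 1 + 1 + 1))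
      have h0 := pw_pos (n + 1 + 1 + 1)
      refine ⟨c, (hf c).2 ⟨n + 1 + 1 + 1, by linarith⟩, c', fun h' => ?_, ?_⟩
      · have := ((hf c').1 h').lt_of_lt (q := rat c') hx ⟨n + 1 + 1 + 1, by linarith⟩
        exact lt_irrefl _ this
      · linarith [pw_add_one (n + 1), pw_add_one (n + 1 + 1)])
    dsimp only at h2 h3 h4
    exact ⟨(hf _).1 h2, fun h5 => h3 ((hf c').2 (h5.mono h4))⟩
  have hlt : ∀ {p q}, Gt x p → ¬ Gt x q → p < q := fun hp hq => by
    by_contra h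
    exact hq (hp.mono (not_lt.1 h))
  have hreal : IsReal (G ⬝ f) := fun n i => by
    have h1 := hlt (hin n).1 (hin (n + i)).2
    have h2 := hlt (hin (n + i)).1 (hin n).2
    have h3 := pw_add_one n
    have h4 := pw_pos (n + 1)
    have h5 : pw (n + i + 1) ≤ pw (n + 1) := by
      rw [add_right_comm]
      exact pw_add_le _ _
    constructor <;> linarith
  refine ⟨hreal, eqR_of_gt hreal hx fun q => ⟨?_, fun hq => ?_⟩⟩
  · rintro ⟨n, hn⟩
    exact (hin n).1.mono (by linarith [pw_pos n])
  · obtain ⟨p, hp, hq⟩ := hq.exists_gt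
    obtain ⟨n, hn⟩ := exists_pw_lt (show 0 < (p - q) / 2 by linarith)
    exact ⟨n, by linarith [hlt hq (hin n).2, pw_add_one n, pw_pos (n + 1)]⟩

theorem exists_cut {x : 𝓜.C Ty.one} : ∃ f : 𝓜.C Ty.one, (∀ c, f ⬝ c ≤ 1) ∧
    ∀ c, f ⬝ c = 1 ↔ Gt x (rat c) := by
  obtain ⟨f, hf⟩ := DfnP.exists_char_elt (fun c : 𝓜.C Ty.N => ∃ n, rat c + pw n < rat (x ⬝ n))
  change ∀ c, (Gt x (rat c) ∧ f ⬝ c = 1) ∨ (¬ Gt x (rat c) ∧ f ⬝ c = 0) at hf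
  refine ⟨f, fun c => ?_, fun c => ?_⟩
  · obtain ⟨-, h⟩ | ⟨-, h⟩ := hf c <;> rw [h]
    exact zero_le_one
  · obtain ⟨h1, h⟩ | ⟨h1, h⟩ := hf c <;> rw [h]
    · exact ⟨fun _ => h1, fun _ => rfl⟩
    · exact ⟨fun h => absurd h zero_ne_one, fun h => absurd h h1⟩

/-- `f` is the cut of the point `G f` of `[0,1]`, at which `Y` has the value `m`. -/
def IsCutAt (G : 𝓜.C (Ty.one ⟶ₜ Ty.one)) (Y : 𝓜.C Ty.two) (f : 𝓜.C Ty.one) (m : 𝓜.C Ty.N) : Prop :=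
  -- The point is computed as `G f` instead of quantified: only number quantifiers are known to
  -- preserve definability.
  InUnit (G ⬝ f) ∧ (∀ c, f ⬝ c = 1 ↔ Gt (G ⬝ f) (rat c)) ∧ Y ⬝ (G ⬝ f) = m

instance (G : 𝓜.C (Ty.one ⟶ₜ Ty.one)) (Y : 𝓜.C Ty.two) :
    DfnP 𝓜 fun p : (Unit × 𝓜.C Ty.one) × 𝓜.C Ty.N => IsCutAt G Y p.1.2 p.2 := by
  unfold IsCutAt Gt
  infer_instance

/-- By `IND₀`, every point of `[0,1]` has a neighbourhood in which `Y` exceeds its value there. -/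
theorem exists_isolating {V : Ty → Type} {ρ : (τ : Ty) → V τ → 𝓜.C τ} (hIND : (IND V).Sat ρ)
    {Y : 𝓜.C Ty.two} (hY : IsInj Y) {x₀ : 𝓜.C Ty.one} (hx₀ : InUnit x₀) :
    ∃ r : 𝓜.C Ty.N, 0 < rat r ∧ ∀ x, InUnit x → InBall x x₀ (cst r) → ¬ EqR x x₀ →
      Y ⬝ x₀ < Y ⬝ x := by
  classical
  obtain ⟨G, hG⟩ := 𝓜.exists_cutReal
  obtain ⟨g, hg, hgD⟩ := Dfn.lam fun (p : Unit × 𝓜.C Ty.one) (m : 𝓜.C Ty.N) =>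
    if IsCutAt G Y p.2 m then (0 : 𝓜.C Ty.N) else 1
  obtain ⟨Z, hZg⟩ := Dfn.exists_elt (fun f => g ((), f)) (hf := hg)
  have hZ : ∀ f m, Z ⬝ f ⬝ m = 0 ↔ IsCutAt G Y f m := fun f m => by
    rw [hZg, hgD]
    by_cases h : IsCutAt G Y f m <;> simp [h]
  -- Uniqueness: codes with the same Y-value name equal reals, so their cuts agree; binary functions
  -- with the same cut are identical by extensionality.
  obtain ⟨l, w, hw⟩ := of_sat_IND ρ hIND Z (by
    intro n f f' hf hf' h h'
    rw [hZ] at h h'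
    have heq := (hY _ _ h.1 h'.1).2 (h.2.2.trans h'.2.2.symm)
    refine 𝓜.ext fun c => ?_
    have h1 : f ⬝ c = 1 ↔ f' ⬝ c = 1 := (h.2.1 c).trans
      (Iff.trans ⟨heq.gt h.1.1, heq.symm.gt h'.1.1⟩ (h'.2.1 c).symm)
    by_cases h0 : f ⬝ c = 0
    · by_contra hne
      have := h1.2 (eq_one_of_le (hf' c) fun h2 => hne (h0.trans h2.symm))
      exact zero_ne_one (h0.symm.trans this)
    · have h2 := eq_one_of_le (hf c) h0
      exact h2.trans (h1.1 h2).symm) (Y ⬝ x₀)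
  obtain ⟨e, he⟩ := Dfn.choose_elt (fun (n q : 𝓜.C Ty.N) => rat q = pw n)
  replace he : ∀ n, rat (e ⬝ n) = pw n := fun n => he n (exists_rat_eq _)
  -- For each listed point, `s` finds a level at which it is outside the ball about x₀, if there is
  -- one; a bound `B` on these levels gives the radius.
  obtain ⟨s, hs⟩ := Dfn.choose_elt
    (fun i n : 𝓜.C Ty.N => ¬ InBall (G ⬝ (w ⬝ i)) x₀ (cst (e ⬝ n)))
    (hP := by unfold InBall LtAddR; infer_instance)
  obtain ⟨B, hB⟩ := exists_bound s l
  refine ⟨e ⬝ B, by rw [he]; exact pw_pos B, fun x hx hball hne => ?_⟩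
  by_contra hle
  obtain ⟨f, hf, hfx⟩ := exists_cut (x := x)
  obtain ⟨hr, hfe⟩ := hG x f hx.1 hfx
  have hGf : InUnit (G ⬝ f) := hx.congr hr hfe.symm
  have hDf : IsCutAt G Y f (Y ⬝ x) := ⟨hGf, fun c => (hfx c).trans ⟨hfe.symm.gt hx.1, hfe.gt hr⟩,
    (hY _ _ hGf hx).1 hfe⟩
  -- A point x with Y(x) ≤ Y(x₀) has its cut as a witness, so the list contains a code of the same
  -- real.
  obtain ⟨i, hi, -, hZi⟩ := (hw (Y ⬝ x) (not_lt.1 hle)).2 ⟨f, hf, (hZ _ _).2 hDf⟩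
  obtain ⟨hz, -, hzY⟩ := (hZ _ _).1 hZi
  have hzx : EqR (G ⬝ (w ⬝ i)) x := (hY _ _ hz hx).2 hzY
  refine hs i ?_ (hball.of_eqR hx.1 hx₀.1 hz.1 hzx.symm ?_)
  -- Without such a level the listed point equals x₀, and then so does x.
  · by_contra hall
    rw [not_exists_not] at hall
    have h1 := eqR_of_forall_inBall hz.1 hx₀.1 fun n => ⟨_, he n, hall n⟩
    exact hne ((hY _ _ hx hx₀).2 (hzY.symm.trans ((hY _ _ hz hx₀).1 h1)))
  · rw [he, he]
    exact pw_le (hB i hi.le)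

/-- In the isolating neighbourhood Ψ even attains its maximum at x₀, so one radius serves for every
ε. -/
theorem IsInjGauge.isUSC {V : Ty → Type} {ρ : (τ : Ty) → V τ → 𝓜.C τ} (hIND : (IND V).Sat ρ)
    {Y : 𝓜.C Ty.two} (hY : IsInj Y) {Ψ : 𝓜.C (Ty.one ⟶ₜ Ty.one)} (hΨ : IsInjGauge Y Ψ) :
    IsUSC Ψ := by
  intro x₀ hx₀ ε hε hε0
  obtain ⟨d, hd, hiso⟩ := exists_isolating hIND hY hx₀
  refine ⟨cst d, isReal_cst d, ?_, fun x hx hball => ?_⟩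
  · rw [cst_ltR (isReal_cst d), gt_cst, rat_zero]
    exact hd
  obtain ⟨r, hr, hr'⟩ := hΨ x
  obtain ⟨r₀, hr₀, hr₀'⟩ := hΨ x₀
  have hle : rat r ≤ rat r₀ := by
    rw [hr', hr₀']
    refine pw_le ?_
    have hY' : Y ⬝ x₀ ≤ Y ⬝ x := by
      by_cases h : EqR x x₀
      · exact ((hY _ _ hx hx₀).1 h).ge
      · exact (hiso x hx hball h).le
    gcongr
  rw [cst_ltR hε, rat_zero] at hε0
  obtain ⟨e, he, n, hn⟩ := hε0.exists_forall hε
  -- `LtAddR` requires 4 · 2^(-m) of room, which the positive ε supplies at a late stage.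
  obtain ⟨m, hm, hme⟩ := exists_pw_lt_of_le (show 0 < e / 4 by linarith) n
  refine ⟨m, ?_⟩
  rw [hr, hr₀, rat_cst, rat_cst]
  linarith [hn m hm]

end Mdl

theorem ACA_IND_proves_HBUsemi_imp_NIN : (ACA.plus IND).Proves (HBUsemi _ ⇒ₒ NIN _) := by
  refine (ACA.plus IND).proves_of_forall_models ACA_IND_closed ACA_IND_extensional _
    fun 𝓜 h𝓜 ρ => ?_
  have hACA : 𝓜.Models ACA := fun ψ hψ => h𝓜 ψ (.inr hψ)
  obtain ⟨𝓜, rfl⟩ := hACA.mdl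
  have hIND := h𝓜 _ (.inl rfl) ρ
  intro hHBU
  rw [Mdl.sat_NIN]
  rintro ⟨Y, hY⟩
  obtain ⟨Ψ, hΨ, hΨ'⟩ := Mdl.exists_injGauge Y
  refine Mdl.not_hasFiniteCover hY hΨ ?_
  have h := hHBU Ψ ((Mdl.sat_isGauge _ _).2 (hΨ.isGauge hY hΨ'))
    ((Mdl.sat_isUSC _ _).2 (hΨ.isUSC hIND hY))
  exact (Mdl.sat_hasFiniteCover _ _).1 h

end HigherOrder

theorem mainTheorem3 :
    (HigherOrder.ACA.plus HigherOrder.IND).Proves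
        (HigherOrder.Fm.imp (HigherOrder.HBUsemi _) (HigherOrder.NIN _)) ∧
      HigherOrder.ACA.Proves
        (HigherOrder.Fm.imp (HigherOrder.HBUBorel _) (HigherOrder.NIN _)) :=
  ⟨HigherOrder.ACA_IND_proves_HBUsemi_imp_NIN, HigherOrder.ACA_proves_HBUBorel_imp_NIN⟩
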